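/- Let $k$ be a field; algebras are associative $k$-algebras, with or without unit, whose product is nondegenerate. For an algebra $A$, $M(A)$ is the multiplier algebra, i.e. the algebra of pairs $m=(m_1,m_2)$ of linear endomorphisms of $A$ with $m_2(a)b=a\,m_1(b)$; write $ma=m_1(a)$, $am=m_2(a)$, and regard $A\subseteq M(A)$. Let $(Q,\Delta)$ be a regular multiplier Hopf algebra: $\Delta:Q\to M(Q\otimes Q)$ is a homomorphism such that $T_1(x\otimes y)=\Delta(x)(1\otimes y)$ and $T_2(x\otimes y)=(x\otimes1)\Delta(y)$ take values in $Q\otimes Q$, are bijective on $Q\otimes Q$ and satisfy $(T_2\otimes \mathrm{id})(\mathrm{id}\otimes T_1)=(\mathrm{id}\otimes T_1)(T_2\otimes \mathrm{id})$, and the same holds for $\Delta$ followed by the flip. Let $S$ be its (bijective) antipode. Sweedler notation is used throughout, each leg of a (co)product being covered by a suitable element of $Q$, directly or through a unital action. *Long module algebras.* A left $Q$-module algebra is an algebra $A$ with a left $Q$-action $\triangleright$ that is unital (for each $a$ there is $e\in Q$ with $e\triangleright a=a$) and satisfies $x\triangleright(ab)=\sum(x_1\triangleright a)(x_2\triangleright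 b)$; right $Q$-module algebras ($(ab)\triangleleft x=\sum(a\triangleleft x_1)(b\triangleleft x_2)$) are defined likewise. $A$ is a $Q$-bimodule algebra if it is both and $(x\triangleright a)\triangleleft y=x\triangleright(a\triangleleft y)$. A left $Q$-comodule algebra is an algebra $A$ with an injective homomorphism $\Gamma:A\to M(Q\otimes A)$, $\Gamma(a)=\sum a_{(-1)}\otimes a_0$, such that $\Gamma(a)(x\otimes1),(x\otimes1)\Gamma(a)\in Q\otimes A$ and $(\mathrm{id}\otimes\Gamma)\Gamma=(\Delta\otimes \mathrm{id})\Gamma$; right $Q$-comodule algebras, with $\Upsilon:A\to M(A\otimes Q)$, $\Upsilon(a)=\sum a_0\otimes a_{(1)}$, are defined likewise. $A$ is a $Q$-bicomodule algebra if it is both and $(1\otimes1\otimes x)\big((\mathrm{id}\otimes\Upsilon)(\Gamma(a)(y\otimes1))\big)=\big((\Gamma\otimes \mathrm{id})((1\otimes x)\Upsilon(a))\big)(y\otimes1\otimes1)$. A left $Q$-Long module algebra is a left $Q$-module and left $Q$-comodule algebra with $\Gamma(x\triangleright a)(y\otimes1)=\sum a_{(-1)}y\otimes x\triangleright a_0$;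 its left twisted product is $a\bullet b=\sum a_0(a_{(-1)}\triangleright b)$. A four-sided $Q$-Long module algebra, $A\in{}^Q_Q\mathcal{LA}^Q_Q$, is a $Q$-bimodule and $Q$-bicomodule algebra such that $$\Gamma(x\triangleright a)(y\otimes1)=\sum a_{(-1)}y\otimes x\triangleright a_0,\qquad \Upsilon(x\triangleright a)(1\otimes y)=\sum x\triangleright a_0\otimes a_{(1)}y,$$ $$\Upsilon(a\triangleleft x)(1\otimes y)=\sum a_0\triangleleft x\otimes a_{(1)}y,\qquad \Gamma(a\triangleleft x)(y\otimes1)=\sum a_{(-1)}y\otimes a_0\triangleleft x .$$ Its L-R-twisted product is $a\circledast b=\sum(a_0\triangleleft b_{(1)})(a_{(-1)}\triangleright b_0)$. **Theorem 4.6.** Let $A\in{}^Q_Q\mathcal{LA}^Q_Q$. (1) $Q\otimes Q^{op}$, with comultiplication $x\otimes y\mapsto\sum(x_1\otimes y_1)\otimes(x_2\otimes y_2)$, is a regular multiplier Hopf algebra, and $A$ is a left $Q\otimes Q^{op}$-Long module algebra with the action $(x\otimes y)\triangleright a=x\triangleright a\triangleleft y$ and the coaction $a\mapsto\sum a_{(-1)}\otimes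 S^{-1}(a_{(1)})\otimes a_0$. (2) The left twisted product $\bullet$ of this $Q\otimes Q^{op}$-Long module algebra, i.e. $a\bullet b=\sum a_0\,(a_{(-1)}\triangleright b\triangleleft S^{-1}(a_{(1)}))$, and the L-R-twisted product $\circledast$ are well-defined associative products on $A$, and $$\alpha:(A,\bullet)\to(A,\circledast),\qquad a\mapsto\sum a_0\triangleleft a_{(1)},$$ is an isomorphism of algebras with inverse $a\mapsto\sum a_0\triangleleft S^{-1}(a_{(1)})$. (3) Each of the following four formulas gives a well-defined associative product on $A\otimes A$: - $A\diamond^Q_rA$: $\ (b\otimes a)(d\otimes c)=\sum b_0d_0\otimes(a\triangleleft d_{(1)})(b_{(-1)}\triangleright c)$, - $A\star^Q_rA$: $\ (b\otimes c)(d\otimes a)=\sum bd_0\otimes(S^{-1}(d_{(-1)})\triangleright c\triangleleft d_{(1)})\,a$, - $A\diamond^Q_lA$: $\ (a\otimes b)(c\otimes d)=\sum(a\triangleleft d_{(1)})(b_{(-1)}\triangleright c)\otimes b_0d_0$, - $A\star^Q_lA$: $\ (a\otimes b)(c\otimes d)=\sum a\,(b_{(-1)}\triangleright c\triangleleft S^{-1}(b_{(1)}))\otimes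 b_0d$, and there are algebra isomorphisms $A\diamond^Q_rA\cong A\star^Q_rA$ and $A\diamond^Q_lA\cong A\star^Q_lA$. -/

import Mathlib

open scoped TensorProduct

namespace MultHopf

noncomputable section

universe u v w w'

/-! ### Multiplier algebras of associative algebras, possibly without unit -/

section Multipliers

variable (k : Type u) [Field k]
variable (A : Type v) [NonUnitalRing A] [Module k A] [IsScalarTower k A A] [SMulCommClass k A A]
variable (B : Type w) [NonUnitalRing B] [Module k B] [IsScalarTower k B B] [SMulCommClass k B B]

instance opIsScalarTower : IsScalarTower k Aᵐᵒᵖ Aᵐᵒᵖ :=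
  ⟨fun c x y => MulOpposite.unop_injective (mul_smul_comm c y.unop x.unop)⟩

instance opSMulCommClass : SMulCommClass k Aᵐᵒᵖ Aᵐᵒᵖ :=
  ⟨fun c x y => MulOpposite.unop_injective (smul_mul_assoc c y.unop x.unop).symm⟩

/-- The product of `A` is nondegenerate. -/
def IsNondegenerate : Prop :=
  (∀ a : A, (∀ b : A, a * b = 0) → a = 0) ∧ (∀ a : A, (∀ b : A, b * a = 0) → a = 0)

/-- The multiplier algebra `M(A)`: all pairs `m = (m₁, m₂)` of linear endomorphisms of `A` with
`m₂(a) b = a m₁(b)`; here `m₁(a) = m a` and `m₂(a) = a m`, and the product of `m` and `n` is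
`(m₁ ∘ n₁, n₂ ∘ m₂)`. -/
def multiplierAlgebra : Subalgebra k (Module.End k A × (Module.End k A)ᵐᵒᵖ) where
  carrier := {m | ∀ a b : A, m.2.unop a * b = a * m.1 b}
  mul_mem' := by
    intro m n hm hn a b
    have h1 := hn (m.2.unop a) b
    have h2 := hm a (n.1 b)
    simpa using h1.trans h2
  add_mem' := by
    intro m n hm hn a b
    have h1 := hm a b
    have h2 := hn a b
    simp [add_mul, mul_add, h1, h2]
  algebraMap_mem' := by
    intro c a b
    simp [Algebra.algebraMap_eq_smul_one, smul_mul_assoc, mul_smul_comm]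

/-- `M(A)` as a (unital) algebra. -/
abbrev Multiplier : Type v := ↥(multiplierAlgebra k A)

/-- The embedding `A → M(A)`, `a ↦ (a ·, · a)`. -/
def embed : A →ₗ[k] Multiplier k A where
  toFun a := ⟨(LinearMap.mulLeft k a, MulOpposite.op (LinearMap.mulRight k a)),
    fun b c => by simp [mul_assoc]⟩
  map_add' a b := by
    apply Subtype.ext
    refine Prod.ext ?_ (MulOpposite.unop_injective ?_) <;> ext c <;>
      simp [add_mul, mul_add]
  map_smul' r a := by
    apply Subtype.ext
    refine Prod.ext ?_ (MulOpposite.unop_injective ?_) <;> ext c <;>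
      simp [smul_mul_assoc, mul_smul_comm]

/-- The element of `A` represented by a multiplier that lies in the image of `A ↪ M(A)`: a linear
left inverse of the embedding. It is only used for multipliers that lie in `A`. -/
def elt : Multiplier k A →ₗ[k] A := (embed k A).leftInverse

variable {k A B}

/-- The multiplier `m ⊗ n` of `A ⊗ B`. -/
def tmulAux (m : Multiplier k A) (n : Multiplier k B) : Multiplier k (A ⊗[k] B) :=
  ⟨(TensorProduct.map m.1.1 n.1.1,
    MulOpposite.op (TensorProduct.map m.1.2.unop n.1.2.unop)), by
    intro s t
    induction s with
    | zero => simp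
    | add x y hx hy => simp only [map_add, add_mul, hx, hy]
    | tmul a b =>
      induction t with
      | zero => simp
      | add x y hx hy => simp only [map_add, mul_add, hx, hy]
      | tmul c d =>
        have h1 := m.2 a c
        have h2 := n.2 b d
        simp [h1, h2]⟩

/-- The canonical bilinear map `M(A) × M(B) → M(A ⊗ B)`. -/
def tmulM : Multiplier k A →ₗ[k] Multiplier k B →ₗ[k] Multiplier k (A ⊗[k] B) :=
  LinearMap.mk₂ k tmulAux
    (fun m m' n => by
      apply Subtype.ext
      exact Prod.ext (TensorProduct.map_add_left _ _ _)
        (MulOpposite.unop_injective (TensorProduct.map_add_left _ _ _)))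
    (fun c m n => by
      apply Subtype.ext
      exact Prod.ext (TensorProduct.map_smul_left _ _ _)
        (MulOpposite.unop_injective (TensorProduct.map_smul_left _ _ _)))
    (fun m n n' => by
      apply Subtype.ext
      exact Prod.ext (TensorProduct.map_add_right _ _ _)
        (MulOpposite.unop_injective (TensorProduct.map_add_right _ _ _)))
    (fun c m n => by
      apply Subtype.ext
      exact Prod.ext (TensorProduct.map_smul_right _ _ _)
        (MulOpposite.unop_injective (TensorProduct.map_smul_right _ _ _)))

/-- Transport of multipliers along a multiplicative linear isomorphism. -/
def congrM (e : A ≃ₗ[k] B) (he : ∀ x y, e (x * y) = e x * e y) :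
    Multiplier k A →ₗ[k] Multiplier k B where
  toFun m := ⟨(e.toLinearMap ∘ₗ m.1.1 ∘ₗ e.symm.toLinearMap,
      MulOpposite.op (e.toLinearMap ∘ₗ m.1.2.unop ∘ₗ e.symm.toLinearMap)), by
    intro a b
    have h := congrArg e (m.2 (e.symm a) (e.symm b))
    simpa [he] using h⟩
  map_add' m n := by
    apply Subtype.ext
    refine Prod.ext ?_ (MulOpposite.unop_injective ?_) <;> ext c <;> simp
  map_smul' r m := by
    apply Subtype.ext
    refine Prod.ext ?_ (MulOpposite.unop_injective ?_) <;> ext c <;> simp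

/-- A multiplier of `A` regarded as a multiplier of `Aᵐᵒᵖ` (its two components are exchanged). -/
def opM : Multiplier k A →ₗ[k] Multiplier k Aᵐᵒᵖ where
  toFun m := ⟨((MulOpposite.opLinearEquiv k).toLinearMap ∘ₗ m.1.2.unop ∘ₗ
        (MulOpposite.opLinearEquiv k).symm.toLinearMap,
      MulOpposite.op ((MulOpposite.opLinearEquiv k).toLinearMap ∘ₗ m.1.1 ∘ₗ
        (MulOpposite.opLinearEquiv k).symm.toLinearMap)), by
    intro a b
    exact MulOpposite.unop_injective (m.2 b.unop a.unop).symm⟩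
  map_add' m n := by
    apply Subtype.ext
    refine Prod.ext ?_ (MulOpposite.unop_injective ?_) <;> ext c <;> simp
  map_smul' r m := by
    apply Subtype.ext
    refine Prod.ext ?_ (MulOpposite.unop_injective ?_) <;> ext c <;> simp

end Multipliers

/-! ### Covering -/

section Covering

variable {k : Type u} [Field k]
variable {X : Type v} [NonUnitalRing X] [Module k X] [IsScalarTower k X X] [SMulCommClass k X X]
variable {Y : Type w} [NonUnitalRing Y] [Module k Y] [IsScalarTower k Y Y] [SMulCommClass k Y Y]
variable {V : Type w'} [AddCommGroup V] [Module k V]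

variable (k X Y) in
/-- `x ↦ x ⊗ 1`, from `X` to `M(X ⊗ Y)`. -/
def fstM : X →ₗ[k] Multiplier k (X ⊗[k] Y) := (tmulM.flip 1) ∘ₗ embed k X

variable (k X Y) in
/-- `y ↦ 1 ⊗ y`, from `Y` to `M(X ⊗ Y)`. -/
def sndM : Y →ₗ[k] Multiplier k (X ⊗[k] Y) := (tmulM 1) ∘ₗ embed k Y

/-- `F(v)(x ⊗ 1)` and `(x ⊗ 1)F(v)` lie in `X ⊗ Y`, for all `v` and `x`. -/
def CoveredFst (F : V →ₗ[k] Multiplier k (X ⊗[k] Y)) : Prop :=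
  ∀ v x, F v * fstM k X Y x ∈ LinearMap.range (embed k (X ⊗[k] Y)) ∧
    fstM k X Y x * F v ∈ LinearMap.range (embed k (X ⊗[k] Y))

/-- `F(v)(1 ⊗ y)` and `(1 ⊗ y)F(v)` lie in `X ⊗ Y`, for all `v` and `y`. -/
def CoveredSnd (F : V →ₗ[k] Multiplier k (X ⊗[k] Y)) : Prop :=
  ∀ v y, F v * sndM k X Y y ∈ LinearMap.range (embed k (X ⊗[k] Y)) ∧
    sndM k X Y y * F v ∈ LinearMap.range (embed k (X ⊗[k] Y))

/-- `(v, x) ↦ F(v)(x ⊗ 1)`, as an element of `X ⊗ Y`. -/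
def rightFst (F : V →ₗ[k] Multiplier k (X ⊗[k] Y)) : V →ₗ[k] X →ₗ[k] X ⊗[k] Y :=
  ((LinearMap.mul k (Multiplier k (X ⊗[k] Y))).compl₁₂ F (fstM k X Y)).compr₂ (elt k (X ⊗[k] Y))

/-- `(v, x) ↦ (x ⊗ 1)F(v)`, as an element of `X ⊗ Y`. -/
def leftFst (F : V →ₗ[k] Multiplier k (X ⊗[k] Y)) : V →ₗ[k] X →ₗ[k] X ⊗[k] Y :=
  ((LinearMap.mul k (Multiplier k (X ⊗[k] Y))).flip.compl₁₂ F (fstM k X Y)).compr₂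
    (elt k (X ⊗[k] Y))

/-- `(v, y) ↦ F(v)(1 ⊗ y)`, as an element of `X ⊗ Y`. -/
def rightSnd (F : V →ₗ[k] Multiplier k (X ⊗[k] Y)) : V →ₗ[k] Y →ₗ[k] X ⊗[k] Y :=
  ((LinearMap.mul k (Multiplier k (X ⊗[k] Y))).compl₁₂ F (sndM k X Y)).compr₂ (elt k (X ⊗[k] Y))

/-- `(v, y) ↦ (1 ⊗ y)F(v)`, as an element of `X ⊗ Y`. -/
def leftSnd (F : V →ₗ[k] Multiplier k (X ⊗[k] Y)) : V →ₗ[k] Y →ₗ[k] X ⊗[k] Y :=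
  ((LinearMap.mul k (Multiplier k (X ⊗[k] Y))).flip.compl₁₂ F (sndM k X Y)).compr₂
    (elt k (X ⊗[k] Y))

end Covering

/-! ### Multiplier Hopf algebras -/

section Hopf

variable {k : Type u} [Field k]
variable {H : Type v} [NonUnitalRing H] [Module k H] [IsScalarTower k H H] [SMulCommClass k H H]

/-- `T₁(x ⊗ y) = Δ(x)(1 ⊗ y)`. -/
def T₁ (Δ : H →ₗ[k] Multiplier k (H ⊗[k] H)) : H ⊗[k] H →ₗ[k] H ⊗[k] H :=
  TensorProduct.lift (rightSnd Δ)

/-- `T₂(x ⊗ y) = (x ⊗ 1)Δ(y)`. -/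
def T₂ (Δ : H →ₗ[k] Multiplier k (H ⊗[k] H)) : H ⊗[k] H →ₗ[k] H ⊗[k] H :=
  TensorProduct.lift (leftFst Δ).flip

/-- `Δ : H → M(H ⊗ H)` is a comultiplication: a homomorphism with `Δ(x)(1 ⊗ y)`, `(x ⊗ 1)Δ(y)` in
`H ⊗ H`, and `(T₂ ⊗ id)(id ⊗ T₁) = (id ⊗ T₁)(T₂ ⊗ id)` on `H ⊗ H ⊗ H`. -/
structure IsComultiplication (Δ : H →ₗ[k] Multiplier k (H ⊗[k] H)) : Prop where
  nondegenerate : IsNondegenerate H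
  map_mul : ∀ x y, Δ (x * y) = Δ x * Δ y
  covered₁ : ∀ x y, Δ x * sndM k H H y ∈ LinearMap.range (embed k (H ⊗[k] H))
  covered₂ : ∀ x y, fstM k H H x * Δ y ∈ LinearMap.range (embed k (H ⊗[k] H))
  coassoc : ∀ t : H ⊗[k] (H ⊗[k] H),
    TensorProduct.assoc k H H H ((T₂ Δ).rTensor H
        ((TensorProduct.assoc k H H H).symm ((T₁ Δ).lTensor H t))) =
      (T₁ Δ).lTensor H (TensorProduct.assoc k H H H ((T₂ Δ).rTensor H
        ((TensorProduct.assoc k H H H).symm t)))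

/-- `(H, Δ)` is a multiplier Hopf algebra. -/
structure IsMultiplierHopf (Δ : H →ₗ[k] Multiplier k (H ⊗[k] H)) : Prop where
  comul : IsComultiplication Δ
  bijective₁ : Function.Bijective (T₁ Δ)
  bijective₂ : Function.Bijective (T₂ Δ)

theorem comm_mul {A : Type v} [NonUnitalRing A] [Module k A] [IsScalarTower k A A]
    [SMulCommClass k A A] {B : Type w} [NonUnitalRing B] [Module k B] [IsScalarTower k B B]
    [SMulCommClass k B B] (s t : A ⊗[k] B) :
    TensorProduct.comm k A B (s * t) = TensorProduct.comm k A B s * TensorProduct.comm k A B t := by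
  induction s with
  | zero => simp
  | add x y hx hy => simp only [map_add, add_mul, hx, hy]
  | tmul a b =>
    induction t with
    | zero => simp
    | add x y hx hy => simp only [map_add, mul_add, hx, hy]
    | tmul c d => simp

/-- The opposite comultiplication `τΔ`, with `τ` the flip of `M(H ⊗ H)`. -/
def flipComul (Δ : H →ₗ[k] Multiplier k (H ⊗[k] H)) : H →ₗ[k] Multiplier k (H ⊗[k] H) :=
  congrM (TensorProduct.comm k H H) comm_mul ∘ₗ Δ

/-- `(H, Δ)` is a regular multiplier Hopf algebra. -/
structure IsRegularMultiplierHopf (Δ : H →ₗ[k] Multiplier k (H ⊗[k] H)) : Prop where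
  hopf : IsMultiplierHopf Δ
  flip_hopf : IsMultiplierHopf (flipComul Δ)

/-- `S : H → H` is the antipode of `(H, Δ)`, `ε` being the counit:
`(ε ⊗ id)(Δ(x)(1 ⊗ y)) = xy`, `(id ⊗ ε)((x ⊗ 1)Δ(y)) = xy`,
`m(S ⊗ id)(Δ(x)(1 ⊗ y)) = ε(x)y`, `m(id ⊗ S)((x ⊗ 1)Δ(y)) = ε(y)x`.
The counit and the antipode are determined by these identities. -/
def IsAntipode (Δ : H →ₗ[k] Multiplier k (H ⊗[k] H)) (S : H →ₗ[k] H) : Prop :=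
  ∃ ε : H →ₗ[k] k,
    (∀ x y, TensorProduct.lid k H (ε.rTensor H (T₁ Δ (x ⊗ₜ y))) = x * y) ∧
    (∀ x y, TensorProduct.rid k H (ε.lTensor H (T₂ Δ (x ⊗ₜ y))) = x * y) ∧
    (∀ x y, LinearMap.mul' k H (S.rTensor H (T₁ Δ (x ⊗ₜ y))) = ε x • y) ∧
    (∀ x y, LinearMap.mul' k H (S.lTensor H (T₂ Δ (x ⊗ₜ y))) = ε y • x)

end Hopf

/-! ### The multiplier Hopf algebra `Q ⊗ Qᵒᵖ` -/

section TensorOp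

variable {k : Type u} [Field k]
variable {Q : Type v} [NonUnitalRing Q] [Module k Q] [IsScalarTower k Q Q] [SMulCommClass k Q Q]

/-- `(Q ⊗ Q)ᵒᵖ ≃ Qᵒᵖ ⊗ Qᵒᵖ`, `op (x ⊗ y) ↦ op x ⊗ op y`. -/
def opTensor : (Q ⊗[k] Q)ᵐᵒᵖ ≃ₗ[k] Qᵐᵒᵖ ⊗[k] Qᵐᵒᵖ :=
  (MulOpposite.opLinearEquiv k).symm ≪≫ₗ
    TensorProduct.congr (MulOpposite.opLinearEquiv k) (MulOpposite.opLinearEquiv k)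

theorem opTensor_mul (s t : (Q ⊗[k] Q)ᵐᵒᵖ) :
    (opTensor (s * t) : Qᵐᵒᵖ ⊗[k] Qᵐᵒᵖ) = opTensor s * opTensor t := by
  obtain ⟨s, rfl⟩ := MulOpposite.op_surjective s
  obtain ⟨t, rfl⟩ := MulOpposite.op_surjective t
  rw [← MulOpposite.op_mul]
  induction s with
  | zero => simp
  | add x y hx hy => simp only [map_add, add_mul, mul_add, MulOpposite.op_add, hx, hy]
  | tmul a b =>
    induction t with
    | zero => simp
    | add x y hx hy => simp only [map_add, add_mul, mul_add, MulOpposite.op_add, hx, hy]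
    | tmul c d => simp [opTensor]

theorem tensorComm_mul {A : Type v} [NonUnitalRing A] [Module k A] [IsScalarTower k A A]
    [SMulCommClass k A A] {B : Type w} [NonUnitalRing B] [Module k B] [IsScalarTower k B B]
    [SMulCommClass k B B] (s t : (A ⊗[k] A) ⊗[k] (B ⊗[k] B)) :
    TensorProduct.tensorTensorTensorComm k A A B B (s * t) =
      TensorProduct.tensorTensorTensorComm k A A B B s *
        TensorProduct.tensorTensorTensorComm k A A B B t := by
  induction s with
  | zero => simp
  | add x y hx hy => simp only [map_add, add_mul, hx, hy]
  | tmul p q =>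
    induction t with
    | zero => simp
    | add x y hx hy => simp only [map_add, mul_add, hx, hy]
    | tmul p' q' =>
      induction p with
      | zero => simp
      | add x y hx hy => simp only [TensorProduct.add_tmul, map_add, add_mul, hx, hy]
      | tmul a b =>
        induction q with
        | zero => simp
        | add x y hx hy => simp only [TensorProduct.tmul_add, map_add, add_mul, hx, hy]
        | tmul c d =>
          induction p' with
          | zero => simp
          | add x y hx hy => simp only [TensorProduct.add_tmul, map_add, mul_add, hx, hy]
          | tmul a' b' =>
            induction q' with
            | zero => simp
            | add x y hx hy => simp only [TensorProduct.tmul_add, map_add, mul_add, hx, hy]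
            | tmul c' d' => simp

/-- The comultiplication of `Qᵒᵖ`: it is `Δ`, seen in `M(Qᵒᵖ ⊗ Qᵒᵖ)`. -/
def opComul (Δ : Q →ₗ[k] Multiplier k (Q ⊗[k] Q)) :
    Qᵐᵒᵖ →ₗ[k] Multiplier k (Qᵐᵒᵖ ⊗[k] Qᵐᵒᵖ) :=
  congrM opTensor opTensor_mul ∘ₗ opM ∘ₗ Δ ∘ₗ (MulOpposite.opLinearEquiv k).symm.toLinearMap

/-- The comultiplication of `Q ⊗ Qᵒᵖ`: `x ⊗ y ↦ ∑ (x₁ ⊗ y₁) ⊗ (x₂ ⊗ y₂)`. -/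
def enveloping (Δ : Q →ₗ[k] Multiplier k (Q ⊗[k] Q)) :
    Q ⊗[k] Qᵐᵒᵖ →ₗ[k] Multiplier k ((Q ⊗[k] Qᵐᵒᵖ) ⊗[k] (Q ⊗[k] Qᵐᵒᵖ)) :=
  congrM (TensorProduct.tensorTensorTensorComm k Q Q Qᵐᵒᵖ Qᵐᵒᵖ) tensorComm_mul ∘ₗ
    TensorProduct.lift (tmulM.compl₁₂ Δ (opComul Δ))

end TensorOp

/-! ### Module algebras, comodule algebras, Long module algebras

A left action of `Q` on `A` is given by `lact : Q →ₗ A →ₗ A`, `lact x a = x ▷ a`; a right action by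
`ract : Q →ₗ A →ₗ A`, `ract x a = a ◁ x`. -/

section Long

variable {k : Type u} [Field k]
variable {Q : Type v} [NonUnitalRing Q] [Module k Q] [IsScalarTower k Q Q] [SMulCommClass k Q Q]
variable {A : Type w} [NonUnitalRing A] [Module k A] [IsScalarTower k A A] [SMulCommClass k A A]

/-- `A` is a (unital) left `Q`-module algebra: `x ▷ (ab) = ∑ (x₁ ▷ a)(x₂ ▷ b)`, where `x₂` is
covered by `b = y ▷ b'`. -/
structure IsLeftModuleAlgebra (Δ : Q →ₗ[k] Multiplier k (Q ⊗[k] Q)) (lact : Q →ₗ[k] A →ₗ[k] A) :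
    Prop where
  act_mul : ∀ x y a, lact (x * y) a = lact x (lact y a)
  unital : ∀ a, ∃ e, lact e a = a
  map_mul : ∀ x y a b, lact x (a * lact y b) =
    LinearMap.mul' k A (TensorProduct.map (lact.flip a) (lact.flip b) (rightSnd Δ x y))

/-- `A` is a (unital) right `Q`-module algebra: `(ab) ◁ x = ∑ (a ◁ x₁)(b ◁ x₂)`, where `x₁` is
covered by `a = a' ◁ y`. -/
structure IsRightModuleAlgebra (Δ : Q →ₗ[k] Multiplier k (Q ⊗[k] Q)) (ract : Q →ₗ[k] A →ₗ[k] A) :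
    Prop where
  act_mul : ∀ x y a, ract (x * y) a = ract y (ract x a)
  unital : ∀ a, ∃ e, ract e a = a
  map_mul : ∀ x y a b, ract x (ract y a * b) =
    LinearMap.mul' k A (TensorProduct.map (ract.flip a) (ract.flip b) (leftFst Δ x y))

/-- `A` is a `Q`-bimodule algebra. -/
structure IsBimoduleAlgebra (Δ : Q →ₗ[k] Multiplier k (Q ⊗[k] Q)) (lact ract : Q →ₗ[k] A →ₗ[k] A) :
    Prop where
  left : IsLeftModuleAlgebra Δ lact
  right : IsRightModuleAlgebra Δ ract
  assoc : ∀ x y a, ract y (lact x a) = lact x (ract y a)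

/-- `x ⊗ y ↦ ((id ⊗ Γ)Γ(a))(x ⊗ y ⊗ 1)`, with values in `Q ⊗ (Q ⊗ A)`: apply
`b ↦ Γ(b)(y ⊗ 1)` to the second leg of `Γ(a)(x ⊗ 1)`. -/
def twiceLeft (Γ : A →ₗ[k] Multiplier k (Q ⊗[k] A)) (a : A) :
    Q ⊗[k] Q →ₗ[k] Q ⊗[k] (Q ⊗[k] A) :=
  TensorProduct.lift
    ((LinearMap.lcomp k (Q ⊗[k] (Q ⊗[k] A)) (rightFst Γ a)) ∘ₗ
      (LinearMap.lTensorHom Q) ∘ₗ (rightFst Γ).flip).flip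

/-- `x ⊗ y ↦ ((υ ⊗ id)υ(a))(1 ⊗ x ⊗ y)`, with values in `(A ⊗ Q) ⊗ Q`: apply
`b ↦ υ(b)(1 ⊗ x)` to the first leg of `υ(a)(1 ⊗ y)`. -/
def twiceRight (υ : A →ₗ[k] Multiplier k (A ⊗[k] Q)) (a : A) :
    Q ⊗[k] Q →ₗ[k] (A ⊗[k] Q) ⊗[k] Q :=
  TensorProduct.lift
    ((LinearMap.lcomp k ((A ⊗[k] Q) ⊗[k] Q) (rightSnd υ a)) ∘ₗ
      (LinearMap.rTensorHom Q) ∘ₗ (rightSnd υ).flip)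

/-- `A` is a left `Q`-comodule algebra. The coassociativity `(id ⊗ Γ)Γ(a) = (Δ ⊗ id)Γ(a)` is
expressed by multiplying both sides on the right by `Δ(p)(1 ⊗ q) ⊗ 1`; these elements span
`Q ⊗ Q ⊗ 1`, and the right side becomes `∑ Δ(a₍₋₁₎ p)(1 ⊗ q) ⊗ a₀`. -/
structure IsLeftComoduleAlgebra (Δ : Q →ₗ[k] Multiplier k (Q ⊗[k] Q))
    (Γ : A →ₗ[k] Multiplier k (Q ⊗[k] A)) : Prop where
  map_mul : ∀ a b, Γ (a * b) = Γ a * Γ b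
  injective : Function.Injective Γ
  covered : CoveredFst Γ
  coassoc : ∀ a p q, twiceLeft Γ a (T₁ Δ (p ⊗ₜ q)) =
    TensorProduct.assoc k Q Q A (((rightSnd Δ).flip q).rTensor A (rightFst Γ a p))

/-- `A` is a right `Q`-comodule algebra. The coassociativity `(υ ⊗ id)υ(a) = (id ⊗ Δ)υ(a)` is
expressed by multiplying both sides on the right by `1 ⊗ Δ(p)(1 ⊗ q)`. -/
structure IsRightComoduleAlgebra (Δ : Q →ₗ[k] Multiplier k (Q ⊗[k] Q))
    (υ : A →ₗ[k] Multiplier k (A ⊗[k] Q)) : Prop where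
  map_mul : ∀ a b, υ (a * b) = υ a * υ b
  injective : Function.Injective υ
  covered : CoveredSnd υ
  coassoc : ∀ a p q, twiceRight υ a (T₁ Δ (p ⊗ₜ q)) =
    (TensorProduct.assoc k A Q Q).symm (((rightSnd Δ).flip q).lTensor A (rightSnd υ a p))

/-- `A` is a `Q`-bicomodule algebra; the last condition is
`(1 ⊗ 1 ⊗ x)((id ⊗ υ)(Γ(a)(y ⊗ 1))) = ((Γ ⊗ id)((1 ⊗ x)υ(a)))(y ⊗ 1 ⊗ 1)`. -/
structure IsBicomoduleAlgebra (Δ : Q →ₗ[k] Multiplier k (Q ⊗[k] Q))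
    (Γ : A →ₗ[k] Multiplier k (Q ⊗[k] A)) (υ : A →ₗ[k] Multiplier k (A ⊗[k] Q)) : Prop where
  left : IsLeftComoduleAlgebra Δ Γ
  right : IsRightComoduleAlgebra Δ υ
  compat : ∀ a x y, ((leftSnd υ).flip x).lTensor Q (rightFst Γ a y) =
    TensorProduct.assoc k Q A Q (((rightFst Γ).flip y).rTensor Q (leftSnd υ a x))

/-- `A` is a left-left `Q`-Long module algebra: `Γ(x ▷ a)(y ⊗ 1) = ∑ a₍₋₁₎ y ⊗ x ▷ a₀`. -/
structure IsLeftLeftLong (Δ : Q →ₗ[k] Multiplier k (Q ⊗[k] Q)) (lact : Q →ₗ[k] A →ₗ[k] A)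
    (Γ : A →ₗ[k] Multiplier k (Q ⊗[k] A)) : Prop where
  moduleAlgebra : IsLeftModuleAlgebra Δ lact
  comoduleAlgebra : IsLeftComoduleAlgebra Δ Γ
  long : ∀ x y a, rightFst Γ (lact x a) y = (lact x).lTensor Q (rightFst Γ a y)

/-- `A` is a left-right `Q`-Long module algebra: `υ(x ▷ a)(1 ⊗ y) = ∑ x ▷ a₀ ⊗ a₍₁₎ y`. -/
structure IsLeftRightLong (Δ : Q →ₗ[k] Multiplier k (Q ⊗[k] Q)) (lact : Q →ₗ[k] A →ₗ[k] A)
    (υ : A →ₗ[k] Multiplier k (A ⊗[k] Q)) : Prop where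
  moduleAlgebra : IsLeftModuleAlgebra Δ lact
  comoduleAlgebra : IsRightComoduleAlgebra Δ υ
  long : ∀ x y a, rightSnd υ (lact x a) y = (lact x).rTensor Q (rightSnd υ a y)

/-- `A` is a right-right `Q`-Long module algebra: `υ(a ◁ x)(1 ⊗ y) = ∑ a₀ ◁ x ⊗ a₍₁₎ y`. -/
structure IsRightRightLong (Δ : Q →ₗ[k] Multiplier k (Q ⊗[k] Q)) (ract : Q →ₗ[k] A →ₗ[k] A)
    (υ : A →ₗ[k] Multiplier k (A ⊗[k] Q)) : Prop where
  moduleAlgebra : IsRightModuleAlgebra Δ ract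
  comoduleAlgebra : IsRightComoduleAlgebra Δ υ
  long : ∀ x y a, rightSnd υ (ract x a) y = (ract x).rTensor Q (rightSnd υ a y)

/-- `A` is a right-left `Q`-Long module algebra: `Γ(a ◁ x)(y ⊗ 1) = ∑ a₍₋₁₎ y ⊗ a₀ ◁ x`. -/
structure IsRightLeftLong (Δ : Q →ₗ[k] Multiplier k (Q ⊗[k] Q)) (ract : Q →ₗ[k] A →ₗ[k] A)
    (Γ : A →ₗ[k] Multiplier k (Q ⊗[k] A)) : Prop where
  moduleAlgebra : IsRightModuleAlgebra Δ ract
  comoduleAlgebra : IsLeftComoduleAlgebra Δ Γ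
  long : ∀ x y a, rightFst Γ (ract x a) y = (ract x).lTensor Q (rightFst Γ a y)

/-- `A` is a four-sided `Q`-Long module algebra. -/
structure IsFourSidedLong (Δ : Q →ₗ[k] Multiplier k (Q ⊗[k] Q)) (lact ract : Q →ₗ[k] A →ₗ[k] A)
    (Γ : A →ₗ[k] Multiplier k (Q ⊗[k] A)) (υ : A →ₗ[k] Multiplier k (A ⊗[k] Q)) : Prop where
  bimodule : IsBimoduleAlgebra Δ lact ract
  bicomodule : IsBicomoduleAlgebra Δ Γ υ
  leftLeft : IsLeftLeftLong Δ lact Γ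
  leftRight : IsLeftRightLong Δ lact υ
  rightRight : IsRightRightLong Δ ract υ
  rightLeft : IsRightLeftLong Δ ract Γ

end Long

/-! ### Twisted products

Products are bilinear maps `V →ₗ V →ₗ V`. Since the actions are unital, the formulas below, in which
the legs of the coactions are covered through the action, determine the products. -/

section Twisted

variable {k : Type u} [Field k]

/-- The product `μ` is associative. -/
def IsAssocMul {V : Type v} [AddCommGroup V] [Module k V] (μ : V →ₗ[k] V →ₗ[k] V) : Prop :=
  ∀ a b c, μ (μ a b) c = μ a (μ b c)

/-- The algebras `(V, μ)` and `(W, ν)` are isomorphic. -/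
def AreIsomorphic {V : Type v} [AddCommGroup V] [Module k V] {W : Type w} [AddCommGroup W]
    [Module k W] (μ : V →ₗ[k] V →ₗ[k] V) (ν : W →ₗ[k] W →ₗ[k] W) : Prop :=
  ∃ φ : V ≃ₗ[k] W, ∀ a b, φ (μ a b) = ν (φ a) (φ b)

variable {Q : Type v} [NonUnitalRing Q] [Module k Q] [IsScalarTower k Q Q] [SMulCommClass k Q Q]
variable {A : Type w} [NonUnitalRing A] [Module k A] [IsScalarTower k A A] [SMulCommClass k A A]
variable {B : Type w'} [NonUnitalRing B] [Module k B] [IsScalarTower k B B] [SMulCommClass k B B]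

/-- `μ` is the left twisted product `a • b = ∑ a₀ (a₍₋₁₎ ▷ b)`, with `a₍₋₁₎` covered by `b = x ▷ b'`:
`a • (x ▷ b) = ∑ a₀ ((a₍₋₁₎ x) ▷ b)`. -/
def IsLeftTwistedProduct (lact : Q →ₗ[k] A →ₗ[k] A) (Γ : A →ₗ[k] Multiplier k (Q ⊗[k] A))
    (μ : A →ₗ[k] A →ₗ[k] A) : Prop :=
  ∀ a b x, μ a (lact x b) =
    TensorProduct.lift ((LinearMap.mul k A).flip ∘ₗ lact.flip b) (rightFst Γ a x)

/-- `μ` is the L-R-twisted product `a ⊛ b = ∑ (a₀ ◁ b₍₁₎)(a₍₋₁₎ ▷ b₀)`, with `b₍₁₎` covered by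
`a = a' ◁ y` and `a₍₋₁₎` covered by `b = x ▷ b'`:
`(a ◁ y) ⊛ (x ▷ b) = ∑ (a₀ ◁ (y b₍₁₎))((a₍₋₁₎ x) ▷ b₀)`. -/
def IsLRTwistedProduct (lact ract : Q →ₗ[k] A →ₗ[k] A) (Γ : A →ₗ[k] Multiplier k (Q ⊗[k] A))
    (υ : A →ₗ[k] Multiplier k (A ⊗[k] Q)) (μ : A →ₗ[k] A →ₗ[k] A) : Prop :=
  ∀ a b x y, μ (ract y a) (lact x b) =
    LinearMap.mul' k A (TensorProduct.map (TensorProduct.lift ract.flip) (TensorProduct.lift lact)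
      (TensorProduct.tensorTensorTensorComm k A Q Q A
        (TensorProduct.comm k Q A (rightFst Γ a x) ⊗ₜ TensorProduct.comm k A Q (leftSnd υ b y))))

/-- The left action `(x ⊗ y) ▷ a = x ▷ a ◁ y` of `Q ⊗ Qᵒᵖ` on a `Q`-bimodule. -/
def envelopingAction (lact ract : Q →ₗ[k] A →ₗ[k] A) : Q ⊗[k] Qᵐᵒᵖ →ₗ[k] A →ₗ[k] A :=
  TensorProduct.lift ((LinearMap.mul k (Module.End k A)).flip.compl₁₂ lact
    (ract ∘ₗ (MulOpposite.opLinearEquiv k).symm.toLinearMap))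

variable (k) in
/-- `p ⊗ (b ⊗ q) ↦ (p ⊗ q) ⊗ b`. -/
def rotate (Q : Type v) [AddCommGroup Q] [Module k Q] (B : Type w') [AddCommGroup B] [Module k B] :
    Q ⊗[k] (B ⊗[k] Q) ≃ₗ[k] (Q ⊗[k] Q) ⊗[k] B :=
  (TensorProduct.comm k B Q).lTensor Q ≪≫ₗ (TensorProduct.assoc k Q Q B).symm

/-- `∑ (b₍₋₁₎ x ⊗ b₍₁₎ z) ⊗ b₀` in `(Q ⊗ Q) ⊗ B`. -/
def legsRight (Γ : B →ₗ[k] Multiplier k (Q ⊗[k] B)) (υ : B →ₗ[k] Multiplier k (B ⊗[k] Q))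
    (b : B) (x z : Q) : (Q ⊗[k] Q) ⊗[k] B :=
  rotate k Q B (((rightSnd υ).flip z).lTensor Q (rightFst Γ b x))

/-- `∑ (z b₍₋₁₎ ⊗ y b₍₁₎) ⊗ b₀` in `(Q ⊗ Q) ⊗ B`. -/
def legsLeft (Γ : B →ₗ[k] Multiplier k (Q ⊗[k] B)) (υ : B →ₗ[k] Multiplier k (B ⊗[k] Q))
    (b : B) (z y : Q) : (Q ⊗[k] Q) ⊗[k] B :=
  rotate k Q B (((leftSnd υ).flip y).lTensor Q (leftFst Γ b z))

/-- `Γ'` is the left coaction `a ↦ ∑ (a₍₋₁₎ ⊗ S⁻¹(a₍₁₎)) ⊗ a₀` of `Q ⊗ Qᵒᵖ` on `A`: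
`Γ'(a)((x ⊗ y) ⊗ 1) = ∑ (a₍₋₁₎ x ⊗ y S⁻¹(a₍₁₎)) ⊗ a₀`, where the product in the second leg is
the product of `Q` and `y S⁻¹(a₍₁₎) = S⁻¹(a₍₁₎ S(y))`. -/
def IsEnvelopingCoaction (S : Q ≃ₗ[k] Q) (Γ : A →ₗ[k] Multiplier k (Q ⊗[k] A))
    (υ : A →ₗ[k] Multiplier k (A ⊗[k] Q))
    (Γ' : A →ₗ[k] Multiplier k ((Q ⊗[k] Qᵐᵒᵖ) ⊗[k] A)) : Prop :=
  ∀ a x y, Γ' a * fstM k (Q ⊗[k] Qᵐᵒᵖ) A (x ⊗ₜ MulOpposite.op y) =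
    embed k ((Q ⊗[k] Qᵐᵒᵖ) ⊗[k] A)
      ((((MulOpposite.opLinearEquiv k).toLinearMap ∘ₗ S.symm.toLinearMap).lTensor Q).rTensor A
        (legsRight Γ υ a x (S y)))

/-- The bilinear map `(p, q) ↦ p ▷ c ◁ q`. -/
def sandwich (lact ract : Q →ₗ[k] A →ₗ[k] A) (c : A) : Q →ₗ[k] Q →ₗ[k] A :=
  ract.flip ∘ₗ lact.flip c

/-- `μ` is the product of the left L-R-smash product on `A ⊗ B`,
`(a ⊗ b)(c ⊗ d) = ∑ (a ◁ d₍₁₎)(b₍₋₁₎ ▷ c) ⊗ b₀ d₀`, in covered form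
`((a ◁ y) ⊗ b)((x ▷ c) ⊗ d) = ∑ (a ◁ (y d₍₁₎))((b₍₋₁₎ x) ▷ c) ⊗ b₀ d₀`. -/
def IsLeftLRSmash (lact ract : Q →ₗ[k] A →ₗ[k] A) (Γ : B →ₗ[k] Multiplier k (Q ⊗[k] B))
    (υ : B →ₗ[k] Multiplier k (B ⊗[k] Q)) (μ : A ⊗[k] B →ₗ[k] A ⊗[k] B →ₗ[k] A ⊗[k] B) : Prop :=
  ∀ a c b d x y, μ (ract y a ⊗ₜ b) (lact x c ⊗ₜ d) =
    TensorProduct.map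
      (TensorProduct.lift ((LinearMap.mul k A).flip.compl₁₂ (lact.flip c) (ract.flip a)))
      (LinearMap.mul' k B)
      (TensorProduct.tensorTensorTensorComm k Q B Q B
        (rightFst Γ b x ⊗ₜ TensorProduct.comm k B Q (leftSnd υ d y)))

/-- `μ` is the product of the right L-R-smash product on `B ⊗ A`,
`(b ⊗ a)(d ⊗ c) = ∑ b₀ d₀ ⊗ (a ◁ d₍₁₎)(b₍₋₁₎ ▷ c)`, in covered form
`(b ⊗ (a ◁ y))(d ⊗ (x ▷ c)) = ∑ b₀ d₀ ⊗ (a ◁ (y d₍₁₎))((b₍₋₁₎ x) ▷ c)`. -/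
def IsRightLRSmash (lact ract : Q →ₗ[k] A →ₗ[k] A) (Γ : B →ₗ[k] Multiplier k (Q ⊗[k] B))
    (υ : B →ₗ[k] Multiplier k (B ⊗[k] Q)) (μ : B ⊗[k] A →ₗ[k] B ⊗[k] A →ₗ[k] B ⊗[k] A) : Prop :=
  ∀ a c b d x y, μ (b ⊗ₜ ract y a) (d ⊗ₜ lact x c) =
    TensorProduct.comm k A B (TensorProduct.map
      (TensorProduct.lift ((LinearMap.mul k A).flip.compl₁₂ (lact.flip c) (ract.flip a)))
      (LinearMap.mul' k B)
      (TensorProduct.tensorTensorTensorComm k Q B Q B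
        (rightFst Γ b x ⊗ₜ TensorProduct.comm k B Q (leftSnd υ d y))))

/-- `μ` is the product of the left twisted smash product on `A ⊗ B`,
`(a ⊗ b)(c ⊗ d) = ∑ a (b₍₋₁₎ ▷ c ◁ S⁻¹(b₍₁₎)) ⊗ b₀ d`, in covered form
`(a ⊗ b)((x ▷ c ◁ y) ⊗ d) = ∑ a ((b₍₋₁₎ x) ▷ c ◁ S⁻¹(b₍₁₎ S(y))) ⊗ b₀ d`, where
`S⁻¹(b₍₁₎ S(y)) = y S⁻¹(b₍₁₎)`. -/
def IsLeftTwistedSmash (S : Q ≃ₗ[k] Q) (lact ract : Q →ₗ[k] A →ₗ[k] A)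
    (Γ : B →ₗ[k] Multiplier k (Q ⊗[k] B)) (υ : B →ₗ[k] Multiplier k (B ⊗[k] Q))
    (μ : A ⊗[k] B →ₗ[k] A ⊗[k] B →ₗ[k] A ⊗[k] B) : Prop :=
  ∀ a c b d x y, μ (a ⊗ₜ b) (ract y (lact x c) ⊗ₜ d) =
    TensorProduct.map
      (LinearMap.mulLeft k a ∘ₗ
        TensorProduct.lift ((sandwich lact ract c).compl₂ S.symm.toLinearMap))
      (LinearMap.mulRight k d) (legsRight Γ υ b x (S y))

/-- `μ` is the product of the right twisted smash product on `B ⊗ A`,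
`(b ⊗ c)(d ⊗ a) = ∑ b d₀ ⊗ (S⁻¹(d₍₋₁₎) ▷ c ◁ d₍₁₎) a`, in covered form
`(b ⊗ (x ▷ c ◁ y))(d ⊗ a) = ∑ b d₀ ⊗ (S⁻¹(S(x) d₍₋₁₎) ▷ c ◁ (y d₍₁₎)) a`, where
`S⁻¹(S(x) d₍₋₁₎) = S⁻¹(d₍₋₁₎) x`. -/
def IsRightTwistedSmash (S : Q ≃ₗ[k] Q) (lact ract : Q →ₗ[k] A →ₗ[k] A)
    (Γ : B →ₗ[k] Multiplier k (Q ⊗[k] B)) (υ : B →ₗ[k] Multiplier k (B ⊗[k] Q))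
    (μ : B ⊗[k] A →ₗ[k] B ⊗[k] A →ₗ[k] B ⊗[k] A) : Prop :=
  ∀ a c b d x y, μ (b ⊗ₜ ract y (lact x c)) (d ⊗ₜ a) =
    TensorProduct.comm k A B (TensorProduct.map
      (LinearMap.mulRight k a ∘ₗ
        TensorProduct.lift ((sandwich lact ract c).comp S.symm.toLinearMap))
      (LinearMap.mulLeft k b) (legsLeft Γ υ d (S x) y))

end Twisted

end

end MultHopf

open MultHopf

/-!
The formulas of the theorem involve multipliers, but the argument never leaves the tensor products of
the algebras themselves. A coaction `v ↦ v₍₋₁₎ ⊗ v₀` of `H` on `V` is handled through its two covered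
forms, the operators `ρ : x ⊗ v ↦ v₍₋₁₎ x ⊗ v₀` and `ρ' : x ⊗ v ↦ x v₍₋₁₎ ⊗ v₀` on `H ⊗ V`
(`IsCoaction`). Because the products are nondegenerate, each of them determines the other and the
multiplier-valued map (`ofCompatible`). The antipode inverts them (`IsCoaction.antipode₁`,
`IsCoaction.antipode₂`).

*The algebra `Q ⊗ Qᵒᵖ`.* Tensor products and opposites of regular multiplier Hopf algebras are regular
multiplier Hopf algebras, since their maps `T₁` and `T₂` are conjugates of tensor products of those of
the factors (`IsRegularMultiplierHopf.tensor`, `IsRegularMultiplierHopf.opComul`). A right coaction of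
`Q` is a left coaction of the coopposite, the antipode carries it to a left coaction of `Qᵒᵖ`
(`IsCoaction.op`), and commuting coactions of two multiplier Hopf algebras combine to a coaction of
their tensor product (`IsCoaction.tensor`).

*Twisting maps.* If `H` acts on `M` and coacts on `B`, there is an operator `m ⊗ b ↦ b₍₋₁₎ ▷ m ⊗ b₀` on
`M ⊗ B` (`exists_isTwist`). It is multiplicative in `M` when `M` is a module algebra and in `B` when
`B` is a comodule algebra (`IsTwist.isMulLeft`, `IsTwist.isMulRight`). On `A ⊗ A` this gives commuting
invertible operators `Ψ : m ⊗ b ↦ b₍₋₁₎ ▷ m ⊗ b₀` and `Φ : m ⊗ b ↦ m ◁ b₍₁₎ ⊗ b₀`, whose inverses come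
from the antipode; the twisting map of the `Q ⊗ Qᵒᵖ`-structure is `Φ⁻¹ Ψ` (`IsTwistSystem`).

*Products on `A ⊗ A`.* All four products are of the form `(a ⊗ b)(c ⊗ d) = a' c' ⊗ b' d'` with
`X (a ⊗ d) = a' ⊗ d'` and `Y (c ⊗ b) = c' ⊗ b'` (`crossMul`), up to exchanging the tensor factors.
The product for `X = id` and `Y = Φ⁻¹ Ψ` is associative because `Φ⁻¹ Ψ` is multiplicative in both
arguments (`isAssocMul_crossMul_id`), and `Φ` is an isomorphism from it to the product for `X = Φ` and
`Y = Ψ` (`map_crossMul`), which is therefore associative too. The other pair arises in the same way,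
with `Φ` and `Ψ` exchanged and with the opposite products.

*Products on `A`.* The product `a • b` is `a₀ b'` with `(Φ⁻¹ Ψ) (b ⊗ a) = b' ⊗ a₀`. It is associative
because `Φ⁻¹ Ψ` is multiplicative in both arguments and, action and coaction being compatible, the
twisting maps in adjacent legs of `A ⊗ A ⊗ A` commute (`isAssocMul_twistedMul`). The map
`α : a ↦ a₀ ◁ a₍₁₎` is a bijection of `A` (`IsRightRightLong.exists_contraction`) that commutes with the
left action and the left coaction, and `α (a b)` is the product of `α (a)` and `α (b)` up to two factors
`Φ` (`IsContraction.map_mul`). One of these turns `Φ⁻¹ Ψ` into `Ψ` and the other one is the factor `Φ` in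
`a ⊛ b` (`IsFourSidedLong.contraction_twistedMul`). The associativity of `⊛` is transported along `α`.
-/

namespace MultHopf

open LinearMap (mulLeft mulRight)

noncomputable section

set_option linter.unusedSectionVars false

universe u v w w' v'

/-! ### Shortcuts for instance search on linear maps -/

section HomClasses

variable {k : Type u} [Field k] {M : Type v} [AddCommMonoid M] [Module k M]
  {N : Type w} [AddCommMonoid N] [Module k N]

instance linearMapAddHomClass : AddHomClass (M →ₗ[k] N) M N := inferInstance

instance linearMapZeroHomClass : ZeroHomClass (M →ₗ[k] N) M N := inferInstance

instance linearEquivAddHomClass : AddHomClass (M ≃ₗ[k] N) M N := inferInstance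

instance linearEquivZeroHomClass : ZeroHomClass (M ≃ₗ[k] N) M N := inferInstance

end HomClasses

/-! ### Tensor products over a field and nondegenerate products -/

section Separation

variable {k : Type u} [Field k]

/-- A jointly injective family of linear maps remains jointly injective after tensoring with a
free module. -/
theorem eq_of_rTensor {ι : Type*} {X : Type v} [AddCommMonoid X] [Module k X] {Y : Type w}
    [AddCommMonoid Y] [Module k Y] {V : Type w'} [AddCommMonoid V] [Module k V] [Module.Free k V]
    (f : ι → X →ₗ[k] Y) (hf : ∀ x x', (∀ i, f i x = f i x') → x = x') {s t : X ⊗[k] V}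
    (h : ∀ i, (f i).rTensor V s = (f i).rTensor V t) : s = t := by
  classical
  let b := Module.Free.chooseBasis k V
  have key : ∀ (i) (r : X ⊗[k] V) (j), TensorProduct.equivFinsuppOfBasisRight b
      ((f i).rTensor V r) j = f i (TensorProduct.equivFinsuppOfBasisRight b r j) := by
    intro i r j
    induction r with
    | zero => simp
    | tmul x v => simp
    | add x y hx hy => simp only [map_add, Finsupp.add_apply, hx, hy]
  apply (TensorProduct.equivFinsuppOfBasisRight b).injective
  ext j
  exact hf _ _ fun i => by rw [← key, h, key]

theorem eq_of_lTensor {ι : Type*} {X : Type v} [AddCommMonoid X] [Module k X] {Y : Type w}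
    [AddCommMonoid Y] [Module k Y] {V : Type w'} [AddCommMonoid V] [Module k V] [Module.Free k V]
    (f : ι → X →ₗ[k] Y) (hf : ∀ x x', (∀ i, f i x = f i x') → x = x') {s t : V ⊗[k] X}
    (h : ∀ i, (f i).lTensor V s = (f i).lTensor V t) : s = t := by
  apply (TensorProduct.comm k V X).injective
  refine eq_of_rTensor f hf fun i => ?_
  have key : ∀ r : V ⊗[k] X, (f i).rTensor V (TensorProduct.comm k V X r) =
      TensorProduct.comm k V Y ((f i).lTensor V r) := fun r => by
    induction r with
    | zero => simp
    | tmul x v => simp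
    | add x y hx hy => simp only [map_add, hx, hy]
  rw [key, key, h]

variable {X : Type v} [NonUnitalRing X] [Module k X] [IsScalarTower k X X] [SMulCommClass k X X]
variable {Y : Type w} [NonUnitalRing Y] [Module k Y] [IsScalarTower k Y Y] [SMulCommClass k Y Y]
variable {V : Type w'} [AddCommGroup V] [Module k V]

theorem IsNondegenerate.eq_of_mul_right (hX : IsNondegenerate X) {a b : X}
    (h : ∀ c, a * c = b * c) : a = b :=
  sub_eq_zero.1 (hX.1 _ fun c => by rw [sub_mul, h, sub_self])

theorem IsNondegenerate.eq_of_mul_left (hX : IsNondegenerate X) {a b : X}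
    (h : ∀ c, c * a = c * b) : a = b :=
  sub_eq_zero.1 (hX.2 _ fun c => by rw [mul_sub, h, sub_self])

theorem eq_of_mulRight_rTensor (hX : IsNondegenerate X) {s t : X ⊗[k] V}
    (h : ∀ x, (mulRight k x).rTensor V s = (mulRight k x).rTensor V t) : s = t :=
  eq_of_rTensor (fun x => mulRight k x) (fun _ _ h => hX.eq_of_mul_right h) h

theorem eq_of_mulLeft_rTensor (hX : IsNondegenerate X) {s t : X ⊗[k] V}
    (h : ∀ x, (mulLeft k x).rTensor V s = (mulLeft k x).rTensor V t) : s = t :=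
  eq_of_rTensor (fun x => mulLeft k x) (fun _ _ h => hX.eq_of_mul_left h) h

theorem eq_of_mulRight_lTensor (hX : IsNondegenerate X) {s t : V ⊗[k] X}
    (h : ∀ x, (mulRight k x).lTensor V s = (mulRight k x).lTensor V t) : s = t :=
  eq_of_lTensor (fun x => mulRight k x) (fun _ _ h => hX.eq_of_mul_right h) h

theorem eq_of_mulLeft_lTensor (hX : IsNondegenerate X) {s t : V ⊗[k] X}
    (h : ∀ x, (mulLeft k x).lTensor V s = (mulLeft k x).lTensor V t) : s = t :=
  eq_of_lTensor (fun x => mulLeft k x) (fun _ _ h => hX.eq_of_mul_left h) h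

theorem rTensor_lTensor_comm {X X' V V' : Type*} [AddCommMonoid X] [Module k X] [AddCommMonoid X']
    [Module k X'] [AddCommMonoid V] [Module k V] [AddCommMonoid V'] [Module k V']
    (f : X →ₗ[k] X') (g : V →ₗ[k] V') (t : X ⊗[k] V) :
    f.rTensor V' (g.lTensor X t) = g.lTensor X' (f.rTensor V t) := by
  induction t with
  | zero => simp
  | tmul a b => simp
  | add s t hs ht => simp only [map_add, hs, ht]

theorem mul_tmul_eq (t : X ⊗[k] Y) (x : X) (y : Y) :
    t * (x ⊗ₜ y) = (mulRight k x).rTensor Y ((mulRight k y).lTensor X t) := by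
  induction t with
  | zero => simp
  | tmul a b => simp
  | add s t hs ht => simp only [map_add, add_mul, hs, ht]

theorem tmul_mul_eq (t : X ⊗[k] Y) (x : X) (y : Y) :
    (x ⊗ₜ y) * t = (mulLeft k x).rTensor Y ((mulLeft k y).lTensor X t) := by
  induction t with
  | zero => simp
  | tmul a b => simp
  | add s t hs ht => simp only [map_add, mul_add, hs, ht]

theorem IsNondegenerate.tensor (hX : IsNondegenerate X) (hY : IsNondegenerate Y) :
    IsNondegenerate (X ⊗[k] Y) := by
  constructor <;> intro t ht
  · refine eq_of_mulRight_lTensor hY fun y => eq_of_mulRight_rTensor hX fun x => ?_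
    rw [← mul_tmul_eq, ht]
    simp
  · refine eq_of_mulLeft_lTensor hY fun y => eq_of_mulLeft_rTensor hX fun x => ?_
    rw [← tmul_mul_eq, ht]
    simp

theorem IsNondegenerate.op (hX : IsNondegenerate X) : IsNondegenerate Xᵐᵒᵖ :=
  ⟨fun _ h => MulOpposite.unop_injective (hX.2 _ fun b =>
      MulOpposite.op_injective (h (MulOpposite.op b))),
    fun _ h => MulOpposite.unop_injective (hX.1 _ fun b =>
      MulOpposite.op_injective (h (MulOpposite.op b)))⟩

end Separation

/-! ### Multipliers of a nondegenerate algebra -/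

section MultiplierBasics

variable {k : Type u} [Field k]
variable {X : Type v} [NonUnitalRing X] [Module k X] [IsScalarTower k X X] [SMulCommClass k X X]
variable {Y : Type w} [NonUnitalRing Y] [Module k Y] [IsScalarTower k Y Y] [SMulCommClass k Y Y]

theorem mult_assoc (m : Multiplier k X) (s t : X) : m.1.2.unop s * t = s * m.1.1 t := m.2 s t

theorem mult_fst_mul (hX : IsNondegenerate X) (m : Multiplier k X) (s t : X) :
    m.1.1 (s * t) = m.1.1 s * t :=
  hX.eq_of_mul_left fun c => by
    rw [← mult_assoc, ← mul_assoc, ← mul_assoc, mult_assoc]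

theorem mult_snd_mul (hX : IsNondegenerate X) (m : Multiplier k X) (s t : X) :
    m.1.2.unop (s * t) = s * m.1.2.unop t :=
  hX.eq_of_mul_right fun c => by
    rw [mult_assoc, mul_assoc, mul_assoc, mult_assoc]

theorem multiplier_ext_fst (hX : IsNondegenerate X) {m n : Multiplier k X}
    (h : ∀ s, m.1.1 s = n.1.1 s) : m = n := by
  refine Subtype.ext (Prod.ext (LinearMap.ext h) (MulOpposite.unop_injective (LinearMap.ext ?_)))
  exact fun s => hX.eq_of_mul_right fun c => by rw [mult_assoc, mult_assoc, h]

theorem embed_injective (hX : IsNondegenerate X) : Function.Injective (embed k X) := by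
  intro a b h
  refine hX.eq_of_mul_right fun c => ?_
  exact LinearMap.congr_fun (congrArg (fun m : Multiplier k X => m.1.1) h) c

theorem elt_embed (hX : IsNondegenerate X) (a : X) : elt k X (embed k X a) = a :=
  LinearMap.leftInverse_apply_of_inj (LinearMap.ker_eq_bot.2 (embed_injective hX)) a

theorem mul_embed (hX : IsNondegenerate X) (m : Multiplier k X) (t : X) :
    m * embed k X t = embed k X (m.1.1 t) :=
  multiplier_ext_fst hX fun s => mult_fst_mul hX m t s

theorem embed_mul (hX : IsNondegenerate X) (m : Multiplier k X) (t : X) :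
    embed k X t * m = embed k X (m.1.2.unop t) :=
  multiplier_ext_fst hX fun s => (mult_assoc m t s).symm

theorem embed_mul_embed (s t : X) : embed k X s * embed k X t = embed k X (s * t) := by
  refine Subtype.ext (Prod.ext (LinearMap.ext fun c => ?_)
    (MulOpposite.unop_injective (LinearMap.ext fun c => ?_)))
  · exact (mul_assoc s t c).symm
  · exact mul_assoc c s t

theorem fstM_fst (x : X) (t : X ⊗[k] Y) : (fstM k X Y x).1.1 t = (mulLeft k x).rTensor Y t := rfl

theorem fstM_snd (x : X) (t : X ⊗[k] Y) :
    (fstM k X Y x).1.2.unop t = (mulRight k x).rTensor Y t := rfl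

theorem sndM_fst (y : Y) (t : X ⊗[k] Y) : (sndM k X Y y).1.1 t = (mulLeft k y).lTensor X t := rfl

theorem sndM_snd (y : Y) (t : X ⊗[k] Y) :
    (sndM k X Y y).1.2.unop t = (mulRight k y).lTensor X t := rfl

theorem mult_mul_fst (m n : Multiplier k X) (t : X) : (m * n).1.1 t = m.1.1 (n.1.1 t) := rfl

theorem mult_mul_snd (m n : Multiplier k X) (t : X) :
    (m * n).1.2.unop t = n.1.2.unop (m.1.2.unop t) := rfl

theorem embed_fst (s t : X) : (embed k X s).1.1 t = s * t := rfl

theorem embed_snd (s t : X) : (embed k X s).1.2.unop t = t * s := rfl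

theorem mult_mulRight (hX : IsNondegenerate X) (hY : IsNondegenerate Y)
    (m : Multiplier k (X ⊗[k] Y)) (x : X) (s : X ⊗[k] Y) :
    m.1.1 ((mulRight k x).rTensor Y s) = (mulRight k x).rTensor Y (m.1.1 s) := by
  refine (hX.tensor hY).eq_of_mul_left fun c => ?_
  rw [← mult_assoc, ← fstM_snd, ← fstM_snd, ← mult_snd_mul (hX.tensor hY),
    ← mult_snd_mul (hX.tensor hY), mult_assoc]

theorem mult_mulRight' (hX : IsNondegenerate X) (hY : IsNondegenerate Y)
    (m : Multiplier k (X ⊗[k] Y)) (y : Y) (s : X ⊗[k] Y) :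
    m.1.1 ((mulRight k y).lTensor X s) = (mulRight k y).lTensor X (m.1.1 s) := by
  refine (hX.tensor hY).eq_of_mul_left fun c => ?_
  rw [← mult_assoc, ← sndM_snd, ← sndM_snd, ← mult_snd_mul (hX.tensor hY),
    ← mult_snd_mul (hX.tensor hY), mult_assoc]

theorem mult_mulLeft (hX : IsNondegenerate X) (hY : IsNondegenerate Y)
    (m : Multiplier k (X ⊗[k] Y)) (x : X) (s : X ⊗[k] Y) :
    m.1.2.unop ((mulLeft k x).rTensor Y s) = (mulLeft k x).rTensor Y (m.1.2.unop s) := by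
  refine (hX.tensor hY).eq_of_mul_right fun c => ?_
  rw [mult_assoc, ← fstM_fst, ← fstM_fst, ← mult_fst_mul (hX.tensor hY),
    ← mult_fst_mul (hX.tensor hY), mult_assoc]

theorem mult_mulLeft' (hX : IsNondegenerate X) (hY : IsNondegenerate Y)
    (m : Multiplier k (X ⊗[k] Y)) (y : Y) (s : X ⊗[k] Y) :
    m.1.2.unop ((mulLeft k y).lTensor X s) = (mulLeft k y).lTensor X (m.1.2.unop s) := by
  refine (hX.tensor hY).eq_of_mul_right fun c => ?_
  rw [mult_assoc, ← sndM_fst, ← sndM_fst, ← mult_fst_mul (hX.tensor hY),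
    ← mult_fst_mul (hX.tensor hY), mult_assoc]

/-- The multiplier `m` of `X ⊗ Y` with `m (x ⊗ 1) = L x` and `(x ⊗ 1) m = R x`, for maps
`L, R : X → X ⊗ Y` with `(x ⊗ 1) L(x') = R(x) (x' ⊗ 1)`. -/
def mkFst (L R : X →ₗ[k] X ⊗[k] Y)
    (h : ∀ e x, (mulLeft k e).rTensor Y (L x) = (mulRight k x).rTensor Y (R e)) :
    Multiplier k (X ⊗[k] Y) :=
  ⟨(TensorProduct.lift (LinearMap.mk₂ k (fun x y => (mulRight k y).lTensor X (L x))
      (fun x x' y => by simp) (fun c x y => by simp)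
      (fun x y y' => by
        rw [← LinearMap.add_apply, ← LinearMap.lTensor_add]; congr 2; ext; simp [mul_add])
      (fun c x y => by
        rw [← LinearMap.smul_apply, ← LinearMap.lTensor_smul]; congr 2; ext; simp [mul_smul_comm])),
    MulOpposite.op (TensorProduct.lift (LinearMap.mk₂ k (fun x y => (mulLeft k y).lTensor X (R x))
      (fun x x' y => by simp) (fun c x y => by simp)
      (fun x y y' => by
        rw [← LinearMap.add_apply, ← LinearMap.lTensor_add]; congr 2; ext; simp [add_mul])
      (fun c x y => by
        rw [← LinearMap.smul_apply, ← LinearMap.lTensor_smul]; congr 2; ext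
        simp [smul_mul_assoc])))), by
    intro s t
    induction s with
    | zero => simp
    | add s s' hs hs' => simp only [map_add, add_mul, hs, hs']
    | tmul x y =>
      induction t with
      | zero => simp
      | add t t' ht ht' => simp only [map_add, mul_add, ht, ht']
      | tmul x' y' =>
        have h1 := congrArg (fun r => (mulLeft k y).lTensor X ((mulRight k y').lTensor X r)) (h x x')
        simp only [MulOpposite.unop_op, TensorProduct.lift.tmul, LinearMap.mk₂_apply] at h1 ⊢
        rw [mul_tmul_eq, tmul_mul_eq]
        have c1 : ∀ r : X ⊗[k] Y, (mulRight k x').rTensor Y ((mulRight k y').lTensor X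
            ((mulLeft k y).lTensor X r)) =
            (mulLeft k y).lTensor X ((mulRight k y').lTensor X ((mulRight k x').rTensor Y r)) := by
          intro r
          induction r with
          | zero => simp
          | tmul a b => simp [mul_assoc]
          | add r r' hr hr' => simp only [map_add, hr, hr']
        have c2 : ∀ r : X ⊗[k] Y, (mulLeft k x).rTensor Y ((mulLeft k y).lTensor X
            ((mulRight k y').lTensor X r)) =
            (mulLeft k y).lTensor X ((mulRight k y').lTensor X ((mulLeft k x).rTensor Y r)) := by
          intro r
          induction r with
          | zero => simp
          | tmul a b => simp
          | add r r' hr hr' => simp only [map_add, hr, hr']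
        rw [c1, c2, h1]⟩

theorem mkFst_fst (L R : X →ₗ[k] X ⊗[k] Y)
    (h : ∀ e x, (mulLeft k e).rTensor Y (L x) = (mulRight k x).rTensor Y (R e)) (x : X) (y : Y) :
    (mkFst L R h).1.1 (x ⊗ₜ y) = (mulRight k y).lTensor X (L x) := rfl

theorem mkFst_snd (L R : X →ₗ[k] X ⊗[k] Y)
    (h : ∀ e x, (mulLeft k e).rTensor Y (L x) = (mulRight k x).rTensor Y (R e)) (x : X) (y : Y) :
    (mkFst L R h).1.2.unop (x ⊗ₜ y) = (mulLeft k y).lTensor X (R x) := rfl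

end MultiplierBasics

/-! ### Covered maps into multiplier algebras -/

section Covers

variable {k : Type u} [Field k]
variable {X : Type v} [NonUnitalRing X] [Module k X] [IsScalarTower k X X] [SMulCommClass k X X]
variable {Y : Type w} [NonUnitalRing Y] [Module k Y] [IsScalarTower k Y Y] [SMulCommClass k Y Y]
variable {V : Type w'} [AddCommGroup V] [Module k V]

theorem elt_of_eq (hX : IsNondegenerate X) {m : Multiplier k X} {t : X} (h : m = embed k X t) :
    elt k X m = t := by rw [h, elt_embed hX]

theorem embed_elt (hX : IsNondegenerate X) {m : Multiplier k X}
    (h : m ∈ LinearMap.range (embed k X)) : embed k X (elt k X m) = m := by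
  obtain ⟨t, rfl⟩ := h
  rw [elt_embed hX]

variable (hX : IsNondegenerate X) (hY : IsNondegenerate Y)
variable {F : V →ₗ[k] Multiplier k (X ⊗[k] Y)}

theorem rightFst_eq (hX : IsNondegenerate X) (hY : IsNondegenerate Y) {v : V} {x : X}
    {t : X ⊗[k] Y} (h : F v * fstM k X Y x = embed k _ t) : rightFst F v x = t :=
  elt_of_eq (hX.tensor hY) h

theorem leftFst_eq (hX : IsNondegenerate X) (hY : IsNondegenerate Y) {v : V} {x : X}
    {t : X ⊗[k] Y} (h : fstM k X Y x * F v = embed k _ t) : leftFst F v x = t :=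
  elt_of_eq (hX.tensor hY) h

theorem rightSnd_eq (hX : IsNondegenerate X) (hY : IsNondegenerate Y) {v : V} {y : Y}
    {t : X ⊗[k] Y} (h : F v * sndM k X Y y = embed k _ t) : rightSnd F v y = t :=
  elt_of_eq (hX.tensor hY) h

theorem embed_rightFst (hX : IsNondegenerate X) (hY : IsNondegenerate Y) {v : V} {x : X}
    (h : F v * fstM k X Y x ∈ LinearMap.range (embed k (X ⊗[k] Y))) :
    embed k _ (rightFst F v x) = F v * fstM k X Y x := embed_elt (hX.tensor hY) h

theorem embed_leftFst (hX : IsNondegenerate X) (hY : IsNondegenerate Y) {v : V} {x : X}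
    (h : fstM k X Y x * F v ∈ LinearMap.range (embed k (X ⊗[k] Y))) :
    embed k _ (leftFst F v x) = fstM k X Y x * F v := embed_elt (hX.tensor hY) h

theorem embed_rightSnd (hX : IsNondegenerate X) (hY : IsNondegenerate Y) {v : V} {y : Y}
    (h : F v * sndM k X Y y ∈ LinearMap.range (embed k (X ⊗[k] Y))) :
    embed k _ (rightSnd F v y) = F v * sndM k X Y y := embed_elt (hX.tensor hY) h

theorem embed_leftSnd (hX : IsNondegenerate X) (hY : IsNondegenerate Y) {v : V} {y : Y}
    (h : sndM k X Y y * F v ∈ LinearMap.range (embed k (X ⊗[k] Y))) :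
    embed k _ (leftSnd F v y) = sndM k X Y y * F v := embed_elt (hX.tensor hY) h

/-- A multiplier of `X ⊗ Y` is determined by its values on pure tensors. -/
theorem multiplier_tensor_ext (hX : IsNondegenerate X) (hY : IsNondegenerate Y)
    {m n : Multiplier k (X ⊗[k] Y)} (h : ∀ x y, m.1.1 (x ⊗ₜ y) = n.1.1 (x ⊗ₜ y)) : m = n :=
  multiplier_ext_fst (hX.tensor hY) fun s => LinearMap.congr_fun (TensorProduct.ext' h) s

theorem mul_fstM_eq_embed (hX : IsNondegenerate X) (hY : IsNondegenerate Y)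
    {m : Multiplier k (X ⊗[k] Y)} {x : X} {t : X ⊗[k] Y}
    (h : ∀ y, m.1.1 (x ⊗ₜ y) = (mulRight k y).lTensor X t) : m * fstM k X Y x = embed k _ t := by
  refine multiplier_tensor_ext hX hY fun x' y => ?_
  have h1 : (mulLeft k x).rTensor Y (x' ⊗ₜ[k] y) = (mulRight k x').rTensor Y (x ⊗ₜ[k] y) := by simp
  rw [mult_mul_fst, fstM_fst, embed_fst, mul_tmul_eq, ← h, h1, mult_mulRight hX hY]

theorem fstM_mul_eq_embed (hX : IsNondegenerate X) (hY : IsNondegenerate Y)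
    {m : Multiplier k (X ⊗[k] Y)} {x : X} {t : X ⊗[k] Y}
    (h : ∀ y, m.1.2.unop (x ⊗ₜ y) = (mulLeft k y).lTensor X t) :
    fstM k X Y x * m = embed k _ t := by
  refine multiplier_tensor_ext hX hY fun x' y => ?_
  refine (hX.tensor hY).eq_of_mul_left fun c => ?_
  rw [← mult_assoc, mult_mul_snd, fstM_snd]
  have h0 : ∀ c : X ⊗[k] Y, m.1.2.unop ((mulRight k x).rTensor Y c) = c * t := by
    intro c
    induction c with
    | zero => simp
    | add s s' hs hs' => simp only [map_add, add_mul, hs, hs']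
    | tmul a b =>
      have h1 : (mulRight k x).rTensor Y (a ⊗ₜ[k] b) = (mulLeft k a).rTensor Y (x ⊗ₜ[k] b) := by
        simp
      rw [h1, mult_mulLeft hX hY, h, ← tmul_mul_eq]
  rw [h0, embed_fst, mul_assoc]

theorem fst_tmul_of_covered (hX : IsNondegenerate X) (hY : IsNondegenerate Y) {v : V} {x : X}
    (h : F v * fstM k X Y x ∈ LinearMap.range (embed k (X ⊗[k] Y))) (y : Y) :
    (F v).1.1 (x ⊗ₜ y) = (mulRight k y).lTensor X (rightFst F v x) := by
  have e := embed_rightFst hX hY h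
  refine eq_of_mulRight_lTensor hY fun b => eq_of_mulRight_rTensor hX fun a => ?_
  rw [← mult_mulRight' hX hY, ← mult_mulRight hX hY]
  have e1 := LinearMap.congr_fun (congrArg (fun m : Multiplier k (X ⊗[k] Y) => m.1.1) e)
    (a ⊗ₜ (y * b))
  simp only [embed_fst, mult_mul_fst, fstM_fst, mul_tmul_eq] at e1
  simp only [LinearMap.lTensor_tmul, LinearMap.rTensor_tmul, LinearMap.mulRight_apply,
    LinearMap.mulLeft_apply] at e1 ⊢
  rw [← e1, ← LinearMap.lTensor_comp_apply]
  congr 3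
  ext
  simp [mul_assoc]

theorem snd_tmul_of_covered (hX : IsNondegenerate X) (hY : IsNondegenerate Y) {v : V} {x : X}
    (h : fstM k X Y x * F v ∈ LinearMap.range (embed k (X ⊗[k] Y))) (y : Y) :
    (F v).1.2.unop (x ⊗ₜ y) = (mulLeft k y).lTensor X (leftFst F v x) := by
  have e := embed_leftFst hX hY h
  refine eq_of_mulLeft_lTensor hY fun b => eq_of_mulLeft_rTensor hX fun a => ?_
  rw [← mult_mulLeft' hX hY, ← mult_mulLeft hX hY]
  have e1 := LinearMap.congr_fun (congrArg (fun m : Multiplier k (X ⊗[k] Y) => m.1.2.unop) e)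
    (a ⊗ₜ (b * y))
  simp only [embed_snd, mult_mul_snd, fstM_snd, tmul_mul_eq] at e1
  simp only [LinearMap.lTensor_tmul, LinearMap.rTensor_tmul, LinearMap.mulRight_apply,
    LinearMap.mulLeft_apply] at e1 ⊢
  rw [← e1, ← LinearMap.lTensor_comp_apply]
  congr 3
  ext
  simp

end Covers

/-! ### Exchanging the factors -/

section Flip

variable {k : Type u} [Field k]
variable {X : Type v} [NonUnitalRing X] [Module k X] [IsScalarTower k X X] [SMulCommClass k X X]
variable {Y : Type w} [NonUnitalRing Y] [Module k Y] [IsScalarTower k Y Y] [SMulCommClass k Y Y]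
variable {Z : Type w'} [NonUnitalRing Z] [Module k Z] [IsScalarTower k Z Z] [SMulCommClass k Z Z]

theorem congrM_fst (e : X ≃ₗ[k] Y) (he : ∀ x y, e (x * y) = e x * e y) (m : Multiplier k X) (t : Y) :
    (congrM e he m).1.1 t = e (m.1.1 (e.symm t)) := rfl

theorem congrM_snd (e : X ≃ₗ[k] Y) (he : ∀ x y, e (x * y) = e x * e y) (m : Multiplier k X) (t : Y) :
    (congrM e he m).1.2.unop t = e (m.1.2.unop (e.symm t)) := rfl

theorem congrM_mul (e : X ≃ₗ[k] Y) (he : ∀ x y, e (x * y) = e x * e y) (m n : Multiplier k X) :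
    congrM e he (m * n) = congrM e he m * congrM e he n := by
  refine Subtype.ext (Prod.ext (LinearMap.ext fun c => ?_)
    (MulOpposite.unop_injective (LinearMap.ext fun c => ?_)))
  · change e (m.1.1 (n.1.1 (e.symm c))) = e (m.1.1 (e.symm (e (n.1.1 (e.symm c)))))
    rw [e.symm_apply_apply]
  · change e (n.1.2.unop (m.1.2.unop (e.symm c))) =
      e (n.1.2.unop (e.symm (e (m.1.2.unop (e.symm c)))))
    rw [e.symm_apply_apply]

theorem congrM_embed (e : X ≃ₗ[k] Y) (he : ∀ x y, e (x * y) = e x * e y) (t : X) :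
    congrM e he (embed k X t) = embed k Y (e t) := by
  refine Subtype.ext (Prod.ext (LinearMap.ext fun c => ?_)
    (MulOpposite.unop_injective (LinearMap.ext fun c => ?_)))
  · change e (t * e.symm c) = e t * c
    rw [he, e.apply_symm_apply]
  · change e (e.symm c * t) = c * e t
    rw [he, e.apply_symm_apply]

/-- The flip `M(X ⊗ Y) → M(Y ⊗ X)`. -/
abbrev commM : Multiplier k (X ⊗[k] Y) →ₗ[k] Multiplier k (Y ⊗[k] X) :=
  congrM (TensorProduct.comm k X Y) comm_mul

theorem commM_commM (m : Multiplier k (X ⊗[k] Y)) : commM (commM m) = m := by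
  refine Subtype.ext (Prod.ext (LinearMap.ext fun c => ?_)
    (MulOpposite.unop_injective (LinearMap.ext fun c => ?_)))
  · change TensorProduct.comm k Y X (TensorProduct.comm k X Y _) = _
    simp
  · change TensorProduct.comm k Y X (TensorProduct.comm k X Y _) = _
    simp

theorem commM_fstM (x : X) : commM (fstM k X Y x) = sndM k Y X x := by
  refine Subtype.ext (Prod.ext (TensorProduct.ext' fun y x' => ?_)
    (MulOpposite.unop_injective (TensorProduct.ext' fun y x' => ?_))) <;> rfl

theorem commM_sndM (y : Y) : commM (sndM k X Y y) = fstM k Y X y := by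
  refine Subtype.ext (Prod.ext (TensorProduct.ext' fun y x' => ?_)
    (MulOpposite.unop_injective (TensorProduct.ext' fun y x' => ?_))) <;> rfl

theorem commM_mem_range {m : Multiplier k (X ⊗[k] Y)}
    (h : m ∈ LinearMap.range (embed k (X ⊗[k] Y))) :
    commM m ∈ LinearMap.range (embed k (Y ⊗[k] X)) := by
  obtain ⟨t, rfl⟩ := h
  exact ⟨_, (congrM_embed _ _ t).symm⟩

end Flip

/-! ### The four covered forms of a map into `M(X ⊗ Y)` -/

section FourForms

variable {k : Type u} [Field k]
variable {X : Type v} [NonUnitalRing X] [Module k X] [IsScalarTower k X X] [SMulCommClass k X X]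
variable {Y : Type w} [NonUnitalRing Y] [Module k Y] [IsScalarTower k Y Y] [SMulCommClass k Y Y]
variable {V : Type w'} [AddCommGroup V] [Module k V]

theorem rightFst_commM (hX : IsNondegenerate X) (hY : IsNondegenerate Y)
    {F : V →ₗ[k] Multiplier k (X ⊗[k] Y)} {v : V} {y : Y}
    (h : F v * sndM k X Y y ∈ LinearMap.range (embed k (X ⊗[k] Y))) :
    rightFst (commM ∘ₗ F) v y = TensorProduct.comm k X Y (rightSnd F v y) := by
  refine rightFst_eq hY hX ?_
  rw [← congrM_embed _ comm_mul, embed_rightSnd hX hY h, congrM_mul, ← commM_sndM]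
  rfl

theorem leftFst_commM (hX : IsNondegenerate X) (hY : IsNondegenerate Y)
    {F : V →ₗ[k] Multiplier k (X ⊗[k] Y)} {v : V} {y : Y}
    (h : sndM k X Y y * F v ∈ LinearMap.range (embed k (X ⊗[k] Y))) :
    leftFst (commM ∘ₗ F) v y = TensorProduct.comm k X Y (leftSnd F v y) := by
  refine leftFst_eq hY hX ?_
  rw [← congrM_embed _ comm_mul, embed_leftSnd hX hY h, congrM_mul, ← commM_sndM]
  rfl

theorem rightSnd_commM (hX : IsNondegenerate X) (hY : IsNondegenerate Y)
    {F : V →ₗ[k] Multiplier k (X ⊗[k] Y)} {v : V} {x : X}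
    (h : F v * fstM k X Y x ∈ LinearMap.range (embed k (X ⊗[k] Y))) :
    rightSnd (commM ∘ₗ F) v x = TensorProduct.comm k X Y (rightFst F v x) := by
  refine rightSnd_eq hY hX ?_
  rw [← congrM_embed _ comm_mul, embed_rightFst hX hY h, congrM_mul, ← commM_fstM]
  rfl

variable (hX : IsNondegenerate X) (hY : IsNondegenerate Y) {F : V →ₗ[k] Multiplier k (X ⊗[k] Y)}

theorem comm_lTensor_apply {V V' W : Type*} [AddCommMonoid V] [Module k V] [AddCommMonoid V']
    [Module k V'] [AddCommMonoid W] [Module k W] (f : V →ₗ[k] V') (t : W ⊗[k] V) :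
    TensorProduct.comm k W V' (f.lTensor W t) = f.rTensor W (TensorProduct.comm k W V t) := by
  induction t with
  | zero => simp
  | tmul a b => simp
  | add s t hs ht => simp only [map_add, hs, ht]

theorem comm_rTensor_apply {V V' W : Type*} [AddCommMonoid V] [Module k V] [AddCommMonoid V']
    [Module k V'] [AddCommMonoid W] [Module k W] (f : V →ₗ[k] V') (t : V ⊗[k] W) :
    TensorProduct.comm k V' W (f.rTensor W t) = f.lTensor W (TensorProduct.comm k V W t) := by
  induction t with
  | zero => simp
  | tmul a b => simp
  | add s t hs ht => simp only [map_add, hs, ht]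

theorem fst_tmul_of_covered_snd (hX : IsNondegenerate X) (hY : IsNondegenerate Y) {v : V} {y : Y}
    (h : F v * sndM k X Y y ∈ LinearMap.range (embed k (X ⊗[k] Y))) (x : X) :
    (F v).1.1 (x ⊗ₜ y) = (mulRight k x).rTensor Y (rightSnd F v y) := by
  have h' : (commM ∘ₗ F) v * fstM k Y X y ∈ LinearMap.range (embed k (Y ⊗[k] X)) := by
    have := commM_mem_range h
    rwa [congrM_mul, commM_sndM] at this
  have e := fst_tmul_of_covered hY hX h' x
  rw [rightFst_commM hX hY h, ← comm_rTensor_apply] at e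
  exact (TensorProduct.comm k X Y).injective e

theorem snd_tmul_of_covered_snd (hX : IsNondegenerate X) (hY : IsNondegenerate Y) {v : V} {y : Y}
    (h : sndM k X Y y * F v ∈ LinearMap.range (embed k (X ⊗[k] Y))) (x : X) :
    (F v).1.2.unop (x ⊗ₜ y) = (mulLeft k x).rTensor Y (leftSnd F v y) := by
  have h' : fstM k Y X y * (commM ∘ₗ F) v ∈ LinearMap.range (embed k (Y ⊗[k] X)) := by
    have := commM_mem_range h
    rwa [congrM_mul, commM_sndM] at this
  have e := snd_tmul_of_covered hY hX h' x
  rw [leftFst_commM hX hY h, ← comm_rTensor_apply] at e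
  exact (TensorProduct.comm k X Y).injective e


theorem compat_fst (hX : IsNondegenerate X) (hY : IsNondegenerate Y) {v : V} {e x : X}
    (h : F v * fstM k X Y x ∈ LinearMap.range (embed k (X ⊗[k] Y)))
    (h' : fstM k X Y e * F v ∈ LinearMap.range (embed k (X ⊗[k] Y))) :
    (mulLeft k e).rTensor Y (rightFst F v x) = (mulRight k x).rTensor Y (leftFst F v e) := by
  apply embed_injective (k := k) (hX.tensor hY)
  rw [← fstM_fst, ← mul_embed (hX.tensor hY), embed_rightFst hX hY h, ← mul_assoc,
    ← embed_leftFst hX hY h', embed_mul (hX.tensor hY), fstM_snd]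

theorem compat_snd (hX : IsNondegenerate X) (hY : IsNondegenerate Y) {v : V} {e y : Y}
    (h : F v * sndM k X Y y ∈ LinearMap.range (embed k (X ⊗[k] Y)))
    (h' : sndM k X Y e * F v ∈ LinearMap.range (embed k (X ⊗[k] Y))) :
    (mulLeft k e).lTensor X (rightSnd F v y) = (mulRight k y).lTensor X (leftSnd F v e) := by
  apply embed_injective (k := k) (hX.tensor hY)
  rw [← sndM_fst, ← mul_embed (hX.tensor hY), embed_rightSnd hX hY h, ← mul_assoc,
    ← embed_leftSnd hX hY h', embed_mul (hX.tensor hY), sndM_snd]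

end FourForms

/-! ### Counit and antipode -/

section Hopf

variable {k : Type u} [Field k]
variable {H : Type v} [NonUnitalRing H] [Module k H] [IsScalarTower k H H] [SMulCommClass k H H]
variable {Δ : H →ₗ[k] Multiplier k (H ⊗[k] H)}

theorem T₁_tmul (x y : H) : T₁ Δ (x ⊗ₜ y) = rightSnd Δ x y := rfl

theorem T₂_tmul (x y : H) : T₂ Δ (x ⊗ₜ y) = leftFst Δ y x := rfl

theorem IsComultiplication.fst_tmul (h : IsComultiplication Δ) (a x y : H) :
    (Δ a).1.1 (x ⊗ₜ y) = (mulRight k x).rTensor H (T₁ Δ (a ⊗ₜ y)) :=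
  fst_tmul_of_covered_snd h.nondegenerate h.nondegenerate (h.covered₁ a y) x

theorem IsComultiplication.snd_tmul (h : IsComultiplication Δ) (a x y : H) :
    (Δ a).1.2.unop (x ⊗ₜ y) = (mulLeft k y).lTensor H (T₂ Δ (x ⊗ₜ a)) :=
  snd_tmul_of_covered h.nondegenerate h.nondegenerate (h.covered₂ x a) y

theorem IsComultiplication.T₁_mul (h : IsComultiplication Δ) (x y z : H) :
    T₁ Δ ((x * y) ⊗ₜ z) = (Δ x).1.1 (T₁ Δ (y ⊗ₜ z)) := by
  have hH := h.nondegenerate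
  refine rightSnd_eq hH hH ?_
  rw [h.map_mul, mul_assoc, ← embed_rightSnd hH hH (h.covered₁ y z), mul_embed (hH.tensor hH)]
  rfl

theorem IsComultiplication.T₂_mul (h : IsComultiplication Δ) (x y z : H) :
    T₂ Δ (x ⊗ₜ (y * z)) = (Δ z).1.2.unop (T₂ Δ (x ⊗ₜ y)) := by
  have hH := h.nondegenerate
  refine leftFst_eq hH hH ?_
  rw [h.map_mul, ← mul_assoc, ← embed_leftFst hH hH (h.covered₂ x y), embed_mul (hH.tensor hH)]
  rfl

theorem flip_flip (Δ : H →ₗ[k] Multiplier k (H ⊗[k] H)) : flipComul (flipComul Δ) = Δ :=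
  LinearMap.ext fun x => commM_commM (Δ x)

theorem IsRegularMultiplierHopf.flip (h : IsRegularMultiplierHopf Δ) :
    IsRegularMultiplierHopf (flipComul Δ) :=
  ⟨h.flip_hopf, by rw [flip_flip]; exact h.hopf⟩

theorem IsRegularMultiplierHopf.coveredFst (h : IsRegularMultiplierHopf Δ) : CoveredFst Δ := by
  refine fun v x => ⟨?_, h.hopf.comul.covered₂ x v⟩
  have := commM_mem_range (h.flip_hopf.comul.covered₁ v x)
  rw [congrM_mul, commM_sndM] at this
  rwa [show commM (flipComul Δ v) = Δ v from commM_commM (Δ v)] at this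

theorem IsRegularMultiplierHopf.coveredSnd (h : IsRegularMultiplierHopf Δ) : CoveredSnd Δ := by
  refine fun v x => ⟨h.hopf.comul.covered₁ v x, ?_⟩
  have := commM_mem_range (h.flip_hopf.comul.covered₂ x v)
  rw [congrM_mul, commM_fstM] at this
  rwa [show commM (flipComul Δ v) = Δ v from commM_commM (Δ v)] at this

theorem IsRegularMultiplierHopf.nondegenerate (h : IsRegularMultiplierHopf Δ) :
    IsNondegenerate H := h.hopf.comul.nondegenerate

theorem IsRegularMultiplierHopf.T₁_flip (h : IsRegularMultiplierHopf Δ) (x y : H) :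
    T₁ (flipComul Δ) (x ⊗ₜ y) = TensorProduct.comm k H H (rightFst Δ x y) :=
  rightSnd_commM h.nondegenerate h.nondegenerate (h.coveredFst x y).1

theorem IsRegularMultiplierHopf.T₂_flip (h : IsRegularMultiplierHopf Δ) (x y : H) :
    T₂ (flipComul Δ) (x ⊗ₜ y) = TensorProduct.comm k H H (leftSnd Δ y x) :=
  leftFst_commM h.nondegenerate h.nondegenerate (h.coveredSnd y x).2

/-- The defining identities of the counit `ε` and the antipode `S`. -/
structure IsCounitAntipode (Δ : H →ₗ[k] Multiplier k (H ⊗[k] H)) (ε : H →ₗ[k] k) (S : H →ₗ[k] H) :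
    Prop where
  counit₁ : ∀ x y, TensorProduct.lid k H (ε.rTensor H (T₁ Δ (x ⊗ₜ y))) = x * y
  counit₂ : ∀ x y, TensorProduct.rid k H (ε.lTensor H (T₂ Δ (x ⊗ₜ y))) = x * y
  antipode₁ : ∀ x y, LinearMap.mul' k H (S.rTensor H (T₁ Δ (x ⊗ₜ y))) = ε x • y
  antipode₂ : ∀ x y, LinearMap.mul' k H (S.lTensor H (T₂ Δ (x ⊗ₜ y))) = ε y • x

theorem isAntipode_iff {S : H →ₗ[k] H} : IsAntipode Δ S ↔ ∃ ε, IsCounitAntipode Δ ε S :=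
  ⟨fun ⟨ε, h1, h2, h3, h4⟩ => ⟨ε, h1, h2, h3, h4⟩, fun ⟨ε, h1, h2, h3, h4⟩ => ⟨ε, h1, h2, h3, h4⟩⟩

variable {ε : H →ₗ[k] k} {S : H →ₗ[k] H}

/-- Multiplicativity of the counit: `(id ⊗ ε)(t Δ(c)) = (id ⊗ ε)(t) c` holds for `t` in the range of
`T₂`, hence for all `t`. -/
theorem IsCounitAntipode.counit_mul (h : IsMultiplierHopf Δ) (hS : IsCounitAntipode Δ ε S)
    (x y : H) : ε (x * y) = ε x * ε y := by
  have hc := h.comul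
  let f : H ⊗[k] H →ₗ[k] H := (TensorProduct.rid k H).toLinearMap ∘ₗ ε.lTensor H
  have hf : ∀ p q, f (p ⊗ₜ q) = ε q • p := fun p q => by simp [f]
  have h1 : ∀ (c : H) (s : H ⊗[k] H), f ((Δ c).1.2.unop s) = f s * c := by
    intro c s
    obtain ⟨s, rfl⟩ := h.bijective₂.2 s
    induction s with
    | zero => simp
    | add s t hs ht => simp only [map_add, add_mul, hs, ht]
    | tmul a b =>
      rw [← hc.T₂_mul]
      exact (hS.counit₂ _ _).trans (by rw [← mul_assoc]; exact congrArg (· * c) (hS.counit₂ _ _).symm)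
  have h2 : ∀ (q : H) (u : H ⊗[k] H), f ((mulLeft k q).lTensor H u) = ε q • f u := by
    intro q u
    obtain ⟨s, rfl⟩ := h.bijective₂.2 u
    induction s with
    | zero => simp
    | add s t hs ht => simp only [map_add, smul_add, hs, ht]
    | tmul p c =>
      rw [← hc.snd_tmul, h1, hf, smul_mul_assoc]
      exact congrArg (ε q • ·) (hS.counit₂ _ _).symm
  by_cases hH : ∃ p : H, p ≠ 0
  · obtain ⟨p, hp⟩ := hH
    have h3 := h2 x (p ⊗ₜ y)
    rw [LinearMap.lTensor_tmul, hf, hf, smul_smul] at h3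
    exact smul_left_injective k hp h3
  · push Not at hH
    rw [hH x, hH y]
    simp

/-- The antipode is antimultiplicative: `m(S ⊗ id)(Δ(x) u) = ε(x) m(S ⊗ id)(u)` holds for `u` in the
range of `T₁`, hence for all `u`. -/
theorem IsCounitAntipode.antipode_mul (h : IsMultiplierHopf Δ) (hS : IsCounitAntipode Δ ε S)
    (x y : H) : S (x * y) = S y * S x := by
  have hc := h.comul
  let g : H ⊗[k] H →ₗ[k] H := LinearMap.mul' k H ∘ₗ S.rTensor H
  have hg : ∀ p q, g (p ⊗ₜ q) = S p * q := fun p q => by simp [g]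
  have h1 : ∀ (c : H) (u : H ⊗[k] H), g ((Δ c).1.1 u) = ε c • g u := by
    intro c u
    obtain ⟨s, rfl⟩ := h.bijective₁.2 u
    induction s with
    | zero => simp
    | add s t hs ht => simp only [map_add, smul_add, hs, ht]
    | tmul a b =>
      rw [← hc.T₁_mul]
      refine (hS.antipode₁ _ _).trans ?_
      rw [hS.counit_mul h, mul_smul]
      exact congrArg (ε c • ·) (hS.antipode₁ _ _).symm
  have h2 : ∀ (q : H) (u : H ⊗[k] H), g ((mulRight k q).rTensor H u) = S q * g u := by
    intro q u
    obtain ⟨s, rfl⟩ := h.bijective₁.2 u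
    induction s with
    | zero => simp
    | add s t hs ht => simp only [map_add, mul_add, hs, ht]
    | tmul c r =>
      rw [← hc.fst_tmul, h1, hg, ← mul_smul_comm]
      exact congrArg (S q * ·) (hS.antipode₁ _ _).symm
  refine hc.nondegenerate.eq_of_mul_right fun s => ?_
  have h3 := h2 y (x ⊗ₜ s)
  rwa [LinearMap.rTensor_tmul, hg, hg, LinearMap.mulRight_apply, ← mul_assoc] at h3

/-- The antipode of the coopposite multiplier Hopf algebra is the inverse antipode. -/
theorem IsCounitAntipode.flip (h : IsRegularMultiplierHopf Δ) {S : H ≃ₗ[k] H}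
    (hS : IsCounitAntipode Δ ε S.toLinearMap) :
    IsCounitAntipode (flipComul Δ) ε S.symm.toLinearMap := by
  have hH := h.nondegenerate
  have hmul : ∀ x y, S (x * y) = S y * S x := hS.antipode_mul h.hopf
  let f : H ⊗[k] H →ₗ[k] H := (TensorProduct.rid k H).toLinearMap ∘ₗ ε.lTensor H
  let f' : H ⊗[k] H →ₗ[k] H := (TensorProduct.lid k H).toLinearMap ∘ₗ ε.rTensor H
  let g : H ⊗[k] H →ₗ[k] H := LinearMap.mul' k H ∘ₗ S.toLinearMap.rTensor H
  let g' : H ⊗[k] H →ₗ[k] H := LinearMap.mul' k H ∘ₗ S.toLinearMap.lTensor H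
  have hf : ∀ z u, f ((mulLeft k z).rTensor H u) = z * f u := fun z u => by
    induction u with
    | zero => simp
    | add s t hs ht => simp only [map_add, mul_add, hs, ht]
    | tmul a b => simp [f, mul_smul_comm]
  have hf1 : ∀ z u, f ((mulRight k z).rTensor H u) = f u * z := fun z u => by
    induction u with
    | zero => simp
    | add s t hs ht => simp only [map_add, add_mul, hs, ht]
    | tmul a b => simp [f, smul_mul_assoc]
  have hf' : ∀ z u, f' ((mulRight k z).lTensor H u) = f' u * z := fun z u => by
    induction u with
    | zero => simp
    | add s t hs ht => simp only [map_add, add_mul, hs, ht]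
    | tmul a b => simp [f', smul_mul_assoc]
  have hf'1 : ∀ z u, f' ((mulLeft k z).lTensor H u) = z * f' u := fun z u => by
    induction u with
    | zero => simp
    | add s t hs ht => simp only [map_add, mul_add, hs, ht]
    | tmul a b => simp [f', mul_smul_comm]
  have hg : ∀ z u, g ((mulRight k z).lTensor H u) = g u * z := fun z u => by
    induction u with
    | zero => simp
    | add s t hs ht => simp only [map_add, add_mul, hs, ht]
    | tmul a b => simp [g, mul_assoc]
  have hg1 : ∀ z u, g ((mulRight k z).rTensor H u) = S z * g u := fun z u => by
    induction u with
    | zero => simp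
    | add s t hs ht => simp only [map_add, mul_add, hs, ht]
    | tmul a b => simp [g, mul_assoc, hmul]
  have hg' : ∀ z u, g' ((mulLeft k z).rTensor H u) = z * g' u := fun z u => by
    induction u with
    | zero => simp
    | add s t hs ht => simp only [map_add, mul_add, hs, ht]
    | tmul a b => simp [g', mul_assoc]
  have hg'1 : ∀ z u, g' ((mulLeft k z).lTensor H u) = g' u * S z := fun z u => by
    induction u with
    | zero => simp
    | add s t hs ht => simp only [map_add, add_mul, hs, ht]
    | tmul a b => simp [g', mul_assoc, hmul]
  have fT : ∀ x y, f (T₂ Δ (x ⊗ₜ y)) = x * y := hS.counit₂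
  have f'T : ∀ x y, f' (T₁ Δ (x ⊗ₜ y)) = x * y := hS.counit₁
  have gT : ∀ x y, g (T₁ Δ (x ⊗ₜ y)) = ε x • y := hS.antipode₁
  have g'T : ∀ x y, g' (T₂ Δ (x ⊗ₜ y)) = ε y • x := hS.antipode₂
  have hsym : ∀ u, S (LinearMap.mul' k H (S.symm.toLinearMap.rTensor H
      (TensorProduct.comm k H H u))) = g u := fun u => by
    induction u with
    | zero => simp
    | add s t hs ht => simp only [map_add, hs, ht]
    | tmul a b => simp [g, hmul]
  have hsym' : ∀ u, S (LinearMap.mul' k H (S.symm.toLinearMap.lTensor H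
      (TensorProduct.comm k H H u))) = g' u := fun u => by
    induction u with
    | zero => simp
    | add s t hs ht => simp only [map_add, hs, ht]
    | tmul a b => simp [g', hmul]
  refine ⟨fun x y => ?_, fun x y => ?_, fun x y => ?_, fun x y => ?_⟩
  · rw [h.T₁_flip]
    have : f (rightFst Δ x y) = x * y := hH.eq_of_mul_left fun z => by
      rw [← hf, compat_fst hH hH (h.coveredFst x y).1 (h.coveredFst x z).2, hf1, ← T₂_tmul, fT,
        mul_assoc]
    rw [← this]
    generalize rightFst Δ x y = u
    induction u with
    | zero => simp
    | add s t hs ht => simp only [map_add, hs, ht]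
    | tmul a b => simp [f]
  · rw [h.T₂_flip]
    have : f' (leftSnd Δ y x) = x * y := hH.eq_of_mul_right fun z => by
      rw [← hf', ← compat_snd hH hH (h.coveredSnd y z).1 (h.coveredSnd y x).2, hf'1, ← T₁_tmul, f'T,
        mul_assoc]
    rw [← this]
    generalize leftSnd Δ y x = u
    induction u with
    | zero => simp
    | add s t hs ht => simp only [map_add, hs, ht]
    | tmul a b => simp [f']
  · rw [h.T₁_flip]
    apply S.injective
    rw [hsym, map_smul]
    refine hH.eq_of_mul_right fun z => ?_
    rw [← hg, ← fst_tmul_of_covered hH hH (h.coveredFst x y).1, h.hopf.comul.fst_tmul, hg1, gT,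
      mul_smul_comm, smul_mul_assoc]
  · rw [h.T₂_flip]
    apply S.injective
    rw [hsym', map_smul]
    refine hH.eq_of_mul_left fun z => ?_
    rw [← hg', ← snd_tmul_of_covered_snd hH hH (h.coveredSnd y x).2, h.hopf.comul.snd_tmul, hg'1,
      g'T, mul_smul_comm, smul_mul_assoc]

end Hopf

/-! ### Tensor products of multiplier Hopf algebras -/

section Tensor

variable {k : Type u} [Field k]
variable {H : Type v} [NonUnitalRing H] [Module k H] [IsScalarTower k H H] [SMulCommClass k H H]
variable {K : Type w} [NonUnitalRing K] [Module k K] [IsScalarTower k K K] [SMulCommClass k K K]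

theorem tmulM_mul (m m' : Multiplier k H) (n n' : Multiplier k K) :
    tmulM m n * tmulM m' n' = tmulM (m * m') (n * n') := by
  refine Subtype.ext (Prod.ext ?_ (MulOpposite.unop_injective ?_))
  · exact (TensorProduct.map_comp _ _ _ _).symm
  · exact (TensorProduct.map_comp _ _ _ _).symm

theorem tmulM_embed (s : H) (t : K) : tmulM (embed k H s) (embed k K t) = embed k _ (s ⊗ₜ t) := by
  refine Subtype.ext (Prod.ext (TensorProduct.ext' fun a b => ?_)
    (MulOpposite.unop_injective (TensorProduct.ext' fun a b => ?_)))
  · exact (Algebra.TensorProduct.tmul_mul_tmul (R := k) s a t b).symm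
  · exact (Algebra.TensorProduct.tmul_mul_tmul (R := k) a s b t).symm

/-- The shuffle `(H ⊗ H) ⊗ (K ⊗ K) ≃ (H ⊗ K) ⊗ (H ⊗ K)`. -/
abbrev shuffle (k : Type u) [Field k] (H : Type v) [AddCommMonoid H] [Module k H] (K : Type w)
    [AddCommMonoid K] [Module k K] : (H ⊗[k] H) ⊗[k] (K ⊗[k] K) ≃ₗ[k] (H ⊗[k] K) ⊗[k] (H ⊗[k] K) :=
  TensorProduct.tensorTensorTensorComm k H H K K

/-- The comultiplication `x ⊗ y ↦ ∑ (x₁ ⊗ y₁) ⊗ (x₂ ⊗ y₂)` of `H ⊗ K`. -/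
def tensorComul (Δ : H →ₗ[k] Multiplier k (H ⊗[k] H)) (Δ' : K →ₗ[k] Multiplier k (K ⊗[k] K)) :
    H ⊗[k] K →ₗ[k] Multiplier k ((H ⊗[k] K) ⊗[k] (H ⊗[k] K)) :=
  congrM (shuffle k H K) tensorComm_mul ∘ₗ TensorProduct.lift (tmulM.compl₁₂ Δ Δ')

theorem tensorComul_tmul (Δ : H →ₗ[k] Multiplier k (H ⊗[k] H))
    (Δ' : K →ₗ[k] Multiplier k (K ⊗[k] K)) (x : H) (y : K) :
    tensorComul Δ Δ' (x ⊗ₜ y) = congrM (shuffle k H K) tensorComm_mul (tmulM (Δ x) (Δ' y)) := rfl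

theorem sndM_tmul (x : H) (y : K) : sndM k (H ⊗[k] K) (H ⊗[k] K) (x ⊗ₜ y) =
    congrM (shuffle k H K) tensorComm_mul (tmulM (sndM k H H x) (sndM k K K y)) := by
  refine Subtype.ext (Prod.ext ?_ (MulOpposite.unop_injective ?_))
  · ext a b c d
    exact congrArg (fun z => (a ⊗ₜ[k] b) ⊗ₜ[k] z) (Algebra.TensorProduct.tmul_mul_tmul (R := k) x c y d)
  · ext a b c d
    exact congrArg (fun z => (a ⊗ₜ[k] b) ⊗ₜ[k] z) (Algebra.TensorProduct.tmul_mul_tmul (R := k) c x d y)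

theorem fstM_tmul (x : H) (y : K) : fstM k (H ⊗[k] K) (H ⊗[k] K) (x ⊗ₜ y) =
    congrM (shuffle k H K) tensorComm_mul (tmulM (fstM k H H x) (fstM k K K y)) := by
  refine Subtype.ext (Prod.ext ?_ (MulOpposite.unop_injective ?_))
  · ext a b c d
    exact congrArg (fun z => z ⊗ₜ[k] (c ⊗ₜ[k] d)) (Algebra.TensorProduct.tmul_mul_tmul (R := k) x a y b)
  · ext a b c d
    exact congrArg (fun z => z ⊗ₜ[k] (c ⊗ₜ[k] d)) (Algebra.TensorProduct.tmul_mul_tmul (R := k) a x b y)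

variable {Δ : H →ₗ[k] Multiplier k (H ⊗[k] H)} {Δ' : K →ₗ[k] Multiplier k (K ⊗[k] K)}

theorem tensorComul_mul_sndM (h : IsComultiplication Δ) (h' : IsComultiplication Δ')
    (x x' : H) (y y' : K) :
    tensorComul Δ Δ' (x ⊗ₜ y) * sndM k (H ⊗[k] K) (H ⊗[k] K) (x' ⊗ₜ y') =
      embed k _ (shuffle k H K (T₁ Δ (x ⊗ₜ x') ⊗ₜ T₁ Δ' (y ⊗ₜ y'))) := by
  have hH := h.nondegenerate
  have hK := h'.nondegenerate
  rw [tensorComul_tmul, sndM_tmul, ← congrM_mul, tmulM_mul, ← embed_rightSnd hH hH (h.covered₁ x x'),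
    ← embed_rightSnd hK hK (h'.covered₁ y y'), tmulM_embed, congrM_embed]
  rfl

theorem fstM_mul_tensorComul (h : IsComultiplication Δ) (h' : IsComultiplication Δ')
    (x x' : H) (y y' : K) :
    fstM k (H ⊗[k] K) (H ⊗[k] K) (x ⊗ₜ y) * tensorComul Δ Δ' (x' ⊗ₜ y') =
      embed k _ (shuffle k H K (T₂ Δ (x ⊗ₜ x') ⊗ₜ T₂ Δ' (y ⊗ₜ y'))) := by
  have hH := h.nondegenerate
  have hK := h'.nondegenerate
  rw [tensorComul_tmul, fstM_tmul, ← congrM_mul, tmulM_mul, ← embed_leftFst hH hH (h.covered₂ x x'),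
    ← embed_leftFst hK hK (h'.covered₂ y y'), tmulM_embed, congrM_embed]
  rfl

theorem T₁_tensorComul (h : IsComultiplication Δ) (h' : IsComultiplication Δ')
    (s : H ⊗[k] H) (t : K ⊗[k] K) : T₁ (tensorComul Δ Δ') (shuffle k H K (s ⊗ₜ t)) =
      shuffle k H K (T₁ Δ s ⊗ₜ T₁ Δ' t) := by
  induction s with
  | zero => simp
  | add s s' hs hs' => simp only [map_add, TensorProduct.add_tmul, hs, hs']
  | tmul x x' =>
    induction t with
    | zero => simp
    | add s s' hs hs' => simp only [map_add, TensorProduct.tmul_add, hs, hs']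
    | tmul y y' =>
      have hE := h.nondegenerate.tensor (k := k) h'.nondegenerate
      exact rightSnd_eq hE hE (tensorComul_mul_sndM h h' x x' y y')

theorem T₂_tensorComul (h : IsComultiplication Δ) (h' : IsComultiplication Δ')
    (s : H ⊗[k] H) (t : K ⊗[k] K) : T₂ (tensorComul Δ Δ') (shuffle k H K (s ⊗ₜ t)) =
      shuffle k H K (T₂ Δ s ⊗ₜ T₂ Δ' t) := by
  induction s with
  | zero => simp
  | add s s' hs hs' => simp only [map_add, TensorProduct.add_tmul, hs, hs']
  | tmul x x' =>
    induction t with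
    | zero => simp
    | add s s' hs hs' => simp only [map_add, TensorProduct.tmul_add, hs, hs']
    | tmul y y' =>
      have hE := h.nondegenerate.tensor (k := k) h'.nondegenerate
      exact leftFst_eq hE hE (fstM_mul_tensorComul h h' x x' y y')

/-- A conjugate of a tensor product of bijective maps is bijective. -/
theorem bijective_of_shuffle {f : H ⊗[k] H →ₗ[k] H ⊗[k] H} {g : K ⊗[k] K →ₗ[k] K ⊗[k] K}
    {F : (H ⊗[k] K) ⊗[k] (H ⊗[k] K) →ₗ[k] (H ⊗[k] K) ⊗[k] (H ⊗[k] K)}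
    (hf : Function.Bijective f) (hg : Function.Bijective g)
    (hF : ∀ s t, F (shuffle k H K (s ⊗ₜ t)) = shuffle k H K (f s ⊗ₜ g t)) :
    Function.Bijective F := by
  have h1 : ∀ z, F z = shuffle k H K (TensorProduct.congr (LinearEquiv.ofBijective f hf)
      (LinearEquiv.ofBijective g hg) ((shuffle k H K).symm z)) := by
    intro z
    obtain ⟨z, rfl⟩ := (shuffle k H K).surjective z
    rw [LinearEquiv.symm_apply_apply]
    induction z with
    | zero => simp only [map_zero]
    | add s t hs ht => simp only [map_add, hs, ht]
    | tmul s t => rw [hF]; rfl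
  have h2 : (F : _ → _) = (((shuffle k H K).symm.trans (TensorProduct.congr
      (LinearEquiv.ofBijective f hf) (LinearEquiv.ofBijective g hg))).trans (shuffle k H K)) :=
    funext h1
  rw [h2]
  exact LinearEquiv.bijective _

/-- The shuffle `(H ⊗ H ⊗ H) ⊗ (K ⊗ K ⊗ K) ≃ (H ⊗ K) ⊗ (H ⊗ K) ⊗ (H ⊗ K)`. -/
def shuffle₃ (k : Type u) [Field k] (H : Type v) [AddCommMonoid H] [Module k H] (K : Type w)
    [AddCommMonoid K] [Module k K] : (H ⊗[k] (H ⊗[k] H)) ⊗[k] (K ⊗[k] (K ⊗[k] K)) ≃ₗ[k]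
      (H ⊗[k] K) ⊗[k] ((H ⊗[k] K) ⊗[k] (H ⊗[k] K)) :=
  (TensorProduct.tensorTensorTensorComm k H (H ⊗[k] H) K (K ⊗[k] K)).trans
    ((shuffle k H K).lTensor (H ⊗[k] K))

theorem shuffle₃_assoc (s : H ⊗[k] H) (x : H) (t : K ⊗[k] K) (y : K) :
    shuffle₃ k H K (TensorProduct.assoc k H H H (s ⊗ₜ x) ⊗ₜ TensorProduct.assoc k K K K (t ⊗ₜ y)) =
      TensorProduct.assoc k _ _ _ (shuffle k H K (s ⊗ₜ t) ⊗ₜ (x ⊗ₜ y)) := by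
  induction s with
  | zero => simp
  | add s s' hs hs' => simp only [map_add, TensorProduct.add_tmul, hs, hs']
  | tmul a b =>
    induction t with
    | zero => simp
    | add s s' hs hs' => simp only [map_add, TensorProduct.tmul_add, TensorProduct.add_tmul, hs, hs']
    | tmul c d => simp [shuffle₃, LinearEquiv.lTensor]

theorem lTensor_shuffle₃ {f : H ⊗[k] H →ₗ[k] H ⊗[k] H} {g : K ⊗[k] K →ₗ[k] K ⊗[k] K}
    {F : (H ⊗[k] K) ⊗[k] (H ⊗[k] K) →ₗ[k] (H ⊗[k] K) ⊗[k] (H ⊗[k] K)}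
    (hF : ∀ s t, F (shuffle k H K (s ⊗ₜ t)) = shuffle k H K (f s ⊗ₜ g t)) (s t) :
    F.lTensor (H ⊗[k] K) (shuffle₃ k H K (s ⊗ₜ t)) =
      shuffle₃ k H K (f.lTensor H s ⊗ₜ g.lTensor K t) := by
  have h : ∀ x s y t, shuffle₃ k H K ((x ⊗ₜ s) ⊗ₜ (y ⊗ₜ t)) =
      (x ⊗ₜ y) ⊗ₜ[k] shuffle k H K (s ⊗ₜ t) := fun x s y t => rfl
  induction s with
  | zero => simp
  | add s s' hs hs' => simp only [map_add, TensorProduct.add_tmul, hs, hs']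
  | tmul x s =>
    induction t with
    | zero => simp
    | add s s' hs hs' => simp only [map_add, TensorProduct.tmul_add, hs, hs']
    | tmul y t => rw [h, LinearMap.lTensor_tmul, LinearMap.lTensor_tmul, LinearMap.lTensor_tmul, h, hF]

theorem rTensor_shuffle₃ {f : H ⊗[k] H →ₗ[k] H ⊗[k] H} {g : K ⊗[k] K →ₗ[k] K ⊗[k] K}
    {F : (H ⊗[k] K) ⊗[k] (H ⊗[k] K) →ₗ[k] (H ⊗[k] K) ⊗[k] (H ⊗[k] K)}
    (hF : ∀ s t, F (shuffle k H K (s ⊗ₜ t)) = shuffle k H K (f s ⊗ₜ g t)) (s t) :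
    TensorProduct.assoc k _ _ _ (F.rTensor (H ⊗[k] K)
        ((TensorProduct.assoc k _ _ _).symm (shuffle₃ k H K (s ⊗ₜ t)))) =
      shuffle₃ k H K (TensorProduct.assoc k H H H (f.rTensor H ((TensorProduct.assoc k H H H).symm s))
        ⊗ₜ TensorProduct.assoc k K K K (g.rTensor K ((TensorProduct.assoc k K K K).symm t))) := by
  obtain ⟨s, rfl⟩ := (TensorProduct.assoc k H H H).surjective s
  obtain ⟨t, rfl⟩ := (TensorProduct.assoc k K K K).surjective t
  rw [LinearEquiv.symm_apply_apply, LinearEquiv.symm_apply_apply]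
  induction s with
  | zero => simp
  | add s s' hs hs' => simp only [map_add, TensorProduct.add_tmul, hs, hs']
  | tmul s x =>
    induction t with
    | zero => simp
    | add s s' hs hs' => simp only [map_add, TensorProduct.tmul_add, hs, hs']
    | tmul t y =>
      rw [shuffle₃_assoc, LinearEquiv.symm_apply_apply, LinearMap.rTensor_tmul, hF,
        LinearMap.rTensor_tmul, LinearMap.rTensor_tmul, shuffle₃_assoc]

theorem coassoc_of_shuffle {f f' : H ⊗[k] H →ₗ[k] H ⊗[k] H} {g g' : K ⊗[k] K →ₗ[k] K ⊗[k] K}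
    {F F' : (H ⊗[k] K) ⊗[k] (H ⊗[k] K) →ₗ[k] (H ⊗[k] K) ⊗[k] (H ⊗[k] K)}
    (hF : ∀ s t, F (shuffle k H K (s ⊗ₜ t)) = shuffle k H K (f s ⊗ₜ g t))
    (hF' : ∀ s t, F' (shuffle k H K (s ⊗ₜ t)) = shuffle k H K (f' s ⊗ₜ g' t))
    (hf : ∀ t, TensorProduct.assoc k H H H (f'.rTensor H
        ((TensorProduct.assoc k H H H).symm (f.lTensor H t))) =
      f.lTensor H (TensorProduct.assoc k H H H (f'.rTensor H
        ((TensorProduct.assoc k H H H).symm t))))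
    (hg : ∀ t, TensorProduct.assoc k K K K (g'.rTensor K
        ((TensorProduct.assoc k K K K).symm (g.lTensor K t))) =
      g.lTensor K (TensorProduct.assoc k K K K (g'.rTensor K
        ((TensorProduct.assoc k K K K).symm t)))) (z) :
    TensorProduct.assoc k _ _ _ (F'.rTensor (H ⊗[k] K)
        ((TensorProduct.assoc k _ _ _).symm (F.lTensor (H ⊗[k] K) z))) =
      F.lTensor (H ⊗[k] K) (TensorProduct.assoc k _ _ _ (F'.rTensor (H ⊗[k] K)
        ((TensorProduct.assoc k _ _ _).symm z))) := by
  let A := (TensorProduct.assoc k (H ⊗[k] K) (H ⊗[k] K) (H ⊗[k] K)).toLinearMap ∘ₗ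
    F'.rTensor (H ⊗[k] K) ∘ₗ
      (TensorProduct.assoc k (H ⊗[k] K) (H ⊗[k] K) (H ⊗[k] K)).symm.toLinearMap
  have key : (A ∘ₗ F.lTensor (H ⊗[k] K)) ∘ₗ (shuffle₃ k H K).toLinearMap =
      (F.lTensor (H ⊗[k] K) ∘ₗ A) ∘ₗ (shuffle₃ k H K).toLinearMap := by
    refine TensorProduct.ext' fun s t => ?_
    change A (F.lTensor (H ⊗[k] K) (shuffle₃ k H K (s ⊗ₜ t))) =
      F.lTensor (H ⊗[k] K) (A (shuffle₃ k H K (s ⊗ₜ t)))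
    rw [lTensor_shuffle₃ hF, show A (shuffle₃ k H K (s ⊗ₜ t)) = _ from rTensor_shuffle₃ hF' s t,
      lTensor_shuffle₃ hF, ← hf, ← hg]
    exact rTensor_shuffle₃ hF' _ _
  obtain ⟨z, rfl⟩ := (shuffle₃ k H K).surjective z
  exact LinearMap.congr_fun key z

theorem map_mul_of_tmul {B : Type*} [NonUnitalNonAssocSemiring B] [Module k B]
    (F : H ⊗[k] K →ₗ[k] B)
    (hF : ∀ x y x' y', F ((x * x') ⊗ₜ (y * y')) = F (x ⊗ₜ y) * F (x' ⊗ₜ y')) (s t : H ⊗[k] K) :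
    F (s * t) = F s * F t := by
  induction s with
  | zero => rw [zero_mul, map_zero, zero_mul]
  | add s s' hs hs' => rw [add_mul, map_add, map_add, add_mul, hs, hs']
  | tmul x y =>
    induction t with
    | zero => rw [mul_zero, map_zero, mul_zero]
    | add s s' hs hs' => rw [mul_add, map_add, map_add, mul_add, hs, hs']
    | tmul x' y' => rw [Algebra.TensorProduct.tmul_mul_tmul, hF]

theorem mul_mem_of_tmul {B : Type*} [NonUnitalNonAssocSemiring B] [Module k B]
    (F G : H ⊗[k] K →ₗ[k] B) (R : Submodule k B)
    (hF : ∀ x y x' y', F (x ⊗ₜ y) * G (x' ⊗ₜ y') ∈ R) (s t : H ⊗[k] K) : F s * G t ∈ R := by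
  induction s with
  | zero => rw [map_zero, zero_mul]; exact zero_mem _
  | add s s' hs hs' => rw [map_add, add_mul]; exact add_mem hs hs'
  | tmul x y =>
    induction t with
    | zero => rw [map_zero, mul_zero]; exact zero_mem _
    | add s s' hs hs' => rw [map_add, mul_add]; exact add_mem hs hs'
    | tmul x' y' => exact hF x y x' y'

theorem IsComultiplication.tensor (h : IsComultiplication Δ) (h' : IsComultiplication Δ') :
    IsComultiplication (tensorComul Δ Δ' :) where
  nondegenerate := h.nondegenerate.tensor h'.nondegenerate
  map_mul := map_mul_of_tmul _ fun x y x' y' => by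
    rw [tensorComul_tmul, tensorComul_tmul, tensorComul_tmul, ← congrM_mul, tmulM_mul, h.map_mul,
      h'.map_mul]
  covered₁ := mul_mem_of_tmul _ _ _ fun x y x' y' =>
    ⟨_, (tensorComul_mul_sndM h h' x x' y y').symm⟩
  covered₂ := mul_mem_of_tmul _ _ _ fun x y x' y' =>
    ⟨_, (fstM_mul_tensorComul h h' x x' y y').symm⟩
  coassoc := coassoc_of_shuffle (T₁_tensorComul h h') (T₂_tensorComul h h') h.coassoc h'.coassoc

theorem IsMultiplierHopf.tensor (h : IsMultiplierHopf Δ) (h' : IsMultiplierHopf Δ') :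
    IsMultiplierHopf (tensorComul Δ Δ' :) where
  comul := h.comul.tensor h'.comul
  bijective₁ := bijective_of_shuffle h.bijective₁ h'.bijective₁ (T₁_tensorComul h.comul h'.comul)
  bijective₂ := bijective_of_shuffle h.bijective₂ h'.bijective₂ (T₂_tensorComul h.comul h'.comul)

theorem comm_shuffle (s : H ⊗[k] H) (t : K ⊗[k] K) :
    TensorProduct.comm k (H ⊗[k] K) (H ⊗[k] K) (shuffle k H K (s ⊗ₜ t)) =
      shuffle k H K (TensorProduct.comm k H H s ⊗ₜ TensorProduct.comm k K K t) := by
  have e : (shuffle k H K).toLinearMap ∘ₗ TensorProduct.map (TensorProduct.comm k H H).toLinearMap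
      (TensorProduct.comm k K K).toLinearMap =
      (TensorProduct.comm k (H ⊗[k] K) (H ⊗[k] K)).toLinearMap ∘ₗ (shuffle k H K).toLinearMap := by
    ext a b c d
    rfl
  exact (LinearMap.congr_fun e (s ⊗ₜ t)).symm

theorem flip_tensorComul (Δ : H →ₗ[k] Multiplier k (H ⊗[k] H))
    (Δ' : K →ₗ[k] Multiplier k (K ⊗[k] K)) :
    flipComul (tensorComul Δ Δ' :) = tensorComul (flipComul Δ :) (flipComul Δ' :) := by
  refine TensorProduct.ext' fun x y => Subtype.ext (Prod.ext ?_ (MulOpposite.unop_injective ?_))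
  · ext a b c d
    exact comm_shuffle ((Δ x).1.1 (c ⊗ₜ a)) ((Δ' y).1.1 (d ⊗ₜ b))
  · ext a b c d
    exact comm_shuffle ((Δ x).1.2.unop (c ⊗ₜ a)) ((Δ' y).1.2.unop (d ⊗ₜ b))

theorem IsRegularMultiplierHopf.tensor (h : IsRegularMultiplierHopf Δ)
    (h' : IsRegularMultiplierHopf Δ') : IsRegularMultiplierHopf (tensorComul Δ Δ' :) :=
  ⟨h.hopf.tensor h'.hopf, by rw [flip_tensorComul]; exact h.flip_hopf.tensor h'.flip_hopf⟩

end Tensor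

/-! ### The opposite multiplier Hopf algebra -/

section Opposite

variable {k : Type u} [Field k]
variable {H : Type v} [NonUnitalRing H] [Module k H] [IsScalarTower k H H] [SMulCommClass k H H]

/-- The multiplier of `Hᵒᵖ ⊗ Hᵒᵖ` given by a multiplier of `H ⊗ H`. -/
def opTensorM : Multiplier k (H ⊗[k] H) →ₗ[k] Multiplier k (Hᵐᵒᵖ ⊗[k] Hᵐᵒᵖ) :=
  congrM opTensor opTensor_mul ∘ₗ opM

theorem opTensorM_mul (m n : Multiplier k (H ⊗[k] H)) :
    opTensorM (m * n) = opTensorM n * opTensorM m := by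
  refine Subtype.ext (Prod.ext (LinearMap.ext fun t => ?_)
    (MulOpposite.unop_injective (LinearMap.ext fun t => ?_)))
  · let u : H ⊗[k] H := m.1.2.unop (opTensor.symm t : (H ⊗[k] H)ᵐᵒᵖ).unop
    exact congrArg (fun v : (H ⊗[k] H)ᵐᵒᵖ => opTensor (MulOpposite.op (n.1.2.unop v.unop)))
      (opTensor.symm_apply_apply (MulOpposite.op u)).symm
  · let u : H ⊗[k] H := n.1.1 (opTensor.symm t : (H ⊗[k] H)ᵐᵒᵖ).unop
    exact congrArg (fun v : (H ⊗[k] H)ᵐᵒᵖ => opTensor (MulOpposite.op (m.1.1 v.unop)))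
      (opTensor.symm_apply_apply (MulOpposite.op u)).symm

variable (k H) in
/-- `x ⊗ y ↦ op y ⊗ op x`. -/
def opSwap : H ⊗[k] H ≃ₗ[k] Hᵐᵒᵖ ⊗[k] Hᵐᵒᵖ :=
  TensorProduct.comm k H H ≪≫ₗ
    TensorProduct.congr (MulOpposite.opLinearEquiv k) (MulOpposite.opLinearEquiv k)

theorem opTensorM_embed (t : H ⊗[k] H) : opTensorM (embed k _ t) =
    embed k (Hᵐᵒᵖ ⊗[k] Hᵐᵒᵖ) (opSwap k H (TensorProduct.comm k H H t)) := by
  have e : embed k (Hᵐᵒᵖ ⊗[k] Hᵐᵒᵖ) (opTensor (MulOpposite.op t)) = _ :=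
    (congrM_embed opTensor opTensor_mul (MulOpposite.op t)).symm
  refine Eq.trans ?_ (e.symm.trans (congrArg (embed k _) ?_))
  · rfl
  · exact congrArg (TensorProduct.congr (MulOpposite.opLinearEquiv k) (MulOpposite.opLinearEquiv k))
      (TensorProduct.comm_comm k H H t).symm

theorem opTensorM_fstM (x : H) : opTensorM (fstM k H H x) = fstM k Hᵐᵒᵖ Hᵐᵒᵖ (MulOpposite.op x) := by
  refine Subtype.ext (Prod.ext ?_ (MulOpposite.unop_injective ?_))
  · ext a b
    rfl
  · ext a b
    rfl

theorem opTensorM_sndM (x : H) : opTensorM (sndM k H H x) = sndM k Hᵐᵒᵖ Hᵐᵒᵖ (MulOpposite.op x) := by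
  refine Subtype.ext (Prod.ext ?_ (MulOpposite.unop_injective ?_))
  · ext a b
    rfl
  · ext a b
    rfl

variable {Δ : H →ₗ[k] Multiplier k (H ⊗[k] H)}

theorem opComul_op (x : H) : opComul Δ (MulOpposite.op x) = opTensorM (Δ x) := rfl

theorem IsRegularMultiplierHopf.opComul_mul_sndM (h : IsRegularMultiplierHopf Δ) (x y : H) :
    opComul Δ (MulOpposite.op x) * sndM k Hᵐᵒᵖ Hᵐᵒᵖ (MulOpposite.op y) =
      embed k _ (opSwap k H (T₂ (flipComul Δ) (y ⊗ₜ x))) := by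
  rw [h.T₂_flip, ← opTensorM_embed, embed_leftSnd h.nondegenerate h.nondegenerate
    (h.coveredSnd x y).2, opTensorM_mul, opTensorM_sndM]
  rfl

theorem IsRegularMultiplierHopf.fstM_mul_opComul (h : IsRegularMultiplierHopf Δ) (x y : H) :
    fstM k Hᵐᵒᵖ Hᵐᵒᵖ (MulOpposite.op x) * opComul Δ (MulOpposite.op y) =
      embed k _ (opSwap k H (T₁ (flipComul Δ) (y ⊗ₜ x))) := by
  rw [h.T₁_flip, ← opTensorM_embed, embed_rightFst h.nondegenerate h.nondegenerate
    (h.coveredFst y x).1, opTensorM_mul, opTensorM_fstM]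
  rfl

theorem IsRegularMultiplierHopf.T₁_opComul (h : IsRegularMultiplierHopf Δ) (t : H ⊗[k] H) :
    T₁ (opComul Δ :) (opSwap k H t) = opSwap k H (T₂ (flipComul Δ) t) := by
  have e : T₁ (opComul Δ :) ∘ₗ (opSwap k H).toLinearMap =
      (opSwap k H).toLinearMap ∘ₗ T₂ (flipComul Δ) := TensorProduct.ext' fun x y =>
    rightSnd_eq h.nondegenerate.op h.nondegenerate.op (h.opComul_mul_sndM y x)
  exact LinearMap.congr_fun e t

theorem IsRegularMultiplierHopf.T₂_opComul (h : IsRegularMultiplierHopf Δ) (t : H ⊗[k] H) :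
    T₂ (opComul Δ :) (opSwap k H t) = opSwap k H (T₁ (flipComul Δ) t) := by
  have e : T₂ (opComul Δ :) ∘ₗ (opSwap k H).toLinearMap =
      (opSwap k H).toLinearMap ∘ₗ T₁ (flipComul Δ) := TensorProduct.ext' fun x y =>
    leftFst_eq h.nondegenerate.op h.nondegenerate.op (h.fstM_mul_opComul y x)
  exact LinearMap.congr_fun e t

variable (k H) in
/-- `x ⊗ (y ⊗ z) ↦ op z ⊗ (op y ⊗ op x)`. -/
def opSwap₃ : H ⊗[k] (H ⊗[k] H) ≃ₗ[k] Hᵐᵒᵖ ⊗[k] (Hᵐᵒᵖ ⊗[k] Hᵐᵒᵖ) :=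
  TensorProduct.congr (MulOpposite.opLinearEquiv k) (opSwap k H) ≪≫ₗ
    TensorProduct.comm k Hᵐᵒᵖ (Hᵐᵒᵖ ⊗[k] Hᵐᵒᵖ) ≪≫ₗ TensorProduct.assoc k Hᵐᵒᵖ Hᵐᵒᵖ Hᵐᵒᵖ

theorem opSwap₃_tmul (x : H) (t : H ⊗[k] H) : opSwap₃ k H (x ⊗ₜ t) =
    TensorProduct.assoc k Hᵐᵒᵖ Hᵐᵒᵖ Hᵐᵒᵖ (opSwap k H t ⊗ₜ MulOpposite.op x) := rfl

theorem opSwap₃_assoc (t : H ⊗[k] H) (x : H) :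
    opSwap₃ k H (TensorProduct.assoc k H H H (t ⊗ₜ x)) = MulOpposite.op x ⊗ₜ opSwap k H t := by
  induction t with
  | zero => simp
  | add s s' hs hs' => simp only [TensorProduct.add_tmul, TensorProduct.tmul_add, map_add, hs, hs']
  | tmul a b => rfl

theorem rTensor_opSwap₃ {f : H ⊗[k] H →ₗ[k] H ⊗[k] H} {g : Hᵐᵒᵖ ⊗[k] Hᵐᵒᵖ →ₗ[k] Hᵐᵒᵖ ⊗[k] Hᵐᵒᵖ}
    (hfg : ∀ t, g (opSwap k H t) = opSwap k H (f t)) (t : H ⊗[k] (H ⊗[k] H)) :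
    TensorProduct.assoc k Hᵐᵒᵖ Hᵐᵒᵖ Hᵐᵒᵖ (g.rTensor Hᵐᵒᵖ
        ((TensorProduct.assoc k Hᵐᵒᵖ Hᵐᵒᵖ Hᵐᵒᵖ).symm (opSwap₃ k H t))) =
      opSwap₃ k H (f.lTensor H t) := by
  induction t with
  | zero => simp
  | add s s' hs hs' => simp only [map_add, hs, hs']
  | tmul x t =>
    rw [opSwap₃_tmul, LinearEquiv.symm_apply_apply, LinearMap.rTensor_tmul, hfg,
      LinearMap.lTensor_tmul, opSwap₃_tmul]

theorem lTensor_opSwap₃ {f : H ⊗[k] H →ₗ[k] H ⊗[k] H} {g : Hᵐᵒᵖ ⊗[k] Hᵐᵒᵖ →ₗ[k] Hᵐᵒᵖ ⊗[k] Hᵐᵒᵖ}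
    (hfg : ∀ t, g (opSwap k H t) = opSwap k H (f t)) (t : H ⊗[k] (H ⊗[k] H)) :
    g.lTensor Hᵐᵒᵖ (opSwap₃ k H t) = opSwap₃ k H (TensorProduct.assoc k H H H
      (f.rTensor H ((TensorProduct.assoc k H H H).symm t))) := by
  obtain ⟨t, rfl⟩ := (TensorProduct.assoc k H H H).surjective t
  rw [LinearEquiv.symm_apply_apply]
  induction t with
  | zero => simp
  | add s s' hs hs' => simp only [map_add, hs, hs']
  | tmul t x =>
    rw [opSwap₃_assoc, LinearMap.lTensor_tmul, hfg, LinearMap.rTensor_tmul, opSwap₃_assoc]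

theorem bijective_of_opSwap {f : H ⊗[k] H →ₗ[k] H ⊗[k] H}
    {g : Hᵐᵒᵖ ⊗[k] Hᵐᵒᵖ →ₗ[k] Hᵐᵒᵖ ⊗[k] Hᵐᵒᵖ} (hf : Function.Bijective f)
    (hfg : ∀ t, g (opSwap k H t) = opSwap k H (f t)) : Function.Bijective g := by
  have e : g = (opSwap k H).toLinearMap ∘ₗ f ∘ₗ (opSwap k H).symm.toLinearMap := by
    refine LinearMap.ext fun t => ?_
    obtain ⟨t, rfl⟩ := (opSwap k H).surjective t
    simp [hfg]
  rw [e]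
  exact (opSwap k H).bijective.comp (hf.comp (opSwap k H).symm.bijective)

theorem IsRegularMultiplierHopf.isMultiplierHopf_opComul (h : IsRegularMultiplierHopf Δ) :
    IsMultiplierHopf (opComul Δ :) where
  comul :=
    { nondegenerate := h.nondegenerate.op
      map_mul := fun x y => by
        obtain ⟨x, rfl⟩ := MulOpposite.op_surjective x
        obtain ⟨y, rfl⟩ := MulOpposite.op_surjective y
        rw [← MulOpposite.op_mul, opComul_op, h.hopf.comul.map_mul, opTensorM_mul]
        rfl
      covered₁ := fun x y => ⟨_, (h.opComul_mul_sndM x.unop y.unop).symm⟩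
      covered₂ := fun x y => ⟨_, (h.fstM_mul_opComul x.unop y.unop).symm⟩
      coassoc := fun t => by
        obtain ⟨t, rfl⟩ := (opSwap₃ k H).surjective t
        rw [lTensor_opSwap₃ h.T₁_opComul, rTensor_opSwap₃ h.T₂_opComul,
          rTensor_opSwap₃ h.T₂_opComul, lTensor_opSwap₃ h.T₁_opComul, h.flip_hopf.comul.coassoc] }
  bijective₁ := bijective_of_opSwap h.flip_hopf.bijective₂ h.T₁_opComul
  bijective₂ := bijective_of_opSwap h.flip_hopf.bijective₁ h.T₂_opComul

theorem comm_opTensor (t : H ⊗[k] H) :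
    TensorProduct.comm k Hᵐᵒᵖ Hᵐᵒᵖ (opTensor (MulOpposite.op t)) =
      opTensor (MulOpposite.op (TensorProduct.comm k H H t)) := by
  have e : (TensorProduct.comm k Hᵐᵒᵖ Hᵐᵒᵖ).toLinearMap ∘ₗ TensorProduct.map
      (MulOpposite.opLinearEquiv k).toLinearMap (MulOpposite.opLinearEquiv k).toLinearMap =
      TensorProduct.map (MulOpposite.opLinearEquiv k).toLinearMap
        (MulOpposite.opLinearEquiv k).toLinearMap ∘ₗ (TensorProduct.comm k H H).toLinearMap := by
    ext
    rfl
  exact LinearMap.congr_fun e t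

theorem flip_opComul (Δ : H →ₗ[k] Multiplier k (H ⊗[k] H)) :
    flipComul (opComul Δ :) = opComul (flipComul Δ) := by
  refine LinearMap.ext fun x => Subtype.ext (Prod.ext ?_ (MulOpposite.unop_injective ?_))
  · ext a b
    exact comm_opTensor ((Δ x.unop).1.2.unop (b.unop ⊗ₜ a.unop))
  · ext a b
    exact comm_opTensor ((Δ x.unop).1.1 (b.unop ⊗ₜ a.unop))

theorem IsRegularMultiplierHopf.opComul (h : IsRegularMultiplierHopf Δ) :
    IsRegularMultiplierHopf (MultHopf.opComul Δ :) :=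
  ⟨h.isMultiplierHopf_opComul, by rw [flip_opComul]; exact h.flip.isMultiplierHopf_opComul⟩

theorem IsRegularMultiplierHopf.enveloping (h : IsRegularMultiplierHopf Δ) :
    IsRegularMultiplierHopf (MultHopf.enveloping Δ :) :=
  h.tensor h.opComul

end Opposite

/-! ### Coactions as invertible operators -/

section TwoLegs

variable {k : Type u} [Field k] {H : Type v} [AddCommGroup H] [Module k H]
variable {K : Type w'} [AddCommGroup K] [Module k K] {V : Type w} [AddCommGroup V] [Module k V]

/-- The operator on `H ⊗ K ⊗ V` that applies `ρ` to the first and third leg, then `τ` to the second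
and third leg. -/
def twoLegs (ρ : H ⊗[k] V →ₗ[k] H ⊗[k] V) (τ : K ⊗[k] V →ₗ[k] K ⊗[k] V) :
    (H ⊗[k] K) ⊗[k] V →ₗ[k] (H ⊗[k] K) ⊗[k] V :=
  (TensorProduct.assoc k H K V).symm.toLinearMap ∘ₗ TensorProduct.lift (TensorProduct.lift
    ((LinearMap.llcomp k V (H ⊗[k] V) (H ⊗[k] (K ⊗[k] V))).compl₁₂
      ((LinearMap.lTensorHom H) ∘ₗ (TensorProduct.curry τ)) (TensorProduct.curry ρ)).flip)

theorem twoLegs_tmul (ρ : H ⊗[k] V →ₗ[k] H ⊗[k] V) (τ : K ⊗[k] V →ₗ[k] K ⊗[k] V) (v : V) (x : H)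
    (y : K) : twoLegs ρ τ ((x ⊗ₜ y) ⊗ₜ v) =
      (TensorProduct.assoc k H K V).symm ((TensorProduct.curry τ y).lTensor H (ρ (x ⊗ₜ v))) := rfl

theorem twoLegs_map {H' K' : Type*} [AddCommGroup H'] [Module k H'] [AddCommGroup K'] [Module k K']
    {ρ : H ⊗[k] V →ₗ[k] H ⊗[k] V} {σ : H' ⊗[k] V →ₗ[k] H' ⊗[k] V}
    {ρ' : K ⊗[k] V →ₗ[k] K ⊗[k] V} {σ' : K' ⊗[k] V →ₗ[k] K' ⊗[k] V} {f : H →ₗ[k] H'}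
    {g : K →ₗ[k] K'} (hf : ∀ t, σ (f.rTensor V t) = f.rTensor V (ρ t))
    (hg : ∀ t, σ' (g.rTensor V t) = g.rTensor V (ρ' t)) (z : (H ⊗[k] K) ⊗[k] V) :
    twoLegs σ σ' ((TensorProduct.map f g).rTensor V z) =
      (TensorProduct.map f g).rTensor V (twoLegs ρ ρ' z) := by
  induction z with
  | zero => simp
  | add s s' hs hs' => simp only [map_add, hs, hs']
  | tmul s v =>
  induction s with
  | zero => simp
  | add s s' hs hs' => simp only [map_add, TensorProduct.add_tmul, hs, hs']
  | tmul x y =>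
    rw [LinearMap.rTensor_tmul, TensorProduct.map_tmul, twoLegs_tmul, twoLegs_tmul,
      ← LinearMap.rTensor_tmul, hf]
    generalize ρ (x ⊗ₜ v) = t
    induction t with
    | zero => simp
    | add s s' hs hs' => simp only [map_add, hs, hs']
    | tmul a b =>
      have hg' := hg (y ⊗ₜ b)
      rw [LinearMap.rTensor_tmul] at hg'
      rw [LinearMap.rTensor_tmul, LinearMap.lTensor_tmul, LinearMap.lTensor_tmul,
        TensorProduct.curry_apply, TensorProduct.curry_apply, hg']
      generalize ρ' (y ⊗ₜ b) = u
      induction u with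
      | zero => simp
      | add s s' hs hs' => simp only [map_add, TensorProduct.tmul_add, hs, hs']
      | tmul c d => rfl

end TwoLegs

section Coaction

variable {k : Type u} [Field k]
variable {H : Type v} [NonUnitalRing H] [Module k H] [IsScalarTower k H H] [SMulCommClass k H H]
variable {K : Type w'} [NonUnitalRing K] [Module k K] [IsScalarTower k K K] [SMulCommClass k K K]
variable {V : Type w} [AddCommGroup V] [Module k V]

/-- `(x ⊗ y) ⊗ v ↦ v₍₋₂₎ x ⊗ v₍₋₁₎ y ⊗ v₀`, for the operator `ρ : x ⊗ v ↦ v₍₋₁₎ x ⊗ v₀`. -/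
abbrev twice (ρ : H ⊗[k] V →ₗ[k] H ⊗[k] V) : (H ⊗[k] H) ⊗[k] V →ₗ[k] (H ⊗[k] H) ⊗[k] V :=
  twoLegs ρ ρ

/-- The operators `ρ` and `ρ'` are of the form `x ⊗ v ↦ v₍₋₁₎ x ⊗ v₀` and `x ⊗ v ↦ x v₍₋₁₎ ⊗ v₀`
for one map `v ↦ v₍₋₁₎ ⊗ v₀` with multiplier values. -/
def IsCompatible (ρ ρ' : H ⊗[k] V →ₗ[k] H ⊗[k] V) : Prop :=
  ∀ e x v, (mulLeft k e).rTensor V (ρ (x ⊗ₜ v)) = (mulRight k x).rTensor V (ρ' (e ⊗ₜ v))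

/-- A left coaction of `(H, Δ)` on a vector space `V`, given by the operators
`ρ : x ⊗ v ↦ v₍₋₁₎ x ⊗ v₀` and `ρ' : x ⊗ v ↦ x v₍₋₁₎ ⊗ v₀` on `H ⊗ V`. -/
structure IsCoaction (Δ : H →ₗ[k] Multiplier k (H ⊗[k] H)) (ρ ρ' : H ⊗[k] V →ₗ[k] H ⊗[k] V) :
    Prop where
  compat : IsCompatible ρ ρ'
  coassoc : ∀ p q v, twice ρ (T₁ Δ (p ⊗ₜ q) ⊗ₜ v) = ((rightSnd Δ).flip q).rTensor V (ρ (p ⊗ₜ v))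
  injective : ∀ v, (∀ x, ρ (x ⊗ₜ v) = 0) → v = 0

variable {Δ : H →ₗ[k] Multiplier k (H ⊗[k] H)} {ρ ρ' : H ⊗[k] V →ₗ[k] H ⊗[k] V}

theorem mulLeft_mulRight_rTensor (x y : H) (t : H ⊗[k] V) :
    (mulLeft k x).rTensor V ((mulRight k y).rTensor V t) =
      (mulRight k y).rTensor V ((mulLeft k x).rTensor V t) := by
  induction t with
  | zero => simp
  | add s s' hs hs' => simp only [map_add, hs, hs']
  | tmul a b => simp [mul_assoc]

theorem mulRight_mulRight_rTensor (x y : H) (t : H ⊗[k] V) :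
    (mulRight k y).rTensor V ((mulRight k x).rTensor V t) = (mulRight k (x * y)).rTensor V t := by
  induction t with
  | zero => simp
  | add s s' hs hs' => simp only [map_add, hs, hs']
  | tmul a b => simp [mul_assoc]

theorem IsCompatible.map_mulRight (h : IsCompatible ρ ρ') (hH : IsNondegenerate H) (y : H)
    (t : H ⊗[k] V) : ρ ((mulRight k y).rTensor V t) = (mulRight k y).rTensor V (ρ t) := by
  induction t with
  | zero => simp
  | add s s' hs hs' => simp only [map_add, hs, hs']
  | tmul x v =>
    refine eq_of_mulLeft_rTensor hH fun e => ?_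
    rw [LinearMap.rTensor_tmul, LinearMap.mulRight_apply, h, mulLeft_mulRight_rTensor,
      h, mulRight_mulRight_rTensor]

theorem mulRight_twoLegs (p : H) (q : K) (t : H ⊗[k] V) (f : V →ₗ[k] K ⊗[k] V) :
    (mulRight k (p ⊗ₜ[k] q)).rTensor V ((TensorProduct.assoc k H K V).symm (f.lTensor H t)) =
      (TensorProduct.assoc k H K V).symm
        (((mulRight k q).rTensor V ∘ₗ f).lTensor H ((mulRight k p).rTensor V t)) := by
  induction t with
  | zero => simp
  | add s s' hs hs' => simp only [map_add, hs, hs']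
  | tmul a b =>
    rw [LinearMap.lTensor_tmul, LinearMap.rTensor_tmul, LinearMap.lTensor_tmul,
      LinearMap.comp_apply]
    generalize f b = z
    induction z with
    | zero => simp
    | add s s' hs hs' => simp only [TensorProduct.tmul_add, map_add, hs, hs']
    | tmul c d => simp

theorem mulLeft_twoLegs (p : H) (q : K) (t : H ⊗[k] V) (f : V →ₗ[k] K ⊗[k] V) :
    (mulLeft k (p ⊗ₜ[k] q)).rTensor V ((TensorProduct.assoc k H K V).symm (f.lTensor H t)) =
      (TensorProduct.assoc k H K V).symm
        (((mulLeft k q).rTensor V ∘ₗ f).lTensor H ((mulLeft k p).rTensor V t)) := by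
  induction t with
  | zero => simp
  | add s s' hs hs' => simp only [map_add, hs, hs']
  | tmul a b =>
    rw [LinearMap.lTensor_tmul, LinearMap.rTensor_tmul, LinearMap.lTensor_tmul,
      LinearMap.comp_apply]
    generalize f b = z
    induction z with
    | zero => simp
    | add s s' hs hs' => simp only [TensorProduct.tmul_add, map_add, hs, hs']
    | tmul c d => simp

theorem IsCompatible.twoLegs {τ τ' : K ⊗[k] V →ₗ[k] K ⊗[k] V} (h : IsCompatible ρ ρ')
    (h' : IsCompatible τ τ') : IsCompatible (twoLegs ρ τ) (twoLegs ρ' τ') := by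
  intro t s v
  induction s with
  | zero => simp
  | add s s' hs hs' =>
    rw [TensorProduct.add_tmul, map_add, map_add, hs, hs', ← LinearMap.add_apply, ← LinearMap.rTensor_add]
    congr 2
    ext; simp [mul_add]
  | tmul p q =>
    induction t with
    | zero => simp
    | add s s' hs hs' =>
      rw [TensorProduct.add_tmul, map_add, map_add, ← hs, ← hs', ← LinearMap.add_apply, ← LinearMap.rTensor_add]
      congr 2
      ext; simp [add_mul]
    | tmul x y =>
      rw [twoLegs_tmul, twoLegs_tmul, mulLeft_twoLegs, mulRight_twoLegs, h]
      congr 3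
      ext v'
      exact h' y q v'

/-- The coassociativity in terms of `ρ'`:
`∑ (x ⊗ 1)Δ(y) (v₍₋₂₎ ⊗ v₍₋₁₎) ⊗ v₀ = ∑ (x ⊗ 1)Δ(y v₍₋₁₎) ⊗ v₀`. -/
theorem IsCoaction.coassoc' (h : IsCoaction Δ ρ ρ') (hΔ : IsMultiplierHopf Δ) (x y : H) (v : V) :
    twice ρ' (T₂ Δ (x ⊗ₜ y) ⊗ₜ v) = ((leftFst Δ).flip x).rTensor V (ρ' (y ⊗ₜ v)) := by
  have hH := hΔ.comul.nondegenerate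
  refine eq_of_mulRight_rTensor (hH.tensor hH) fun s => ?_
  obtain ⟨s, rfl⟩ := hΔ.bijective₁.2 s
  -- `(x ⊗ 1)Δ(y)Δ(p)(1 ⊗ q) = (x ⊗ 1)Δ(yp)(1 ⊗ q)`
  have e : ∀ y p q : H, T₂ Δ (x ⊗ₜ y) * T₁ Δ (p ⊗ₜ q) =
      (mulLeft k x).rTensor H (T₁ Δ ((y * p) ⊗ₜ q)) := fun y p q => by
    rw [hΔ.comul.T₁_mul, T₂_tmul]
    apply embed_injective (k := k) (hH.tensor hH)
    rw [← embed_mul_embed, embed_leftFst hH hH (hΔ.comul.covered₂ x y), mul_assoc,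
      mul_embed (hH.tensor hH), mul_embed (hH.tensor hH), fstM_fst]
  induction s with
  | zero => simp
  | add s s' hs hs' =>
    have : ∀ s s' : H ⊗[k] H, mulRight k (s + s') = mulRight k s + mulRight k s' := fun s s' => by
      ext; simp [mul_add]
    rw [map_add, this, LinearMap.rTensor_add, LinearMap.add_apply, hs, hs', LinearMap.add_apply]
  | tmul p q =>
    rw [← h.compat.twoLegs h.compat, h.coassoc]
    have e1 : ∀ t : H ⊗[k] V, (mulLeft k (T₂ Δ (x ⊗ₜ y))).rTensor V
        (((rightSnd Δ).flip q).rTensor V t) = ((mulLeft k x).rTensor H ∘ₗ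
          (rightSnd Δ).flip q).rTensor V ((mulLeft k y).rTensor V t) := fun t => by
      induction t with
      | zero => simp
      | add s s' hs hs' => simp only [map_add, hs, hs']
      | tmul a b => exact congrArg (· ⊗ₜ[k] b) (e y a q)
    have e2 : ∀ t : H ⊗[k] V, (mulRight k (T₁ Δ (p ⊗ₜ q))).rTensor V
        (((leftFst Δ).flip x).rTensor V t) = ((mulLeft k x).rTensor H ∘ₗ
          (rightSnd Δ).flip q).rTensor V ((mulRight k p).rTensor V t) := fun t => by
      induction t with
      | zero => simp
      | add s s' hs hs' => simp only [map_add, hs, hs']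
      | tmul a b => exact congrArg (· ⊗ₜ[k] b) (e a p q)
    rw [e1, h.compat, ← e2]

/-- Applying a functional to the first leg. -/
def evalLeft (ε : H →ₗ[k] k) : H ⊗[k] V →ₗ[k] V := (TensorProduct.lid k V).toLinearMap ∘ₗ ε.rTensor V

theorem evalLeft_tmul (ε : H →ₗ[k] k) (x : H) (v : V) : evalLeft ε (x ⊗ₜ[k] v) = ε x • v := by
  simp [evalLeft]

variable {ε : H →ₗ[k] k} {S : H ≃ₗ[k] H}

theorem evalLeft_twice (ρ : H ⊗[k] V →ₗ[k] H ⊗[k] V) (x y : H) (v : V) :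
    (evalLeft ε).rTensor V (twice ρ ((x ⊗ₜ y) ⊗ₜ v)) = ρ (y ⊗ₜ evalLeft ε (ρ (x ⊗ₜ v))) := by
  rw [twoLegs_tmul]
  generalize ρ (x ⊗ₜ v) = t
  induction t with
  | zero => simp
  | add s s' hs hs' => simp only [map_add, TensorProduct.tmul_add, hs, hs']
  | tmul a b =>
    rw [LinearMap.lTensor_tmul, evalLeft_tmul, TensorProduct.tmul_smul, map_smul,
      TensorProduct.curry_apply]
    generalize ρ (y ⊗ₜ b) = z
    induction z with
    | zero => simp
    | add s s' hs hs' => simp only [map_add, TensorProduct.tmul_add, smul_add, hs, hs']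
    | tmul c d => simp [evalLeft_tmul, TensorProduct.smul_tmul']

theorem IsCoaction.counit (h : IsCoaction Δ ρ ρ') (hΔ : IsMultiplierHopf Δ)
    (hS : IsCounitAntipode Δ ε S.toLinearMap) (x : H) (v : V) :
    evalLeft ε (ρ (x ⊗ₜ v)) = ε x • v := by
  have hH := hΔ.comul.nondegenerate
  have hε : ∀ p q, evalLeft ε (T₁ Δ (p ⊗ₜ q)) = p * q := hS.counit₁
  have h1 : ((evalLeft ε).rTensor V ∘ₗ twice ρ ∘ₗ (TensorProduct.mk k (H ⊗[k] H) V).flip v) ∘ₗ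
      T₁ Δ = (ρ ∘ₗ (TensorProduct.mk k H V).flip v ∘ₗ evalLeft ε) ∘ₗ T₁ Δ :=
    TensorProduct.ext' fun p q => by
      simp only [LinearMap.comp_apply, LinearMap.flip_apply, TensorProduct.mk_apply]
      rw [h.coassoc, hε, ← LinearMap.mulRight_apply (R := k), ← LinearMap.rTensor_tmul,
        h.compat.map_mulRight hH, ← LinearMap.rTensor_comp_apply]
      exact congrArg (fun f : H →ₗ[k] H => f.rTensor V (ρ (p ⊗ₜ v)))
        (LinearMap.ext fun a => hε a q)
  have h2 : ∀ s : H ⊗[k] H, (evalLeft ε).rTensor V (twice ρ (s ⊗ₜ v)) = ρ (evalLeft ε s ⊗ₜ v) :=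
    fun s => by
      obtain ⟨s, rfl⟩ := hΔ.bijective₁.2 s
      exact LinearMap.congr_fun h1 s
  refine sub_eq_zero.1 (h.injective _ fun y => ?_)
  rw [TensorProduct.tmul_sub, map_sub, ← evalLeft_twice, h2, evalLeft_tmul, sub_eq_zero,
    TensorProduct.smul_tmul]

theorem IsCoaction.counit' (h : IsCoaction Δ ρ ρ') (hΔ : IsMultiplierHopf Δ)
    (hS : IsCounitAntipode Δ ε S.toLinearMap) (x : H) (v : V) :
    evalLeft ε (ρ' (x ⊗ₜ v)) = ε x • v := by
  have hε : ∀ x y, ε (x * y) = ε x * ε y := hS.counit_mul hΔ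
  have h1 : ∀ (e : H) (t : H ⊗[k] V), evalLeft ε ((mulLeft k e).rTensor V t) =
      ε e • evalLeft ε t := fun e t => by
    induction t with
    | zero => simp
    | add s s' hs hs' => simp only [map_add, smul_add, hs, hs']
    | tmul a b => simp [evalLeft_tmul, hε, mul_smul]
  have h2 : ∀ (e : H) (t : H ⊗[k] V), evalLeft ε ((mulRight k e).rTensor V t) =
      ε e • evalLeft ε t := fun e t => by
    induction t with
    | zero => simp
    | add s s' hs hs' => simp only [map_add, smul_add, hs, hs']
    | tmul a b => simp [evalLeft_tmul, hε, mul_smul, smul_comm (ε a)]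
  by_cases hε0 : ∃ p : H, ε p ≠ 0
  · obtain ⟨p, hp⟩ := hε0
    have := congrArg (evalLeft ε) (h.compat x p v)
    rw [h1, h2, h.counit hΔ hS, smul_comm] at this
    exact (smul_right_injective V hp this).symm
  · push Not at hε0
    rw [show ε = 0 from LinearMap.ext hε0]
    simp [evalLeft]

/-- `S` on the first leg. -/
abbrev antipodeLeft (S : H ≃ₗ[k] H) (V : Type w) [AddCommGroup V] [Module k V] :
    H ⊗[k] V ≃ₗ[k] H ⊗[k] V := TensorProduct.congr S (LinearEquiv.refl k V)

theorem antipodeLeft_mulRight (hS : ∀ x y, S (x * y) = S y * S x) (x : H) (t : H ⊗[k] V) :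
    antipodeLeft S V ((mulRight k x).rTensor V t) =
      (mulLeft k (S x)).rTensor V (antipodeLeft S V t) := by
  induction t with
  | zero => simp
  | add s s' hs hs' => simp only [map_add, hs, hs']
  | tmul a b => simp [hS]

theorem antipodeLeft_mulLeft (hS : ∀ x y, S (x * y) = S y * S x) (x : H) (t : H ⊗[k] V) :
    antipodeLeft S V ((mulLeft k x).rTensor V t) =
      (mulRight k (S x)).rTensor V (antipodeLeft S V t) := by
  induction t with
  | zero => simp
  | add s s' hs hs' => simp only [map_add, hs, hs']
  | tmul a b => simp [hS]

theorem IsCoaction.antipode_compat (h : IsCoaction Δ ρ ρ') (hS : ∀ x y, S (x * y) = S y * S x)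
    (x y : H) (v : V) : (mulRight k y).rTensor V (antipodeLeft S V (ρ (S.symm x ⊗ₜ v))) =
      (mulLeft k x).rTensor V (antipodeLeft S V (ρ' (S.symm y ⊗ₜ v))) := by
  obtain ⟨x, rfl⟩ := S.surjective x
  obtain ⟨y, rfl⟩ := S.surjective y
  rw [S.symm_apply_apply, S.symm_apply_apply, ← antipodeLeft_mulLeft hS, h.compat,
    antipodeLeft_mulRight hS]

/-- The identity `∑ S(v₍₋₂₎) v₍₋₁₎ ⊗ v₀ = 1 ⊗ v` in covered form. -/
theorem IsCoaction.antipode₁ (h : IsCoaction Δ ρ ρ') (hΔ : IsMultiplierHopf Δ)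
    (hS : IsCounitAntipode Δ ε S.toLinearMap) (t : H ⊗[k] V) :
    ρ' (antipodeLeft S V (ρ t)) = antipodeLeft S V t := by
  have hH := hΔ.comul.nondegenerate
  induction t with
  | zero => simp
  | add s s' hs hs' => simp only [map_add, hs, hs']
  | tmul x v =>
  let g : H ⊗[k] H →ₗ[k] H := LinearMap.mul' k H ∘ₗ S.toLinearMap.rTensor H
  have hg : ∀ p q, g (T₁ Δ (p ⊗ₜ q)) = ε p • q := hS.antipode₁
  have h1 : (g.rTensor V ∘ₗ twice ρ ∘ₗ (TensorProduct.mk k (H ⊗[k] H) V).flip v) ∘ₗ T₁ Δ =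
      ((TensorProduct.mk k H V).flip v ∘ₗ g) ∘ₗ T₁ Δ := TensorProduct.ext' fun p q => by
    simp only [LinearMap.comp_apply, LinearMap.flip_apply, TensorProduct.mk_apply]
    rw [h.coassoc, hg, TensorProduct.smul_tmul, ← h.counit hΔ hS p v]
    generalize ρ (p ⊗ₜ v) = t
    induction t with
    | zero => simp
    | add s s' hs hs' => simp only [map_add, TensorProduct.tmul_add, hs, hs']
    | tmul a b =>
      rw [evalLeft_tmul, ← TensorProduct.smul_tmul, ← hg]
      rfl
  have h2 : ∀ s : H ⊗[k] H, g.rTensor V (twice ρ (s ⊗ₜ v)) = g s ⊗ₜ v := fun s => by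
    obtain ⟨s, rfl⟩ := hΔ.bijective₁.2 s
    exact LinearMap.congr_fun h1 s
  have h3 : ∀ (y : H) (t : H ⊗[k] V), g.rTensor V ((TensorProduct.assoc k H H V).symm
      ((TensorProduct.curry ρ y).lTensor H t)) =
        (mulRight k y).rTensor V (ρ' (antipodeLeft S V t)) := fun y t => by
    induction t with
    | zero => simp
    | add s s' hs hs' => simp only [map_add, hs, hs']
    | tmul a b =>
      rw [TensorProduct.congr_tmul, LinearEquiv.refl_apply, ← h.compat, LinearMap.lTensor_tmul,
        TensorProduct.curry_apply]
      generalize ρ (y ⊗ₜ b) = z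
      induction z with
      | zero => simp
      | add s s' hs hs' => simp only [map_add, TensorProduct.tmul_add, hs, hs']
      | tmul c d => simp [g]
  refine eq_of_mulRight_rTensor hH fun y => ?_
  rw [← h3, ← twoLegs_tmul, h2]
  simp [g]

/-- The identity `∑ v₍₋₂₎ S(v₍₋₁₎) ⊗ v₀ = 1 ⊗ v` in covered form. -/
theorem IsCoaction.antipode₂ (h : IsCoaction Δ ρ ρ') (hΔ : IsMultiplierHopf Δ)
    (hS : IsCounitAntipode Δ ε S.toLinearMap) (t : H ⊗[k] V) :
    antipodeLeft S V (ρ ((antipodeLeft S V).symm (ρ' t))) = t := by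
  have hH := hΔ.comul.nondegenerate
  have hmul : ∀ x y, S (x * y) = S y * S x := hS.antipode_mul hΔ
  induction t with
  | zero => simp
  | add s s' hs hs' => simp only [map_add, hs, hs']
  | tmul x v =>
  let g : H ⊗[k] H →ₗ[k] H := LinearMap.mul' k H ∘ₗ S.toLinearMap.lTensor H
  have hg : ∀ p q, g (T₂ Δ (p ⊗ₜ q)) = ε q • p := hS.antipode₂
  have h1 : (g.rTensor V ∘ₗ twice ρ' ∘ₗ (TensorProduct.mk k (H ⊗[k] H) V).flip v) ∘ₗ T₂ Δ =
      ((TensorProduct.mk k H V).flip v ∘ₗ g) ∘ₗ T₂ Δ := TensorProduct.ext' fun p q => by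
    simp only [LinearMap.comp_apply, LinearMap.flip_apply, TensorProduct.mk_apply]
    rw [h.coassoc' hΔ, hg, TensorProduct.smul_tmul, ← h.counit' hΔ hS q v]
    generalize ρ' (q ⊗ₜ v) = t
    induction t with
    | zero => simp
    | add s s' hs hs' => simp only [map_add, TensorProduct.tmul_add, hs, hs']
    | tmul a b =>
      rw [evalLeft_tmul, ← TensorProduct.smul_tmul, ← hg]
      rfl
  have h2 : ∀ s : H ⊗[k] H, g.rTensor V (twice ρ' (s ⊗ₜ v)) = g s ⊗ₜ v := fun s => by
    obtain ⟨s, rfl⟩ := hΔ.bijective₂.2 s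
    exact LinearMap.congr_fun h1 s
  have h3 : ∀ (y : H) (t : H ⊗[k] V), g.rTensor V ((TensorProduct.assoc k H H V).symm
      ((TensorProduct.curry ρ' (S.symm y)).lTensor H t)) =
        (mulRight k y).rTensor V (antipodeLeft S V (ρ ((antipodeLeft S V).symm t))) := fun y t => by
    induction t with
    | zero => simp
    | add s s' hs hs' => simp only [map_add, hs, hs']
    | tmul a b =>
      rw [TensorProduct.congr_symm_tmul, LinearEquiv.refl_symm, LinearEquiv.refl_apply,
        h.antipode_compat hmul, LinearMap.lTensor_tmul, TensorProduct.curry_apply]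
      generalize ρ' (S.symm y ⊗ₜ b) = z
      induction z with
      | zero => simp
      | add s s' hs hs' => simp only [map_add, TensorProduct.tmul_add, hs, hs']
      | tmul c d => simp [g]
  refine eq_of_mulRight_rTensor hH fun y => ?_
  rw [← h3, ← twoLegs_tmul, h2]
  simp [g]

end Coaction

/-! ### Coactions of the opposite multiplier Hopf algebra -/

section OppositeCoaction

variable {k : Type u} [Field k]
variable {H : Type v} [NonUnitalRing H] [Module k H] [IsScalarTower k H H] [SMulCommClass k H H]
variable {V : Type w} [AddCommGroup V] [Module k V]
variable {Δ : H →ₗ[k] Multiplier k (H ⊗[k] H)} {ρ ρ' : H ⊗[k] V →ₗ[k] H ⊗[k] V}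
variable {ε : H →ₗ[k] k} {S : H ≃ₗ[k] H}

/-- `x ⊗ v ↦ op x ⊗ v`. -/
abbrev opLeft (k : Type u) [Field k] (H : Type v) [AddCommGroup H] [Module k H] (V : Type w)
    [AddCommGroup V] [Module k V] : H ⊗[k] V ≃ₗ[k] Hᵐᵒᵖ ⊗[k] V :=
  TensorProduct.congr (MulOpposite.opLinearEquiv k) (LinearEquiv.refl k V)

theorem opLeft_mulRight (x : H) (t : H ⊗[k] V) : opLeft k H V ((mulRight k x).rTensor V t) =
    (mulLeft k (MulOpposite.op x)).rTensor V (opLeft k H V t) := by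
  induction t with
  | zero => simp
  | add s s' hs hs' => simp only [map_add, hs, hs']
  | tmul a b => simp

theorem opLeft_mulLeft (x : H) (t : H ⊗[k] V) : opLeft k H V ((mulLeft k x).rTensor V t) =
    (mulRight k (MulOpposite.op x)).rTensor V (opLeft k H V t) := by
  induction t with
  | zero => simp
  | add s s' hs hs' => simp only [map_add, hs, hs']
  | tmul a b => simp

/-- If `τ` inverts `ρ'`, the operator `op τ op⁻¹` inverts the twofold application of `ρ'`. -/
theorem twice_opSwap {τ : Hᵐᵒᵖ ⊗[k] V →ₗ[k] Hᵐᵒᵖ ⊗[k] V}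
    (hτ : ∀ t, τ (opLeft k H V (ρ' t)) = opLeft k H V t) (z : (H ⊗[k] H) ⊗[k] V) :
    twice τ ((opSwap k H).toLinearMap.rTensor V (twice ρ' z)) =
      (opSwap k H).toLinearMap.rTensor V z := by
  have h1 : ∀ (x : H) (t : H ⊗[k] V), twice τ ((opSwap k H).toLinearMap.rTensor V
      ((TensorProduct.assoc k H H V).symm (x ⊗ₜ t))) = (TensorProduct.assoc k Hᵐᵒᵖ Hᵐᵒᵖ V).symm
        ((TensorProduct.curry τ (MulOpposite.op x)).lTensor Hᵐᵒᵖ (τ (opLeft k H V t))) :=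
    fun x t => by
      induction t with
      | zero => simp
      | add s s' hs hs' => simp only [TensorProduct.tmul_add, map_add, hs, hs']
      | tmul a b => rfl
  have h2 : ∀ (x : H) (v : V), τ.comp (opLeft k H V).toLinearMap (ρ' (x ⊗ₜ v)) =
      MulOpposite.op x ⊗ₜ v := fun x v => hτ _
  induction z with
  | zero => simp
  | add s s' hs hs' => simp only [map_add, hs, hs']
  | tmul t v =>
    induction t with
    | zero => simp
    | add s s' hs hs' => simp only [TensorProduct.add_tmul, map_add, hs, hs']
    | tmul x y =>
      change _ = (TensorProduct.assoc k Hᵐᵒᵖ Hᵐᵒᵖ V).symm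
        (MulOpposite.op y ⊗ₜ (MulOpposite.op x ⊗ₜ v))
      rw [← h2 x v, twoLegs_tmul]
      generalize ρ' (x ⊗ₜ v) = u
      induction u with
      | zero => simp
      | add s s' hs hs' => simp only [TensorProduct.tmul_add, map_add, hs, hs']
      | tmul a b =>
        rw [LinearMap.lTensor_tmul, h1, TensorProduct.curry_apply, hτ]
        rfl

/-- The antipode carries a coaction of `H` to a coaction of the opposite of the coopposite:
`v ↦ op S(v₍₋₁₎) ⊗ v₀`. -/
theorem IsCoaction.op (h : IsCoaction Δ ρ ρ') (hΔ : IsRegularMultiplierHopf Δ)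
    (hS : IsCounitAntipode Δ ε S.toLinearMap) :
    IsCoaction (opComul (flipComul Δ) :) ((antipodeLeft S V ≪≫ₗ opLeft k H V).conj ρ)
      ((antipodeLeft S V ≪≫ₗ opLeft k H V).conj ρ') := by
  have hmul : ∀ x y, S (x * y) = S y * S x := hS.antipode_mul hΔ.hopf
  have hT := hΔ.flip.T₁_opComul
  rw [flip_flip] at hT
  refine ⟨fun e x v => ?_, fun p q v => ?_, fun v hv => h.injective v fun x => ?_⟩
  · change (mulLeft k e).rTensor V (opLeft k H V (antipodeLeft S V
      (ρ (S.symm x.unop ⊗ₜ v)))) = (mulRight k x).rTensor V (opLeft k H V (antipodeLeft S V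
      (ρ' (S.symm e.unop ⊗ₜ v))))
    have := congrArg (opLeft k H V) (h.antipode_compat hmul x.unop e.unop v)
    rwa [opLeft_mulRight, opLeft_mulLeft] at this
  · set τ := (antipodeLeft S V ≪≫ₗ opLeft k H V).conj ρ with hτ
    have h1 : ∀ t, τ (opLeft k H V (ρ' t)) = opLeft k H V t := fun t => by
      have := congrArg (opLeft k H V) (h.antipode₂ hΔ.hopf hS t)
      rw [← this, hτ, LinearEquiv.conj_apply_apply]
      simp
    obtain ⟨t, ht⟩ := (opLeft k H V).surjective (τ (p ⊗ₜ v))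
    have h2 : ρ' t = p.unop ⊗ₜ v := by
      rw [← (LinearEquiv.symm_apply_eq (opLeft k H V)).2 ht.symm]
      refine Eq.trans ?_ ((h.antipode₁ hΔ.hopf hS ((antipodeLeft S V).symm
        (p.unop ⊗ₜ v))).trans ((antipodeLeft S V).apply_symm_apply _))
      rw [hτ, LinearEquiv.conj_apply_apply, LinearEquiv.trans_apply,
        LinearEquiv.symm_apply_apply]
      rfl
    have h3 : ∀ t : H ⊗[k] V, twice ρ' (((leftFst Δ).flip q.unop).rTensor V t) =
        ((leftFst Δ).flip q.unop).rTensor V (ρ' t) := fun t => by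
      induction t with
      | zero => simp
      | add s s' hs hs' => simp only [map_add, hs, hs']
      | tmul a b => exact h.coassoc' hΔ.hopf q.unop a b
    have h4 := twice_opSwap h1 (((leftFst Δ).flip q.unop).rTensor V t)
    rw [h3, h2] at h4
    have h5 : T₁ (opComul (flipComul Δ) :) (p ⊗ₜ q) = opSwap k H (T₂ Δ (q.unop ⊗ₜ p.unop)) :=
      hT (q.unop ⊗ₜ p.unop)
    rw [h5, ← ht]
    refine h4.trans ?_
    clear h4 h2 ht
    induction t with
    | zero => simp
    | add s s' hs hs' => simp only [map_add, hs, hs']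
    | tmul a b => exact congrArg (· ⊗ₜ[k] b) (hT (q.unop ⊗ₜ a)).symm
  · have := hv (MulOpposite.op (S x))
    rw [LinearEquiv.conj_apply_apply, LinearEquiv.map_eq_zero_iff] at this
    rw [← this]
    exact congrArg (fun y => ρ (y ⊗ₜ v)) (S.symm_apply_apply x).symm

end OppositeCoaction

/-! ### Comodule algebras and the operators of their coactions -/

section ComoduleAlgebra

variable {k : Type u} [Field k]
variable {H : Type v} [NonUnitalRing H] [Module k H] [IsScalarTower k H H] [SMulCommClass k H H]
variable {A : Type w} [NonUnitalRing A] [Module k A] [IsScalarTower k A A] [SMulCommClass k A A]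
variable {Δ : H →ₗ[k] Multiplier k (H ⊗[k] H)}

/-- `x ⊗ a ↦ a₍₋₁₎ x ⊗ a₀`. -/
def coactRight (Γ : A →ₗ[k] Multiplier k (H ⊗[k] A)) : H ⊗[k] A →ₗ[k] H ⊗[k] A :=
  TensorProduct.lift (rightFst Γ).flip

/-- `x ⊗ a ↦ x a₍₋₁₎ ⊗ a₀`. -/
def coactLeft (Γ : A →ₗ[k] Multiplier k (H ⊗[k] A)) : H ⊗[k] A →ₗ[k] H ⊗[k] A :=
  TensorProduct.lift (leftFst Γ).flip

theorem coactRight_tmul (Γ : A →ₗ[k] Multiplier k (H ⊗[k] A)) (x : H) (a : A) :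
    coactRight Γ (x ⊗ₜ a) = rightFst Γ a x := rfl

/-- `m ⊗ (a ⊗ b) ↦ a₍₋₁₎ m ⊗ a₀ b`, for the operator `τ : m ⊗ a ↦ a₍₋₁₎ m ⊗ a₀`. -/
def twistMul {M : Type v'} [AddCommGroup M] [Module k M] (τ : M ⊗[k] A →ₗ[k] M ⊗[k] A) :
    M ⊗[k] (A ⊗[k] A) →ₗ[k] M ⊗[k] A :=
  (LinearMap.mul' k A).lTensor M ∘ₗ (TensorProduct.assoc k M A A).toLinearMap ∘ₗ τ.rTensor A ∘ₗ
    (TensorProduct.assoc k M A A).symm.toLinearMap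

theorem twistMul_tmul {M : Type v'} [AddCommGroup M] [Module k M]
    (τ : M ⊗[k] A →ₗ[k] M ⊗[k] A) (m : M) (a b : A) :
    twistMul τ (m ⊗ₜ (a ⊗ₜ b)) = (mulRight k b).lTensor M (τ (m ⊗ₜ a)) := by
  change (LinearMap.mul' k A).lTensor M (TensorProduct.assoc k M A A (τ (m ⊗ₜ a) ⊗ₜ b)) = _
  generalize τ (m ⊗ₜ a) = t
  induction t with
  | zero => simp
  | add s s' hs hs' => simp only [map_add, TensorProduct.add_tmul, hs, hs']
  | tmul c d => simp

/-- The operator `τ : m ⊗ a ↦ a₍₋₁₎ m ⊗ a₀` belongs to a multiplicative coaction: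
`(ab)₍₋₁₎ m ⊗ (ab)₀ = a₍₋₁₎ b₍₋₁₎ m ⊗ a₀ b₀`. -/
def IsMultiplicative {M : Type v'} [AddCommGroup M] [Module k M]
    (τ : M ⊗[k] A →ₗ[k] M ⊗[k] A) : Prop :=
  ∀ m a b, τ (m ⊗ₜ (a * b)) = twistMul τ ((TensorProduct.mk k A A a).lTensor M (τ (m ⊗ₜ b)))

theorem isCompatible_of_coveredFst (hH : IsNondegenerate H) (hA : IsNondegenerate A)
    {Γ : A →ₗ[k] Multiplier k (H ⊗[k] A)} (h : CoveredFst Γ) :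
    IsCompatible (coactRight Γ) (coactLeft Γ) := fun e x a =>
  compat_fst hH hA (h a x).1 (h a e).2

theorem twiceLeft_eq (Γ : A →ₗ[k] Multiplier k (H ⊗[k] A)) (a : A) (s : H ⊗[k] H) :
    twiceLeft Γ a s = TensorProduct.assoc k H H A (twice (coactRight Γ) (s ⊗ₜ a)) := by
  have e : twiceLeft Γ a = (TensorProduct.assoc k H H A).toLinearMap ∘ₗ twice (coactRight Γ) ∘ₗ
      (TensorProduct.mk k (H ⊗[k] H) A).flip a := TensorProduct.ext' fun x y => by
    simp only [LinearMap.comp_apply, LinearMap.flip_apply, TensorProduct.mk_apply]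
    rw [twoLegs_tmul, LinearEquiv.coe_coe, LinearEquiv.apply_symm_apply]
    rfl
  exact LinearMap.congr_fun e s

theorem IsLeftComoduleAlgebra.isCoaction (hH : IsNondegenerate H) (hA : IsNondegenerate A)
    {Γ : A →ₗ[k] Multiplier k (H ⊗[k] A)} (h : IsLeftComoduleAlgebra Δ Γ) :
    IsCoaction Δ (coactRight Γ) (coactLeft Γ) where
  compat := isCompatible_of_coveredFst hH hA h.covered
  coassoc p q a := by
    have := h.coassoc a p q
    rw [twiceLeft_eq] at this
    exact (TensorProduct.assoc k H H A).injective this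
  injective a ha := h.injective <| by
    rw [map_zero]
    refine multiplier_tensor_ext hH hA fun x y => ?_
    rw [fst_tmul_of_covered hH hA (h.covered a x).1, ← coactRight_tmul, ha, map_zero]
    rfl

theorem fst_eq_twistMul (hH : IsNondegenerate H) (hA : IsNondegenerate A)
    {Γ : A →ₗ[k] Multiplier k (H ⊗[k] A)} (h : CoveredFst Γ) (a : A) (t : H ⊗[k] A) :
    (Γ a).1.1 t = twistMul (coactRight Γ) ((TensorProduct.mk k A A a).lTensor H t) := by
  induction t with
  | zero => simp
  | add s s' hs hs' => simp only [map_add, hs, hs']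
  | tmul x b =>
    rw [fst_tmul_of_covered hH hA (h a x).1, LinearMap.lTensor_tmul, TensorProduct.mk_apply,
      twistMul_tmul, coactRight_tmul]

theorem IsLeftComoduleAlgebra.isMultiplicative (hH : IsNondegenerate H) (hA : IsNondegenerate A)
    {Γ : A →ₗ[k] Multiplier k (H ⊗[k] A)} (h : IsLeftComoduleAlgebra Δ Γ) :
    IsMultiplicative (coactRight Γ) := fun x a b => by
  refine rightFst_eq hH hA ?_
  rw [h.map_mul, mul_assoc, coactRight_tmul, ← embed_rightFst hH hA (h.covered b x).1,
    mul_embed (hH.tensor hA), fst_eq_twistMul hH hA h.covered]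

variable {ρ ρ' : H ⊗[k] A →ₗ[k] H ⊗[k] A}

theorem IsCompatible.curry (h : IsCompatible ρ ρ') (a : A) (e x : H) :
    (mulLeft k e).rTensor A ((TensorProduct.curry ρ).flip a x) =
      (mulRight k x).rTensor A ((TensorProduct.curry ρ').flip a e) := h e x a

/-- The map `A → M(H ⊗ A)` with covered forms `ρ` and `ρ'`. -/
def ofCompatible (hH : IsNondegenerate H) (hA : IsNondegenerate A) (h : IsCompatible ρ ρ') :
    A →ₗ[k] Multiplier k (H ⊗[k] A) where
  toFun a := mkFst ((TensorProduct.curry ρ).flip a) ((TensorProduct.curry ρ').flip a) (h.curry a)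
  map_add' a b := multiplier_tensor_ext hH hA fun x y => by
    refine (mkFst_fst _ _ (h.curry (a + b)) x y).trans (Eq.trans ?_ (congrArg₂ (· + ·)
      (mkFst_fst _ _ (h.curry a) x y) (mkFst_fst _ _ (h.curry b) x y)).symm)
    simp only [map_add, LinearMap.add_apply]
  map_smul' r a := multiplier_tensor_ext hH hA fun x y => by
    refine (mkFst_fst _ _ (h.curry (r • a)) x y).trans (Eq.trans ?_ (congrArg (r • ·)
      (mkFst_fst _ _ (h.curry a) x y)).symm)
    simp only [map_smul, LinearMap.smul_apply]

theorem ofCompatible_mul_fstM (hH : IsNondegenerate H) (hA : IsNondegenerate A)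
    (h : IsCompatible ρ ρ') (a : A) (x : H) :
    ofCompatible hH hA h a * fstM k H A x = embed k _ (ρ (x ⊗ₜ a)) :=
  mul_fstM_eq_embed hH hA fun y => mkFst_fst _ _ (h.curry a) x y

theorem fstM_mul_ofCompatible (hH : IsNondegenerate H) (hA : IsNondegenerate A)
    (h : IsCompatible ρ ρ') (a : A) (x : H) :
    fstM k H A x * ofCompatible hH hA h a = embed k _ (ρ' (x ⊗ₜ a)) :=
  fstM_mul_eq_embed hH hA fun y => mkFst_snd _ _ (h.curry a) x y

theorem coactRight_ofCompatible (hH : IsNondegenerate H) (hA : IsNondegenerate A)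
    (h : IsCompatible ρ ρ') : coactRight (ofCompatible hH hA h) = ρ :=
  TensorProduct.ext' fun x a => rightFst_eq hH hA (ofCompatible_mul_fstM hH hA h a x)

theorem IsCoaction.isLeftComoduleAlgebra (hH : IsNondegenerate H) (hA : IsNondegenerate A)
    (h : IsCoaction Δ ρ ρ') (hρ : IsMultiplicative ρ) :
    IsLeftComoduleAlgebra Δ (ofCompatible hH hA h.compat) := by
  have hc : CoveredFst (ofCompatible hH hA h.compat) := fun a x =>
    ⟨⟨_, (ofCompatible_mul_fstM hH hA h.compat a x).symm⟩,
      ⟨_, (fstM_mul_ofCompatible hH hA h.compat a x).symm⟩⟩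
  refine ⟨fun a b => multiplier_tensor_ext hH hA fun x y => ?_,
    (injective_iff_map_eq_zero _).2 fun a ha => h.injective a fun x => ?_, hc, fun a p q => ?_⟩
  · rw [mult_mul_fst, fst_tmul_of_covered hH hA (hc b x).1, fst_tmul_of_covered hH hA (hc _ x).1,
      mult_mulRight' hH hA, fst_eq_twistMul hH hA hc, ← coactRight_tmul, ← coactRight_tmul,
      coactRight_ofCompatible]
    exact congrArg _ (hρ x a b)
  · rw [← coactRight_ofCompatible hH hA h.compat, coactRight_tmul]
    refine rightFst_eq hH hA ?_
    rw [ha, zero_mul, map_zero]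
  · rw [twiceLeft_eq, coactRight_ofCompatible, h.coassoc, ← coactRight_tmul,
      coactRight_ofCompatible]

end ComoduleAlgebra

/-! ### Right coactions as left coactions of the coopposite -/

section RightComodule

variable {k : Type u} [Field k]
variable {H : Type v} [NonUnitalRing H] [Module k H] [IsScalarTower k H H] [SMulCommClass k H H]
variable {A : Type w} [NonUnitalRing A] [Module k A] [IsScalarTower k A A] [SMulCommClass k A A]
variable {Δ : H →ₗ[k] Multiplier k (H ⊗[k] H)} {υ : A →ₗ[k] Multiplier k (A ⊗[k] H)}

/-- `x ⊗ a ↦ a₍₁₎ x ⊗ a₀`. -/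
def rcoactRight (υ : A →ₗ[k] Multiplier k (A ⊗[k] H)) : H ⊗[k] A →ₗ[k] H ⊗[k] A :=
  (TensorProduct.comm k A H).toLinearMap ∘ₗ TensorProduct.lift (rightSnd υ).flip

/-- `x ⊗ a ↦ x a₍₁₎ ⊗ a₀`. -/
def rcoactLeft (υ : A →ₗ[k] Multiplier k (A ⊗[k] H)) : H ⊗[k] A →ₗ[k] H ⊗[k] A :=
  (TensorProduct.comm k A H).toLinearMap ∘ₗ TensorProduct.lift (leftSnd υ).flip

theorem rcoactRight_tmul (υ : A →ₗ[k] Multiplier k (A ⊗[k] H)) (x : H) (a : A) :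
    rcoactRight υ (x ⊗ₜ a) = TensorProduct.comm k A H (rightSnd υ a x) := rfl

theorem rcoactLeft_tmul (υ : A →ₗ[k] Multiplier k (A ⊗[k] H)) (x : H) (a : A) :
    rcoactLeft υ (x ⊗ₜ a) = TensorProduct.comm k A H (leftSnd υ a x) := rfl

theorem coveredFst_commM (h : CoveredSnd υ) : CoveredFst (commM ∘ₗ υ) := fun a x => by
  have h1 := commM_mem_range (h a x).1
  have h2 := commM_mem_range (h a x).2
  rw [congrM_mul, commM_sndM] at h1 h2
  exact ⟨h1, h2⟩

theorem coactRight_commM (hH : IsNondegenerate H) (hA : IsNondegenerate A) (h : CoveredSnd υ) :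
    coactRight (commM ∘ₗ υ) = rcoactRight υ := TensorProduct.ext' fun x a =>
  rightFst_commM hA hH (h a x).1

theorem coactLeft_commM (hH : IsNondegenerate H) (hA : IsNondegenerate A) (h : CoveredSnd υ) :
    coactLeft (commM ∘ₗ υ) = rcoactLeft υ := TensorProduct.ext' fun x a =>
  leftFst_commM hA hH (h a x).2

/-- `(a ⊗ x) ⊗ y ↦ (y ⊗ x) ⊗ a`. -/
def reverse₃ (k : Type u) [Field k] (A : Type w) [AddCommGroup A] [Module k A] (H : Type v)
    [AddCommGroup H] [Module k H] : (A ⊗[k] H) ⊗[k] H ≃ₗ[k] (H ⊗[k] H) ⊗[k] A :=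
  TensorProduct.comm k (A ⊗[k] H) H ≪≫ₗ (TensorProduct.comm k A H).lTensor H ≪≫ₗ
    (TensorProduct.assoc k H H A).symm

theorem reverse₃_twiceRight (a : A) (s : H ⊗[k] H) :
    reverse₃ k A H (twiceRight υ a s) =
      twice (rcoactRight υ) (TensorProduct.comm k H H s ⊗ₜ a) := by
  induction s with
  | zero => simp
  | add s s' hs hs' => simp only [map_add, TensorProduct.add_tmul, hs, hs']
  | tmul x y =>
    rw [TensorProduct.comm_tmul, twoLegs_tmul, rcoactRight_tmul]
    change reverse₃ k A H (((rightSnd υ).flip x).rTensor H (rightSnd υ a y)) = _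
    generalize rightSnd υ a y = t
    induction t with
    | zero => simp
    | add s s' hs hs' => simp only [map_add, hs, hs']
    | tmul b z => rfl

theorem reverse₃_assoc (f : H →ₗ[k] H ⊗[k] H) (t : A ⊗[k] H) :
    reverse₃ k A H ((TensorProduct.assoc k A H H).symm (f.lTensor A t)) =
      ((TensorProduct.comm k H H).toLinearMap ∘ₗ f).rTensor A (TensorProduct.comm k A H t) := by
  induction t with
  | zero => simp
  | add s s' hs hs' => simp only [map_add, hs, hs']
  | tmul b z =>
    rw [LinearMap.lTensor_tmul, TensorProduct.comm_tmul, LinearMap.rTensor_tmul,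
      LinearMap.comp_apply]
    generalize f z = s
    induction s with
    | zero => simp
    | add s s' hs hs' => simp only [map_add, TensorProduct.add_tmul, TensorProduct.tmul_add, hs, hs']
    | tmul x y => rfl

theorem eq_of_mulRight_rTensor_rTensor {V W : Type*} [AddCommGroup V] [Module k V] [AddCommGroup W]
    [Module k W] (hH : IsNondegenerate H) {s t : (H ⊗[k] V) ⊗[k] W}
    (h : ∀ z, ((mulRight k z).rTensor V).rTensor W s = ((mulRight k z).rTensor V).rTensor W t) :
    s = t := by
  apply (TensorProduct.assoc k H V W).injective
  refine eq_of_mulRight_rTensor hH fun z => ?_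
  have e : ∀ t : (H ⊗[k] V) ⊗[k] W, (mulRight k z).rTensor (V ⊗[k] W)
      (TensorProduct.assoc k H V W t) =
      TensorProduct.assoc k H V W (((mulRight k z).rTensor V).rTensor W t) := fun t => by
    rw [LinearMap.rTensor_tensor]
    simp
  rw [e, e, h]

theorem IsRegularMultiplierHopf.fst_tmul (h : IsRegularMultiplierHopf Δ) (p x y : H) :
    (mulRight k y).lTensor H (rightFst Δ p x) = (mulRight k x).rTensor H (T₁ Δ (p ⊗ₜ y)) :=
  (fst_tmul_of_covered h.nondegenerate h.nondegenerate (h.coveredFst p x).1 y).symm.trans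
    (h.hopf.comul.fst_tmul p x y)

/-- A right coaction of `(H, Δ)` is a left coaction of the coopposite. -/
theorem IsRightComoduleAlgebra.isCoaction (hΔ : IsRegularMultiplierHopf Δ)
    (hA : IsNondegenerate A) (h : IsRightComoduleAlgebra Δ υ) :
    IsCoaction (flipComul Δ) (rcoactRight υ) (rcoactLeft υ) := by
  have hH := hΔ.nondegenerate
  have hc : IsCompatible (rcoactRight υ) (rcoactLeft υ) := by
    rw [← coactRight_commM hH hA h.covered, ← coactLeft_commM hH hA h.covered]
    exact isCompatible_of_coveredFst hH hA (coveredFst_commM h.covered)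
  refine ⟨hc, fun p q a => ?_, fun a ha => ?_⟩
  · have h1 : ∀ p q a, twice (rcoactRight υ) (TensorProduct.comm k H H (T₁ Δ (p ⊗ₜ q)) ⊗ₜ a) =
        ((TensorProduct.comm k H H).toLinearMap ∘ₗ (rightSnd Δ).flip q).rTensor A
          (rcoactRight υ (p ⊗ₜ a)) := fun p q a => by
      rw [← reverse₃_twiceRight, h.coassoc, reverse₃_assoc, rcoactRight_tmul]
    -- both sides agree after multiplication by `z` in the leg that is covered by `T₁`
    have h2 : ∀ p z : H, (mulRight k z).rTensor H (T₁ (flipComul Δ) (p ⊗ₜ q)) =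
        (mulRight k q).lTensor H (TensorProduct.comm k H H (T₁ Δ (p ⊗ₜ z))) := fun p z => by
      rw [hΔ.T₁_flip, ← comm_lTensor_apply, hΔ.fst_tmul, comm_rTensor_apply]
    refine eq_of_mulRight_rTensor_rTensor hH fun z => ?_
    have e1 : twice (rcoactRight υ) (((mulRight k z).rTensor H).rTensor A
          (T₁ (flipComul Δ) (p ⊗ₜ q) ⊗ₜ a)) =
        ((mulRight k z).rTensor H).rTensor A
          (twice (rcoactRight υ) (T₁ (flipComul Δ) (p ⊗ₜ q) ⊗ₜ a)) :=
      twoLegs_map (hc.map_mulRight hH z) (fun t => by simp) _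
    have e2 : ∀ s : H ⊗[k] H, twice (rcoactRight υ) (((mulRight k q).lTensor H).rTensor A
          (s ⊗ₜ a)) = ((mulRight k q).lTensor H).rTensor A (twice (rcoactRight υ) (s ⊗ₜ a)) :=
      fun s => twoLegs_map (fun t => by simp) (hc.map_mulRight hH q) _
    rw [← e1, LinearMap.rTensor_tmul, h2, ← LinearMap.rTensor_tmul, e2, h1,
      ← LinearMap.rTensor_comp_apply, ← LinearMap.rTensor_comp_apply]
    exact congrArg (fun f : H →ₗ[k] H ⊗[k] H => f.rTensor A (rcoactRight υ (p ⊗ₜ a)))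
      (LinearMap.ext fun b => (h2 b z).symm)
  · refine (injective_iff_map_eq_zero υ).1 h.injective a (multiplier_tensor_ext hA hH fun b x => ?_)
    have h0 : rightSnd υ a x = 0 := (TensorProduct.comm k A H).map_eq_zero_iff.1 (ha x)
    rw [fst_tmul_of_covered_snd hA hH (h.covered a x).1, h0, map_zero]
    rfl

theorem IsRightComoduleAlgebra.isMultiplicative (hH : IsNondegenerate H)
    (hA : IsNondegenerate A) (h : IsRightComoduleAlgebra Δ υ) :
    IsMultiplicative (rcoactRight υ) := fun x a b => by
  have hc := coveredFst_commM h.covered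
  rw [← coactRight_commM hH hA h.covered]
  refine rightFst_eq hH hA ?_
  rw [LinearMap.comp_apply, h.map_mul, congrM_mul, mul_assoc, coactRight_tmul]
  change (commM ∘ₗ υ) a * ((commM ∘ₗ υ) b * _) = _
  rw [← embed_rightFst hH hA (hc b x).1, mul_embed (hH.tensor hA), fst_eq_twistMul hH hA hc]

end RightComodule

/-! ### Coactions of a tensor product -/

section Commuting

variable {k : Type u} [Field k] {H : Type v} [AddCommGroup H] [Module k H]
variable {K : Type w'} [AddCommGroup K] [Module k K] {V : Type w} [AddCommGroup V] [Module k V]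

/-- The operators `ρ` on `H ⊗ V` and `τ` on `K ⊗ V` commute, as operators on `H ⊗ K ⊗ V`. -/
def LegsCommute (ρ : H ⊗[k] V →ₗ[k] H ⊗[k] V) (τ : K ⊗[k] V →ₗ[k] K ⊗[k] V) : Prop :=
  ∀ x y v, TensorProduct.leftComm k H K V ((TensorProduct.curry τ y).lTensor H (ρ (x ⊗ₜ v))) =
    (TensorProduct.curry ρ x).lTensor K (τ (y ⊗ₜ v))

theorem LegsCommute.symm {ρ : H ⊗[k] V →ₗ[k] H ⊗[k] V} {τ : K ⊗[k] V →ₗ[k] K ⊗[k] V}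
    (h : LegsCommute ρ τ) : LegsCommute τ ρ := fun y x v => by
  rw [← h]
  generalize (TensorProduct.curry τ y).lTensor H (ρ (x ⊗ₜ v)) = t
  induction t with
  | zero => simp
  | add s s' hs hs' => simp only [map_add, hs, hs']
  | tmul a u =>
    induction u with
    | zero => simp
    | add s s' hs hs' => simp only [map_add, TensorProduct.tmul_add, hs, hs']
    | tmul b c => rfl

end Commuting

section CommutingCompatible

variable {k : Type u} [Field k]
variable {H : Type v} [NonUnitalRing H] [Module k H] [IsScalarTower k H H] [SMulCommClass k H H]
variable {K : Type w'} [NonUnitalRing K] [Module k K] [IsScalarTower k K K] [SMulCommClass k K K]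
variable {V : Type w} [AddCommGroup V] [Module k V]
variable {ρ ρ' : H ⊗[k] V →ₗ[k] H ⊗[k] V} {τ τ' : K ⊗[k] V →ₗ[k] K ⊗[k] V}

/-- An operator that commutes with one covered form of a coaction commutes with the other. -/
theorem LegsCommute.right (h : LegsCommute ρ τ') (hτ : IsCompatible τ τ') (hK : IsNondegenerate K) :
    LegsCommute ρ τ := fun x y v => by
  refine eq_of_mulLeft_rTensor hK fun z => ?_
  have e1 : ∀ t : H ⊗[k] V, (mulLeft k z).rTensor (H ⊗[k] V) (TensorProduct.leftComm k H K V
      ((TensorProduct.curry τ y).lTensor H t)) = (mulRight k y).rTensor (H ⊗[k] V)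
        (TensorProduct.leftComm k H K V ((TensorProduct.curry τ' z).lTensor H t)) := fun t => by
    have e0 : ∀ (f : K →ₗ[k] K) (a : H) (s : K ⊗[k] V), f.rTensor (H ⊗[k] V)
        (TensorProduct.leftComm k H K V (a ⊗ₜ s)) =
        TensorProduct.leftComm k H K V (a ⊗ₜ (f.rTensor V s)) := fun f a s => by
      induction s with
      | zero => simp
      | add s s' hs hs' => simp only [map_add, TensorProduct.tmul_add, hs, hs']
      | tmul c d => simp
    induction t with
    | zero => simp
    | add s s' hs hs' => simp only [map_add, hs, hs']
    | tmul a b =>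
      rw [LinearMap.lTensor_tmul, LinearMap.lTensor_tmul, e0, e0, TensorProduct.curry_apply,
        TensorProduct.curry_apply, hτ]
  rw [e1, h, rTensor_lTensor_comm, rTensor_lTensor_comm, hτ]

end CommutingCompatible

section TensorCoaction

variable {k : Type u} [Field k]
variable {H : Type v} [NonUnitalRing H] [Module k H] [IsScalarTower k H H] [SMulCommClass k H H]
variable {K : Type w'} [NonUnitalRing K] [Module k K] [IsScalarTower k K K] [SMulCommClass k K K]
variable {V : Type w} [AddCommGroup V] [Module k V]
variable {A : Type w} [NonUnitalRing A] [Module k A] [IsScalarTower k A A] [SMulCommClass k A A]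

theorem twistMul_twoLegs (ρ : H ⊗[k] A →ₗ[k] H ⊗[k] A) (τ : K ⊗[k] A →ₗ[k] K ⊗[k] A) (x : H) (a : A)
    (t : K ⊗[k] A) : twistMul (twoLegs ρ τ) ((TensorProduct.mk k A A a).lTensor (H ⊗[k] K)
        ((TensorProduct.assoc k H K A).symm (x ⊗ₜ t))) =
      (TensorProduct.assoc k H K A).symm (((twistMul τ ∘ₗ
        (LinearMap.lTensorHom K (R := k)).flip t ∘ₗ TensorProduct.mk k A A)).lTensor H
          (ρ (x ⊗ₜ a))) := by
  induction t with
  | zero => simp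
  | add s s' hs hs' =>
    simp only [map_add, TensorProduct.tmul_add, hs, hs', LinearMap.add_comp, LinearMap.comp_add,
      LinearMap.lTensor_add, LinearMap.add_apply]
  | tmul y b =>
    rw [TensorProduct.assoc_symm_tmul, LinearMap.lTensor_tmul, TensorProduct.mk_apply,
      twistMul_tmul, twoLegs_tmul]
    generalize ρ (x ⊗ₜ a) = u
    induction u with
    | zero => simp
    | add s s' hs hs' => simp only [map_add, hs, hs']
    | tmul c d =>
      rw [LinearMap.lTensor_tmul, LinearMap.lTensor_tmul]
      change _ = (TensorProduct.assoc k H K A).symm (c ⊗ₜ[k] (twistMul τ (y ⊗ₜ (d ⊗ₜ b))))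
      rw [twistMul_tmul, TensorProduct.curry_apply]
      generalize τ (y ⊗ₜ d) = z
      induction z with
      | zero => simp
      | add s s' hs hs' => simp only [map_add, TensorProduct.tmul_add, hs, hs']
      | tmul e f => rfl

theorem IsMultiplicative.twoLegs {ρ : H ⊗[k] A →ₗ[k] H ⊗[k] A} {τ : K ⊗[k] A →ₗ[k] K ⊗[k] A}
    (hρ : IsMultiplicative ρ) (hτ : IsMultiplicative τ) : IsMultiplicative (twoLegs ρ τ) := by
  intro m a b
  induction m with
  | zero => simp
  | add s s' hs hs' => simp only [map_add, TensorProduct.add_tmul, hs, hs']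
  | tmul x y =>
    rw [twoLegs_tmul, twoLegs_tmul, hρ]
    generalize ρ (x ⊗ₜ b) = t
    induction t with
    | zero => simp
    | add s s' hs hs' => simp only [map_add, hs, hs']
    | tmul c d =>
      rw [LinearMap.lTensor_tmul, LinearMap.lTensor_tmul, twistMul_twoLegs, TensorProduct.mk_apply,
        twistMul_tmul, ← LinearMap.lTensor_comp_apply, TensorProduct.curry_apply]
      congr 3
      ext e
      exact hτ y e d

variable {Δ : H →ₗ[k] Multiplier k (H ⊗[k] H)} {Δ' : K →ₗ[k] Multiplier k (K ⊗[k] K)}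
variable {ρ ρ' : H ⊗[k] V →ₗ[k] H ⊗[k] V} {τ τ' : K ⊗[k] V →ₗ[k] K ⊗[k] V}

/-- Up to the shuffle of the legs, applying the combined coaction of `H ⊗ K` twice amounts to applying
the coaction of `K` twice and the coaction of `H` twice. -/
theorem LegsCommute.twice_twoLegs (h : LegsCommute ρ τ) (s : H ⊗[k] H) (t : K ⊗[k] K) (v : V) :
    twice (twoLegs ρ τ) (shuffle k H K (s ⊗ₜ t) ⊗ₜ v) =
      (shuffle k H K).toLinearMap.rTensor V (twoLegs (twice ρ) (twice τ) ((s ⊗ₜ t) ⊗ₜ v)) := by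
  induction s with
  | zero => simp
  | add s s' hs hs' => simp only [map_add, TensorProduct.add_tmul, hs, hs']
  | tmul x x' =>
  induction t with
  | zero => simp
  | add s s' hs hs' => simp only [map_add, TensorProduct.add_tmul, TensorProduct.tmul_add, hs, hs']
  | tmul y y' =>
  let P : H → K ⊗[k] (H ⊗[k] V) →ₗ[k] ((H ⊗[k] K) ⊗[k] (H ⊗[k] K)) ⊗[k] V := fun a =>
    (TensorProduct.assoc k (H ⊗[k] K) (H ⊗[k] K) V).symm.toLinearMap ∘ₗ
      TensorProduct.map (TensorProduct.mk k H K a)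
        ((TensorProduct.assoc k H K V).symm.toLinearMap ∘ₗ (TensorProduct.curry τ y').lTensor H)
  have h1 : ∀ (a : H) (u : K ⊗[k] V), (TensorProduct.assoc k (H ⊗[k] K) (H ⊗[k] K) V).symm
      ((TensorProduct.curry (twoLegs ρ τ) (x' ⊗ₜ y')).lTensor (H ⊗[k] K)
        ((TensorProduct.assoc k H K V).symm (a ⊗ₜ u))) =
          P a ((TensorProduct.curry ρ x').lTensor K u) := fun a u => by
    induction u with
    | zero => simp
    | add s s' hs hs' => simp only [map_add, TensorProduct.tmul_add, hs, hs']
    | tmul c d => rfl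
  have h2 : ∀ (a : H) (w : H ⊗[k] V), P a (TensorProduct.leftComm k H K V
      ((TensorProduct.curry τ y).lTensor H w)) = (shuffle k H K).toLinearMap.rTensor V
        ((TensorProduct.assoc k (H ⊗[k] H) (K ⊗[k] K) V).symm
          ((TensorProduct.curry (twice τ) (y ⊗ₜ y')).lTensor (H ⊗[k] H)
            ((TensorProduct.assoc k H H V).symm (a ⊗ₜ w)))) := fun a w => by
    induction w with
    | zero => simp
    | add s s' hs hs' => simp only [map_add, TensorProduct.tmul_add, hs, hs']
    | tmul e f =>
      rw [TensorProduct.assoc_symm_tmul, LinearMap.lTensor_tmul, LinearMap.lTensor_tmul,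
        TensorProduct.curry_apply, TensorProduct.curry_apply, twoLegs_tmul]
      generalize τ (y ⊗ₜ f) = u
      induction u with
      | zero => simp
      | add s s' hs hs' => simp only [map_add, TensorProduct.tmul_add, hs, hs']
      | tmul c g =>
        change (TensorProduct.assoc k (H ⊗[k] K) (H ⊗[k] K) V).symm ((a ⊗ₜ c) ⊗ₜ
          (TensorProduct.assoc k H K V).symm (e ⊗ₜ (τ (y' ⊗ₜ g)))) =
          (shuffle k H K).toLinearMap.rTensor V
            ((TensorProduct.assoc k (H ⊗[k] H) (K ⊗[k] K) V).symm ((a ⊗ₜ e) ⊗ₜ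
              (TensorProduct.assoc k K K V).symm (c ⊗ₜ τ (y' ⊗ₜ g))))
        generalize τ (y' ⊗ₜ g) = z
        induction z with
        | zero => simp
        | add s s' hs hs' => simp only [map_add, TensorProduct.tmul_add, hs, hs']
        | tmul i j => rfl
  change twice (twoLegs ρ τ) (((x ⊗ₜ y) ⊗ₜ (x' ⊗ₜ y')) ⊗ₜ v) = _
  rw [twoLegs_tmul, twoLegs_tmul, twoLegs_tmul, twoLegs_tmul]
  generalize ρ (x ⊗ₜ v) = t
  induction t with
  | zero => simp
  | add s s' hs hs' => simp only [map_add, hs, hs']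
  | tmul a b =>
    rw [LinearMap.lTensor_tmul, LinearMap.lTensor_tmul, h1, TensorProduct.curry_apply, ← h, h2,
      TensorProduct.curry_apply]

theorem IsCoaction.tensor (hΔ : IsComultiplication Δ) (hΔ' : IsComultiplication Δ')
    (hρ : IsCoaction Δ ρ ρ') (hτ : IsCoaction Δ' τ τ') (h : LegsCommute ρ τ) :
    IsCoaction (tensorComul Δ Δ' :) (twoLegs ρ τ) (twoLegs ρ' τ') := by
  refine ⟨hρ.compat.twoLegs hτ.compat, fun p q v => ?_, fun v hv => ?_⟩
  · induction p with
    | zero => simp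
    | add s s' hs hs' => simp only [map_add, TensorProduct.add_tmul, hs, hs']
    | tmul p p' =>
    induction q with
    | zero => simp
    | add s s' hs hs' =>
      simp only [map_add, TensorProduct.add_tmul, TensorProduct.tmul_add, hs, hs',
        LinearMap.rTensor_add, LinearMap.add_apply]
    | tmul q q' =>
    have hT : ∀ p p', T₁ (tensorComul Δ Δ' :) ((p ⊗ₜ p') ⊗ₜ (q ⊗ₜ q')) =
        shuffle k H K (T₁ Δ (p ⊗ₜ q) ⊗ₜ T₁ Δ' (p' ⊗ₜ q')) := fun p p' =>
      T₁_tensorComul hΔ hΔ' (p ⊗ₜ q) (p' ⊗ₜ q')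
    rw [hT, h.twice_twoLegs, twoLegs_tmul, twoLegs_tmul, hρ.coassoc]
    generalize ρ (p ⊗ₜ v) = t
    induction t with
    | zero => simp
    | add s s' hs hs' => simp only [map_add, hs, hs']
    | tmul a b =>
      rw [LinearMap.rTensor_tmul, LinearMap.lTensor_tmul, LinearMap.lTensor_tmul,
        TensorProduct.curry_apply, TensorProduct.curry_apply, hτ.coassoc]
      generalize τ (p' ⊗ₜ b) = u
      induction u with
      | zero => simp
      | add s s' hs hs' => simp only [map_add, TensorProduct.tmul_add, hs, hs']
      | tmul c d => exact congrArg (· ⊗ₜ[k] d) (hT a c).symm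
  · refine hρ.injective v fun x => ?_
    refine eq_of_lTensor (fun y => TensorProduct.curry τ y) (fun c d hcd => ?_) fun y => ?_
    · refine sub_eq_zero.1 (hτ.injective _ fun y => ?_)
      rw [TensorProduct.tmul_sub, map_sub, sub_eq_zero]
      exact hcd y
    · have := hv (x ⊗ₜ y)
      rw [twoLegs_tmul, LinearEquiv.map_eq_zero_iff] at this
      rw [this, map_zero]

end TensorCoaction

/-! ### Actions of the opposite algebra and of a tensor product -/

section Actions

variable {k : Type u} [Field k]
variable {H : Type v} [NonUnitalRing H] [Module k H] [IsScalarTower k H H] [SMulCommClass k H H]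
variable {K : Type w'} [NonUnitalRing K] [Module k K] [IsScalarTower k K K] [SMulCommClass k K K]
variable {A : Type w} [NonUnitalRing A] [Module k A] [IsScalarTower k A A] [SMulCommClass k A A]
variable {Δ : H →ₗ[k] Multiplier k (H ⊗[k] H)} {Δ' : K →ₗ[k] Multiplier k (K ⊗[k] K)}

theorem IsRegularMultiplierHopf.leftFst_leftSnd (h : IsRegularMultiplierHopf Δ) (a x y : H) :
    (mulLeft k y).lTensor H (leftFst Δ a x) = (mulLeft k x).rTensor H (leftSnd Δ a y) := by
  have hH := h.nondegenerate
  apply embed_injective (k := k) (hH.tensor hH)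
  have e : sndM k H H y * fstM k H H x = fstM k H H x * sndM k H H y :=
    multiplier_tensor_ext hH hH fun _ _ => rfl
  rw [← sndM_fst, ← fstM_fst, ← mul_embed (hH.tensor hH), ← mul_embed (hH.tensor hH),
    embed_leftFst hH hH (h.coveredFst a x).2, embed_leftSnd hH hH (h.coveredSnd a y).2,
    ← mul_assoc, e, mul_assoc]

/-- The left action of `Hᵒᵖ` given by a right action of `H`. -/
abbrev opAction {M : Type w} [AddCommGroup M] [Module k M] (ract : H →ₗ[k] M →ₗ[k] M) :
    Hᵐᵒᵖ →ₗ[k] M →ₗ[k] M := ract ∘ₗ (MulOpposite.opLinearEquiv k).symm.toLinearMap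

/-- `(ab) ◁ x = ∑ (a ◁ x₁)(b ◁ x₂)`, with `x₂` covered by `b = b' ◁ y`. -/
theorem IsRightModuleAlgebra.map_mul' {ract : H →ₗ[k] A →ₗ[k] A} (hΔ : IsRegularMultiplierHopf Δ)
    (h : IsRightModuleAlgebra Δ ract) (x y : H) (a b : A) : ract x (a * ract y b) =
      LinearMap.mul' k A (TensorProduct.map (ract.flip a) (ract.flip b) (leftSnd Δ x y)) := by
  obtain ⟨e, he⟩ := h.unital a
  have h1 := h.map_mul x e a (ract y b)
  have h3 : ∀ t : H ⊗[k] H, TensorProduct.map (ract.flip a) (ract.flip (ract y b)) t =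
      TensorProduct.map (ract.flip a) (ract.flip b) ((mulLeft k y).lTensor H t) := fun t => by
    induction t with
    | zero => simp
    | add s s' hs hs' => simp only [map_add, hs, hs']
    | tmul c d => simp [h.act_mul]
  have h4 : ∀ t : H ⊗[k] H, TensorProduct.map (ract.flip a) (ract.flip b)
      ((mulLeft k e).rTensor H t) = TensorProduct.map (ract.flip a) (ract.flip b) t := fun t => by
    induction t with
    | zero => simp
    | add s s' hs hs' => simp only [map_add, hs, hs']
    | tmul c d => simp [h.act_mul, he]
  rw [he, h3, hΔ.leftFst_leftSnd, h4] at h1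
  exact h1

theorem IsRightModuleAlgebra.op {ract : H →ₗ[k] A →ₗ[k] A} (hΔ : IsRegularMultiplierHopf Δ)
    (h : IsRightModuleAlgebra Δ ract) : IsLeftModuleAlgebra (opComul Δ :) (opAction ract) where
  act_mul x y a := h.act_mul y.unop x.unop a
  unital a := by
    obtain ⟨e, he⟩ := h.unital a
    exact ⟨MulOpposite.op e, he⟩
  map_mul x y a b := by
    have h2 : rightSnd (opComul Δ :) x y = TensorProduct.map (MulOpposite.opLinearEquiv k).toLinearMap
        (MulOpposite.opLinearEquiv k).toLinearMap (leftSnd Δ x.unop y.unop) := by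
      refine (hΔ.T₁_opComul (y.unop ⊗ₜ x.unop)).trans ?_
      rw [hΔ.T₂_flip]
      exact congrArg (TensorProduct.congr _ _) (TensorProduct.comm_comm k H H _)
    rw [h2]
    exact (h.map_mul' hΔ x.unop y.unop a b).trans (congrArg _ (LinearMap.congr_fun
      (TensorProduct.map_comp ((opAction ract).flip a) ((opAction ract).flip b)
        (MulOpposite.opLinearEquiv k).toLinearMap (MulOpposite.opLinearEquiv k).toLinearMap) _))

/-- The action `(x ⊗ y) ▷ a = y ▷ (x ▷ a)` of `H ⊗ K`, for commuting actions of `H` and `K`. -/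
def tensorAction {M : Type w} [AddCommGroup M] [Module k M] (act : H →ₗ[k] M →ₗ[k] M)
    (act' : K →ₗ[k] M →ₗ[k] M) : H ⊗[k] K →ₗ[k] M →ₗ[k] M :=
  TensorProduct.lift ((LinearMap.mul k (Module.End k M)).flip.compl₁₂ act act')

theorem tensorAction_tmul {M : Type w} [AddCommGroup M] [Module k M] (act : H →ₗ[k] M →ₗ[k] M)
    (act' : K →ₗ[k] M →ₗ[k] M) (x : H) (y : K) (a : M) : tensorAction act act' (x ⊗ₜ y) a = act' y (act x a) := rfl

theorem IsLeftModuleAlgebra.tensor {act : H →ₗ[k] A →ₗ[k] A} {act' : K →ₗ[k] A →ₗ[k] A}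
    (hΔ : IsComultiplication Δ) (hΔ' : IsComultiplication Δ') (h : IsLeftModuleAlgebra Δ act)
    (h' : IsLeftModuleAlgebra Δ' act') (hc : ∀ x y a, act' y (act x a) = act x (act' y a)) :
    IsLeftModuleAlgebra (tensorComul Δ Δ' :) (tensorAction act act') where
  act_mul s t a := by
    induction s with
    | zero => simp
    | add s s' hs hs' => simp only [map_add, add_mul, LinearMap.add_apply, hs, hs']
    | tmul x y =>
    induction t with
    | zero => simp
    | add s s' hs hs' => simp only [map_add, mul_add, LinearMap.add_apply, hs, hs']
    | tmul x' y' =>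
      rw [Algebra.TensorProduct.tmul_mul_tmul (R := k), tensorAction_tmul, tensorAction_tmul,
        tensorAction_tmul, h.act_mul, h'.act_mul, hc x y']
  unital a := by
    obtain ⟨e, he⟩ := h.unital a
    obtain ⟨e', he'⟩ := h'.unital a
    exact ⟨e ⊗ₜ e', by rw [tensorAction_tmul, he, he']⟩
  map_mul s t a b := by
    induction s with
    | zero => simp
    | add s s' hs hs' => simp only [map_add, LinearMap.add_apply, hs, hs']
    | tmul x x' =>
    induction t with
    | zero => simp
    | add s s' hs hs' => simp only [map_add, mul_add, LinearMap.add_apply, hs, hs']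
    | tmul y y' =>
      have hT : rightSnd (tensorComul Δ Δ' :) (x ⊗ₜ x') (y ⊗ₜ y') =
          shuffle k H K (rightSnd Δ x y ⊗ₜ rightSnd Δ' x' y') :=
        T₁_tensorComul hΔ hΔ' (x ⊗ₜ y) (x' ⊗ₜ y')
      rw [hT, tensorAction_tmul, tensorAction_tmul, hc y y', h.map_mul]
      generalize rightSnd Δ x y = u
      induction u with
      | zero => simp
      | add s s' hs hs' => simp only [map_add, TensorProduct.add_tmul, hs, hs']
      | tmul c d =>
        rw [TensorProduct.map_tmul, LinearMap.mul'_apply, LinearMap.flip_apply, LinearMap.flip_apply,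
          ← hc, h'.map_mul]
        generalize rightSnd Δ' x' y' = z
        induction z with
        | zero => simp
        | add s s' hs hs' => simp only [map_add, TensorProduct.tmul_add, hs, hs']
        | tmul e f => rfl

end Actions

/-! ### Twisting maps from an action and a coaction -/

section Twist

variable {k : Type u} [Field k]
variable {H : Type v} [NonUnitalRing H] [Module k H] [IsScalarTower k H H] [SMulCommClass k H H]
variable {M : Type w} [AddCommGroup M] [Module k M] {B : Type w'} [AddCommGroup B] [Module k B]

/-- A unital action of the nonunital algebra `H` on the vector space `M`. -/
structure IsUnitalAction (act : H →ₗ[k] M →ₗ[k] M) : Prop where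
  act_mul : ∀ x y m, act (x * y) m = act x (act y m)
  unital : ∀ m, ∃ e, act e m = m

variable {act : H →ₗ[k] M →ₗ[k] M} {τ τ' τ₂ : H ⊗[k] B →ₗ[k] H ⊗[k] B}
  {Λ Λ₂ : M ⊗[k] B →ₗ[k] M ⊗[k] B}

/-- Finitely many elements have a common local unit: if `e` fixes the elements of `l` and `e'` fixes
`m - e m`, then `e + e' - e' e` fixes `m` and the elements of `l`. -/
theorem IsUnitalAction.exists_unit_list (h : IsUnitalAction act) (l : List M) :
    ∃ e, ∀ m ∈ l, act e m = m := by
  induction l with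
  | nil => exact ⟨0, by simp⟩
  | cons m l ih =>
    obtain ⟨e, he⟩ := ih
    obtain ⟨e', he'⟩ := h.unital (m - act e m)
    refine ⟨e + e' - e' * e, fun n hn => ?_⟩
    have e1 : act (e + e' - e' * e) n = act e n + act e' (n - act e n) := by
      simp only [map_add, map_sub, LinearMap.add_apply, LinearMap.sub_apply, h.act_mul]
      abel
    rw [e1]
    rcases List.mem_cons.1 hn with rfl | hn
    · rw [he']; abel
    · rw [he n hn]; simp

theorem IsUnitalAction.exists_unit (h : IsUnitalAction act) (t : M ⊗[k] B) :
    ∃ e, (act e).rTensor B t = t := by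
  have : ∃ l : List M, ∀ e, (∀ m ∈ l, act e m = m) → (act e).rTensor B t = t := by
    induction t with
    | zero => exact ⟨[], by simp⟩
    | tmul m b => exact ⟨[m], fun e he => by rw [LinearMap.rTensor_tmul, he m (by simp)]⟩
    | add s s' hs hs' =>
      obtain ⟨l, hl⟩ := hs
      obtain ⟨l', hl'⟩ := hs'
      refine ⟨l ++ l', fun e he => ?_⟩
      rw [map_add, hl e fun m hm => he m (by simp [hm]), hl' e fun m hm => he m (by simp [hm])]
  obtain ⟨l, hl⟩ := this
  obtain ⟨e, he⟩ := h.exists_unit_list l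
  exact ⟨e, hl e he⟩

theorem IsUnitalAction.surjective (h : IsUnitalAction act) :
    Function.Surjective (TensorProduct.lift act) := fun m => by
  obtain ⟨e, he⟩ := h.unital m
  exact ⟨e ⊗ₜ m, he⟩

/-- `Λ` is the operator `m ⊗ b ↦ b₍₋₁₎ ▷ m ⊗ b₀`, where `τ : x ⊗ b ↦ b₍₋₁₎ x ⊗ b₀`. -/
def IsTwist (act : H →ₗ[k] M →ₗ[k] M) (τ : H ⊗[k] B →ₗ[k] H ⊗[k] B)
    (Λ : M ⊗[k] B →ₗ[k] M ⊗[k] B) : Prop :=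
  ∀ x m b, Λ (act x m ⊗ₜ b) = (act.flip m).rTensor B (τ (x ⊗ₜ b))

theorem act_rTensor_flip (h : IsUnitalAction act) (e : H) (m : M) (t : H ⊗[k] B) :
    (act e).rTensor B ((act.flip m).rTensor B t) =
      (act.flip m).rTensor B ((mulLeft k e).rTensor B t) := by
  induction t with
  | zero => simp
  | add s s' hs hs' => simp only [map_add, hs, hs']
  | tmul x b => simp [h.act_mul]

theorem flip_rTensor_mulRight (h : IsUnitalAction act) (x : H) (m : M) (t : H ⊗[k] B) :
    (act.flip m).rTensor B ((mulRight k x).rTensor B t) = (act.flip (act x m)).rTensor B t := by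
  induction t with
  | zero => simp
  | add s s' hs hs' => simp only [map_add, hs, hs']
  | tmul y b => simp [h.act_mul]

/-- The twisting map exists: if `∑ xᵢ ▷ mᵢ = 0`, then `X = ∑ b₍₋₁₎ xᵢ ▷ mᵢ ⊗ b₀` has a local unit
`e`, and `X = e X = ∑ (e b₍₋₁₎) xᵢ ▷ mᵢ ⊗ b₀ = 0`. -/
theorem exists_isTwist (h : IsUnitalAction act) (hτ : IsCompatible τ τ') :
    ∃ Λ, IsTwist act τ Λ := by
  obtain ⟨s, hs⟩ := LinearMap.exists_rightInverse_of_surjective (TensorProduct.lift act)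
    (LinearMap.range_eq_top.2 h.surjective)
  let F : B → H ⊗[k] M →ₗ[k] M ⊗[k] B := fun b => TensorProduct.lift (LinearMap.flip
    (LinearMap.mk₂ k (fun (m : M) (x : H) => (act.flip m).rTensor B (τ (x ⊗ₜ b)))
      (by intros; simp [LinearMap.rTensor_add]) (by intros; simp [LinearMap.rTensor_smul])
      (by intros; simp [TensorProduct.add_tmul])
      (by intros; rw [← TensorProduct.smul_tmul']; simp)))
  have hF : ∀ b x m, F b (x ⊗ₜ m) = (act.flip m).rTensor B (τ (x ⊗ₜ b)) := fun _ _ _ => rfl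
  have h1 : ∀ b e u, (act e).rTensor B (F b u) =
      (act.flip (TensorProduct.lift act u)).rTensor B (τ' (e ⊗ₜ b)) := fun b e u => by
    induction u with
    | zero => simp
    | add s s' hs hs' => simp only [map_add, hs, hs', LinearMap.rTensor_add, LinearMap.add_apply]
    | tmul x m =>
      rw [hF, act_rTensor_flip h, hτ, flip_rTensor_mulRight h, TensorProduct.lift.tmul]
  have h2 : ∀ b u, TensorProduct.lift act u = 0 → F b u = 0 := fun b u hu => by
    obtain ⟨e, he⟩ := h.exists_unit (F b u)
    rw [← he, h1, hu]
    simp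
  have h3 : ∀ b u, F b (s (TensorProduct.lift act u)) = F b u := fun b u => by
    rw [← sub_eq_zero, ← map_sub]
    refine h2 b _ ?_
    rw [map_sub, sub_eq_zero]
    exact LinearMap.congr_fun hs _
  refine ⟨TensorProduct.lift (LinearMap.mk₂ k (fun m b => F b (s m)) (fun m m' b => by simp)
    (fun c m b => by simp) (fun m b b' => ?_) (fun c m b => ?_)), fun x m b => h3 b (x ⊗ₜ m)⟩
  · generalize s m = u
    induction u with
    | zero => simp
    | add s s' hs hs' => simp only [map_add, hs, hs']; abel
    | tmul x n => simp only [hF, TensorProduct.tmul_add, map_add]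
  · generalize s m = u
    induction u with
    | zero => simp
    | add s s' hs hs' => simp only [map_add, hs, hs', smul_add]
    | tmul x n => simp only [hF, TensorProduct.tmul_smul, map_smul]

theorem IsTwist.apply_flip (hΛ : IsTwist act τ Λ) (m : M) (t : H ⊗[k] B) :
    Λ ((act.flip m).rTensor B t) = (act.flip m).rTensor B (τ t) := by
  induction t with
  | zero => simp
  | add s s' hs hs' => simp only [map_add, hs, hs']
  | tmul x b => exact hΛ x m b

theorem IsTwist.comp (hΛ : IsTwist act τ Λ) (hΛ₂ : IsTwist act τ₂ Λ₂) :
    IsTwist act (τ ∘ₗ τ₂) (Λ ∘ₗ Λ₂) := fun x m b => by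
  rw [LinearMap.comp_apply, hΛ₂, hΛ.apply_flip, LinearMap.comp_apply]

theorem IsTwist.eq_id (h : IsUnitalAction act) (hΛ : IsTwist act τ Λ) (hτ : ∀ t, τ t = t)
    (t : M ⊗[k] B) : Λ t = t := by
  induction t with
  | zero => simp
  | add s s' hs hs' => simp only [map_add, hs, hs']
  | tmul m b =>
    obtain ⟨e, he⟩ := h.unital m
    have := hΛ e m b
    rw [hτ, he] at this
    rw [this, LinearMap.rTensor_tmul, LinearMap.flip_apply, he]

end Twist

/-! ### Twisting maps and products -/

section TwistMul

variable {k : Type u} [Field k]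
variable {M : Type w} [AddCommGroup M] [Module k M] {B : Type w'} [AddCommGroup B] [Module k B]

/-- `Λ (m n ⊗ b) = m' Λ (n ⊗ b')` for `Λ (m ⊗ b) = m' ⊗ b'`, where `mM` is the product of `M`. -/
def IsMulLeft (mM : M →ₗ[k] M →ₗ[k] M) (Λ : M ⊗[k] B →ₗ[k] M ⊗[k] B) : Prop :=
  ∀ m n b, Λ (mM m n ⊗ₜ b) = (TensorProduct.lift mM).rTensor B
    ((TensorProduct.assoc k M M B).symm ((TensorProduct.curry Λ n).lTensor M (Λ (m ⊗ₜ b))))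

/-- `Λ (m ⊗ b d) = b' Λ (m' ⊗ d)` for `Λ (m ⊗ b) = m' ⊗ b'`, where `mB` is the flipped product
of `B`. -/
def IsMulRight (mB : B →ₗ[k] B →ₗ[k] B) (Λ : M ⊗[k] B →ₗ[k] M ⊗[k] B) : Prop :=
  ∀ m b d, Λ (m ⊗ₜ mB b d) = (TensorProduct.lift mB.flip).lTensor M
    (TensorProduct.assoc k M B B (((TensorProduct.curry Λ).flip d).rTensor B (Λ (m ⊗ₜ b))))

/-- The operators `Φ` and `Ψ` commute, as operators on `M ⊗ B ⊗ B` with common first leg. -/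
def CoLegsCommute (Φ Ψ : M ⊗[k] B →ₗ[k] M ⊗[k] B) : Prop :=
  ∀ m b d, TensorProduct.rightComm k M B B
      (((TensorProduct.curry Φ).flip d).rTensor B (Ψ (m ⊗ₜ b))) =
    ((TensorProduct.curry Ψ).flip b).rTensor B (Φ (m ⊗ₜ d))

variable {mM : M →ₗ[k] M →ₗ[k] M} {mB : B →ₗ[k] B →ₗ[k] B} {Λ Φ : M ⊗[k] B →ₗ[k] M ⊗[k] B}

theorem IsMulLeft.inverse (h : IsMulLeft mM Λ) (h1 : ∀ t, Λ (Φ t) = t) (h2 : ∀ t, Φ (Λ t) = t) :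
    IsMulLeft mM.flip Φ := fun m n b => by
  have h3 : ∀ (m : M) (t : M ⊗[k] B), Λ ((mM.flip m).rTensor B t) =
      (TensorProduct.lift mM).rTensor B ((TensorProduct.assoc k M M B).symm
        ((TensorProduct.curry Λ m).lTensor M (Λ t))) := fun m t => by
    induction t with
    | zero => simp
    | add s s' hs hs' => simp only [map_add, hs, hs']
    | tmul a b => exact h a m b
  have h4 : ∀ u : M ⊗[k] B, Λ ((TensorProduct.lift mM.flip).rTensor B
      ((TensorProduct.assoc k M M B).symm ((TensorProduct.curry Φ n).lTensor M u))) =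
        (mM n).rTensor B (Λ u) := fun u => by
    induction u with
    | zero => simp
    | add s s' hs hs' => simp only [map_add, hs, hs']
    | tmul c d =>
      have e1 : ∀ t : M ⊗[k] B, (TensorProduct.lift mM.flip).rTensor B
          ((TensorProduct.assoc k M M B).symm (c ⊗ₜ t)) = (mM.flip c).rTensor B t := fun t => by
        induction t with
        | zero => simp
        | add s s' hs hs' => simp only [map_add, TensorProduct.tmul_add, hs, hs']
        | tmul a b => simp
      have e2 : ∀ t : M ⊗[k] B, (TensorProduct.lift mM).rTensor B
          ((TensorProduct.assoc k M M B).symm (n ⊗ₜ t)) = (mM n).rTensor B t := fun t => by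
        induction t with
        | zero => simp
        | add s s' hs hs' => simp only [map_add, TensorProduct.tmul_add, hs, hs']
        | tmul a b => simp
      rw [LinearMap.lTensor_tmul, e1, h3, TensorProduct.curry_apply, h1, LinearMap.lTensor_tmul,
        e2, TensorProduct.curry_apply]
  rw [← h2 ((TensorProduct.lift mM.flip).rTensor B _), h4, h1]
  rfl

theorem IsMulRight.inverse (h : IsMulRight mB Λ) (h1 : ∀ t, Λ (Φ t) = t) (h2 : ∀ t, Φ (Λ t) = t) :
    IsMulRight mB.flip Φ := fun m b d => by
  have h3 : ∀ (d : B) (t : M ⊗[k] B), Λ ((mB.flip d).lTensor M t) =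
      (TensorProduct.lift mB.flip).lTensor M (TensorProduct.assoc k M B B
        (((TensorProduct.curry Λ).flip d).rTensor B (Λ t))) := fun d t => by
    induction t with
    | zero => simp
    | add s s' hs hs' => simp only [map_add, hs, hs']
    | tmul a b => exact h a b d
  have h4 : ∀ u : M ⊗[k] B, Λ ((TensorProduct.lift mB).lTensor M
      (TensorProduct.assoc k M B B (((TensorProduct.curry Φ).flip d).rTensor B u))) =
        (mB d).lTensor M (Λ u) := fun u => by
    induction u with
    | zero => simp
    | add s s' hs hs' => simp only [map_add, hs, hs']
    | tmul c e =>
      have e1 : ∀ t : M ⊗[k] B, (TensorProduct.lift mB).lTensor M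
          (TensorProduct.assoc k M B B (t ⊗ₜ e)) = (mB.flip e).lTensor M t := fun t => by
        induction t with
        | zero => simp
        | add s s' hs hs' => simp only [map_add, TensorProduct.add_tmul, hs, hs']
        | tmul a b => simp
      have e2 : ∀ t : M ⊗[k] B, (TensorProduct.lift mB.flip).lTensor M
          (TensorProduct.assoc k M B B (t ⊗ₜ d)) = (mB d).lTensor M t := fun t => by
        induction t with
        | zero => simp
        | add s s' hs hs' => simp only [map_add, TensorProduct.add_tmul, hs, hs']
        | tmul a b => simp
      rw [LinearMap.rTensor_tmul, e1, h3, LinearMap.flip_apply, TensorProduct.curry_apply, h1,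
        LinearMap.rTensor_tmul, e2, LinearMap.flip_apply, TensorProduct.curry_apply]
  have h5 := h4 (Φ (m ⊗ₜ b))
  rw [h1] at h5
  rw [LinearMap.flip_flip, ← h2 ((TensorProduct.lift mB).lTensor M _), h5]
  rfl

end TwistMul

/-! ### Multiplicativity and commutation of twisting maps -/

section TwistTheory

variable {k : Type u} [Field k]
variable {H : Type v} [NonUnitalRing H] [Module k H] [IsScalarTower k H H] [SMulCommClass k H H]
variable {K : Type v'} [NonUnitalRing K] [Module k K] [IsScalarTower k K K] [SMulCommClass k K K]
variable {M : Type w} [AddCommGroup M] [Module k M] {B : Type w'} [AddCommGroup B] [Module k B]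
variable {act : H →ₗ[k] M →ₗ[k] M} {act₂ : K →ₗ[k] M →ₗ[k] M}
  {τ : H ⊗[k] B →ₗ[k] H ⊗[k] B} {τ₂ : K ⊗[k] B →ₗ[k] K ⊗[k] B}
  {Λ Λ₂ : M ⊗[k] B →ₗ[k] M ⊗[k] B}

theorem IsLeftModuleAlgebra.isUnitalAction {A : Type w} [NonUnitalRing A] [Module k A]
    [IsScalarTower k A A] [SMulCommClass k A A] {Δ : H →ₗ[k] Multiplier k (H ⊗[k] H)}
    {act : H →ₗ[k] A →ₗ[k] A} (h : IsLeftModuleAlgebra Δ act) : IsUnitalAction act :=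
  ⟨h.act_mul, h.unital⟩

/-- For a module algebra, the twisting map is multiplicative in the algebra that is acted on. The
products of the elements `p ▷ m` and `q ▷ n` are treated for all `p ⊗ q = ∑ Δ(x)(1 ⊗ y)` at once. -/
theorem IsTwist.isMulLeft {A : Type w} [NonUnitalRing A] [Module k A] [IsScalarTower k A A]
    [SMulCommClass k A A] {Δ : H →ₗ[k] Multiplier k (H ⊗[k] H)} {act : H →ₗ[k] A →ₗ[k] A}
    {τ' : H ⊗[k] B →ₗ[k] H ⊗[k] B} {Λ : A ⊗[k] B →ₗ[k] A ⊗[k] B}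
    (hΔ : Function.Surjective (T₁ Δ)) (h : IsLeftModuleAlgebra Δ act) (hτ : IsCoaction Δ τ τ')
    (hΛ : IsTwist act τ Λ) : IsMulLeft (LinearMap.mul k A) Λ := fun m n b => by
  obtain ⟨p, hp⟩ := h.unital m
  obtain ⟨q, hq⟩ := h.unital n
  have key : ∀ s : H ⊗[k] H,
      Λ (LinearMap.mul' k A (TensorProduct.map (act.flip m) (act.flip n) s) ⊗ₜ b) =
        (LinearMap.mul' k A).rTensor B ((TensorProduct.map (act.flip m) (act.flip n)).rTensor B
          (twice τ (s ⊗ₜ b))) := fun s => by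
    obtain ⟨s, rfl⟩ := hΔ s
    induction s with
    | zero => simp
    | add s s' hs hs' => simp only [map_add, TensorProduct.add_tmul, hs, hs']
    | tmul x y =>
      rw [hτ.coassoc]
      change Λ (LinearMap.mul' k A (TensorProduct.map _ _ (rightSnd Δ x y)) ⊗ₜ b) = _
      rw [← h.map_mul, hΛ]
      generalize τ (x ⊗ₜ b) = t
      induction t with
      | zero => simp
      | add s s' hs hs' => simp only [map_add, hs, hs']
      | tmul c d => exact congrArg (· ⊗ₜ[k] d) (h.map_mul c y m n)
  have h1 := key (p ⊗ₜ q)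
  rw [← twoLegs_map (σ := Λ) (σ' := Λ) (hΛ.apply_flip m) (hΛ.apply_flip n)] at h1
  simp only [TensorProduct.map_tmul, LinearMap.rTensor_tmul, LinearMap.flip_apply, hp, hq] at h1
  exact h1

/-- For a comodule algebra, the twisting map is multiplicative in the algebra that coacts. -/
theorem IsTwist.isMulRight {B : Type w'} [NonUnitalRing B] [Module k B] [IsScalarTower k B B]
    [SMulCommClass k B B] {τ : H ⊗[k] B →ₗ[k] H ⊗[k] B} {Λ : M ⊗[k] B →ₗ[k] M ⊗[k] B}
    (h : IsUnitalAction act) (hτ : IsMultiplicative τ) (hΛ : IsTwist act τ Λ) :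
    IsMulRight (LinearMap.mul k B).flip Λ := fun m b d => by
  obtain ⟨x, hx⟩ := h.unital m
  have h1 := hΛ x m (d * b)
  have h2 := hΛ x m b
  rw [hx] at h1 h2
  rw [LinearMap.flip_apply, LinearMap.mul_apply', h1, h2, hτ]
  generalize τ (x ⊗ₜ b) = t
  induction t with
  | zero => simp
  | add s s' hs hs' => simp only [map_add, hs, hs']
  | tmul c e =>
    rw [LinearMap.lTensor_tmul, LinearMap.rTensor_tmul, LinearMap.rTensor_tmul,
      TensorProduct.mk_apply, twistMul_tmul, LinearMap.flip_apply, LinearMap.flip_apply,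
      TensorProduct.curry_apply, hΛ]
    generalize τ (c ⊗ₜ d) = u
    induction u with
    | zero => simp
    | add s s' hs hs' => simp only [map_add, TensorProduct.add_tmul, hs, hs']
    | tmul i j => rfl

theorem IsTwist.map_lTensor (h : ∀ m, ∃ e, act e m = m) (hΛ : IsTwist act τ Λ) {f : B →ₗ[k] B}
    (hf : ∀ x b, τ (x ⊗ₜ f b) = f.lTensor H (τ (x ⊗ₜ b))) (t : M ⊗[k] B) :
    Λ (f.lTensor M t) = f.lTensor M (Λ t) := by
  induction t with
  | zero => simp
  | add s s' hs hs' => simp only [map_add, hs, hs']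
  | tmul m b =>
    obtain ⟨x, hx⟩ := h m
    have h1 := hΛ x m (f b)
    have h2 := hΛ x m b
    rw [hx] at h1 h2
    rw [LinearMap.lTensor_tmul, h1, h2, hf]
    generalize τ (x ⊗ₜ b) = u
    induction u with
    | zero => simp
    | add s s' hs hs' => simp only [map_add, hs, hs']
    | tmul c e => rfl

theorem IsTwist.map_rTensor (h : IsUnitalAction act) (hΛ : IsTwist act τ Λ) {f : M →ₗ[k] M}
    (hf : ∀ x m, f (act x m) = act x (f m)) (t : M ⊗[k] B) :
    Λ (f.rTensor B t) = f.rTensor B (Λ t) := by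
  induction t with
  | zero => simp
  | add s s' hs hs' => simp only [map_add, hs, hs']
  | tmul m b =>
    obtain ⟨x, hx⟩ := h.unital m
    have h1 := hΛ x (f m) b
    have h2 := hΛ x m b
    rw [hx] at h2
    rw [← hf, hx] at h1
    rw [LinearMap.rTensor_tmul, h1, h2]
    generalize τ (x ⊗ₜ b) = u
    induction u with
    | zero => simp
    | add s s' hs hs' => simp only [map_add, hs, hs']
    | tmul c e => exact congrArg (· ⊗ₜ[k] e) (hf c m).symm

theorem IsTwist.legsCommute (h : IsUnitalAction act) (h₂ : IsUnitalAction act₂)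
    (hΛ : IsTwist act τ Λ) (hΛ₂ : IsTwist act₂ τ₂ Λ₂) (hτ : LegsCommute τ τ₂) :
    LegsCommute Λ Λ₂ := fun m n b => by
  obtain ⟨x, hx⟩ := h.unital m
  obtain ⟨y, hy⟩ := h₂.unital n
  have h1 := hΛ x m b
  have h2 := hΛ₂ y n b
  have h3 := hτ x y b
  rw [hx] at h1
  rw [hy] at h2
  have e1 : ∀ t : H ⊗[k] B, TensorProduct.leftComm k M M B ((TensorProduct.curry Λ₂ n).lTensor M
      ((act.flip m).rTensor B t)) = TensorProduct.map (act₂.flip n) ((act.flip m).rTensor B)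
        (TensorProduct.leftComm k H K B ((TensorProduct.curry τ₂ y).lTensor H t)) := fun t => by
    induction t with
    | zero => simp
    | add s s' hs hs' => simp only [map_add, hs, hs']
    | tmul c e =>
      rw [LinearMap.lTensor_tmul, LinearMap.rTensor_tmul, LinearMap.lTensor_tmul,
        TensorProduct.curry_apply, TensorProduct.curry_apply]
      have := hΛ₂ y n e
      rw [hy] at this
      rw [this]
      generalize τ₂ (y ⊗ₜ e) = u
      induction u with
      | zero => simp
      | add s s' hs hs' => simp only [map_add, TensorProduct.tmul_add, hs, hs']
      | tmul i j => rfl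
  have e2 : ∀ t : K ⊗[k] B, (TensorProduct.curry Λ m).lTensor M ((act₂.flip n).rTensor B t) =
      TensorProduct.map (act₂.flip n) ((act.flip m).rTensor B)
        ((TensorProduct.curry τ x).lTensor K t) := fun t => by
    induction t with
    | zero => simp
    | add s s' hs hs' => simp only [map_add, hs, hs']
    | tmul c e =>
      have := hΛ x m e
      rw [hx] at this
      exact congrArg (act₂.flip n c ⊗ₜ[k] ·) this
  rw [h1, h2, e1, e2, h3]

theorem IsTwist.coLegsCommute (h : IsUnitalAction act) (h₂ : IsUnitalAction act₂)
    (hΛ : IsTwist act τ Λ) (hΛ₂ : IsTwist act₂ τ₂ Λ₂)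
    (hc : ∀ x y m, act₂ y (act x m) = act x (act₂ y m)) :
    CoLegsCommute Λ₂ Λ := fun m b d => by
  obtain ⟨x, hx⟩ := h.unital m
  obtain ⟨y, hy⟩ := h₂.unital m
  have h1 := hΛ x m b
  have h2 := hΛ₂ y m d
  rw [hx] at h1
  rw [hy] at h2
  rw [h1, h2]
  have e1 : ∀ u c, Λ₂ (act u m ⊗ₜ c) = (act₂.flip (act u m)).rTensor B (τ₂ (y ⊗ₜ c)) :=
    fun u c => by rw [← hΛ₂, hc, hy]
  have e2 : ∀ u c, Λ (act₂ u m ⊗ₜ c) = (act.flip (act₂ u m)).rTensor B (τ (x ⊗ₜ c)) :=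
    fun u c => by rw [← hΛ, ← hc, hx]
  let f : K ⊗[k] B →ₗ[k] M →ₗ[k] M ⊗[k] B := (LinearMap.rTensorHom B ∘ₗ act₂.flip).flip
  let g : H ⊗[k] B →ₗ[k] M →ₗ[k] M ⊗[k] B := (LinearMap.rTensorHom B ∘ₗ act.flip).flip
  have e3 : ∀ s : H ⊗[k] B, ((TensorProduct.curry Λ₂).flip d).rTensor B
      ((act.flip m).rTensor B s) = (f (τ₂ (y ⊗ₜ d))).rTensor B ((act.flip m).rTensor B s) :=
    fun s => by
      induction s with
      | zero => simp
      | add s s' hs hs' => simp only [map_add, hs, hs']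
      | tmul u c => exact congrArg (· ⊗ₜ[k] c) (e1 u d)
  have e4 : ∀ s : K ⊗[k] B, ((TensorProduct.curry Λ).flip b).rTensor B
      ((act₂.flip m).rTensor B s) = (g (τ (x ⊗ₜ b))).rTensor B ((act₂.flip m).rTensor B s) :=
    fun s => by
      induction s with
      | zero => simp
      | add s s' hs hs' => simp only [map_add, hs, hs']
      | tmul u c => exact congrArg (· ⊗ₜ[k] c) (e2 u b)
  rw [e3, e4]
  generalize τ (x ⊗ₜ b) = s
  generalize τ₂ (y ⊗ₜ d) = t
  induction s with
  | zero => simp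
  | add s s' hs hs' => simp only [map_add, hs, hs', LinearMap.rTensor_add, LinearMap.add_apply]
  | tmul u c =>
  induction t with
  | zero => simp
  | add s s' hs hs' => simp only [map_add, hs, hs', LinearMap.rTensor_add, LinearMap.add_apply]
  | tmul v e =>
    change (act₂ v (act u m) ⊗ₜ[k] c) ⊗ₜ[k] e = (act u (act₂ v m) ⊗ₜ[k] c) ⊗ₜ[k] e
    rw [hc]

theorem IsTwist.tensor (hΛ : IsTwist act τ Λ) (hΛ₂ : IsTwist act₂ τ₂ Λ₂)
    (hc : ∀ x y m, act₂ y (act x m) = act x (act₂ y m)) :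
    IsTwist (tensorAction act act₂) (twoLegs τ τ₂) (Λ₂ ∘ₗ Λ) := fun z m b => by
  induction z with
  | zero => simp
  | add s s' hs hs' => simp only [map_add, TensorProduct.add_tmul, LinearMap.add_apply, hs, hs']
  | tmul x y =>
  rw [LinearMap.comp_apply, tensorAction_tmul, hc, hΛ, twoLegs_tmul]
  generalize τ (x ⊗ₜ b) = t
  induction t with
  | zero => simp
  | add s s' hs hs' => simp only [map_add, hs, hs']
  | tmul u c =>
    rw [LinearMap.lTensor_tmul, LinearMap.rTensor_tmul, LinearMap.flip_apply, ← hc, hΛ₂,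
      TensorProduct.curry_apply]
    generalize τ₂ (y ⊗ₜ c) = t
    induction t with
    | zero => simp
    | add s s' hs hs' => simp only [map_add, TensorProduct.tmul_add, hs, hs']
    | tmul u c => rfl

/-- The twisting maps of commuting actions and commuting coactions commute. -/
theorem IsTwist.commute (h : IsUnitalAction act) (h₂ : IsUnitalAction act₂)
    (hΛ : IsTwist act τ Λ) (hΛ₂ : IsTwist act₂ τ₂ Λ₂)
    (hc : ∀ x y m, act₂ y (act x m) = act x (act₂ y m)) (hτ : LegsCommute τ τ₂)
    (t : M ⊗[k] B) : Λ₂ (Λ t) = Λ (Λ₂ t) := by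
  induction t with
  | zero => simp
  | add s s' hs hs' => simp only [map_add, hs, hs']
  | tmul m b =>
    obtain ⟨x, hx⟩ := h.unital m
    obtain ⟨y, hy⟩ := h₂.unital m
    have h1 := hΛ.tensor hΛ₂ hc (x ⊗ₜ y) m b
    have h2 := hΛ₂.tensor hΛ (fun x y m => (hc y x m).symm) (y ⊗ₜ x) m b
    rw [LinearMap.comp_apply, tensorAction_tmul, twoLegs_tmul] at h1 h2
    rw [hx, hy] at h1
    rw [hy, hx] at h2
    rw [h1, h2, ← hτ]
    generalize (TensorProduct.curry τ₂ y).lTensor H (τ (x ⊗ₜ b)) = s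
    induction s with
    | zero => simp
    | add s s' hs hs' => simp only [map_add, hs, hs']
    | tmul u t =>
      induction t with
      | zero => simp
      | add s s' hs hs' => simp only [map_add, TensorProduct.tmul_add, hs, hs']
      | tmul v e => exact congrArg (· ⊗ₜ[k] e) (hc u v m)

end TwistTheory

/-! ### Products on a tensor product -/

section Cross

variable {k : Type u} [Field k]
variable {M : Type w} [AddCommGroup M] [Module k M] {B : Type w'} [AddCommGroup B] [Module k B]

/-- `(m ⊗ b, n ⊗ d) ↦ m n ⊗ d b`, for products `mM` on `M` and `mB` on `B`. -/
abbrev outerMul (mM : M →ₗ[k] M →ₗ[k] M) (mB : B →ₗ[k] B →ₗ[k] B) :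
    M ⊗[k] B →ₗ[k] M ⊗[k] B →ₗ[k] M ⊗[k] B := TensorProduct.map₂ mM mB.flip

/-- The product `(a ⊗ b, c ⊗ d) ↦ a' c' ⊗ b' d'`, where `X (a ⊗ d) = a' ⊗ d'` and
`Y (c ⊗ b) = c' ⊗ b'`. -/
def crossMul (mM : M →ₗ[k] M →ₗ[k] M) (mB : B →ₗ[k] B →ₗ[k] B) (X Y : M ⊗[k] B →ₗ[k] M ⊗[k] B) :
    M ⊗[k] B →ₗ[k] M ⊗[k] B →ₗ[k] M ⊗[k] B :=
  TensorProduct.curry (TensorProduct.lift ((outerMul mM mB).compl₁₂ X Y) ∘ₗ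
    ((TensorProduct.comm k M B).lTensor (M ⊗[k] B) ≪≫ₗ
      TensorProduct.tensorTensorTensorComm k M B B M ≪≫ₗ
      (TensorProduct.comm k B M).lTensor (M ⊗[k] B)).toLinearMap)

variable {mM : M →ₗ[k] M →ₗ[k] M} {mB : B →ₗ[k] B →ₗ[k] B} {X Y Φ Ψ Θ : M ⊗[k] B →ₗ[k] M ⊗[k] B}

theorem crossMul_tmul (a c : M) (b d : B) : crossMul mM mB X Y (a ⊗ₜ b) (c ⊗ₜ d) =
    outerMul mM mB (X (a ⊗ₜ d)) (Y (c ⊗ₜ b)) := rfl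

theorem crossMul_flip :
    crossMul mM.flip mB.flip X Y = (crossMul mM mB Y X).flip := by
  refine TensorProduct.ext' fun a b => TensorProduct.ext' fun c d => ?_
  rw [LinearMap.flip_apply, crossMul_tmul, crossMul_tmul]
  generalize X (a ⊗ₜ d) = s
  generalize Y (c ⊗ₜ b) = t
  induction s with
  | zero => simp
  | add s s' hs hs' => simp only [map_add, LinearMap.add_apply, hs, hs']
  | tmul m b =>
  induction t with
  | zero => simp
  | add s s' hs hs' => simp only [map_add, LinearMap.add_apply, hs, hs']
  | tmul n d => rfl

/-- The product `(a ⊗ b)(c ⊗ d) = a c' ⊗ b' d` is associative if `Θ : c ⊗ b ↦ c' ⊗ b'` is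
multiplicative in both arguments. -/
theorem isAssocMul_crossMul_id (hM : IsAssocMul mM) (hB : IsAssocMul mB) (h₁ : IsMulLeft mM Θ)
    (h₂ : IsMulRight mB.flip Θ) : IsAssocMul (crossMul mM mB LinearMap.id Θ) := fun s t u => by
  induction s with
  | zero => simp
  | add s s' hs hs' => simp only [map_add, LinearMap.add_apply, hs, hs']
  | tmul a b =>
  induction t with
  | zero => simp
  | add s s' hs hs' => simp only [map_add, LinearMap.add_apply, hs, hs']
  | tmul c d =>
  induction u with
  | zero => simp
  | add s s' hs hs' => simp only [map_add, hs, hs']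
  | tmul e f =>
  rw [crossMul_tmul, crossMul_tmul, LinearMap.id_apply, LinearMap.id_apply]
  have e1 : ∀ z : M ⊗[k] B, crossMul mM mB LinearMap.id Θ (outerMul mM mB (a ⊗ₜ d) z) (e ⊗ₜ f) =
      TensorProduct.map (mM a) (mB.flip f) (crossMul mM mB LinearMap.id Θ z (Θ (e ⊗ₜ d))) :=
    fun z => by
      induction z with
      | zero => simp
      | add s s' hs hs' => simp only [map_add, LinearMap.add_apply, hs, hs']
      | tmul p q =>
      have h3 := h₂ e d q
      rw [LinearMap.flip_apply] at h3
      rw [TensorProduct.map₂_apply_tmul, TensorProduct.map_tmul, LinearMap.flip_apply, crossMul_tmul, h3]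
      generalize Θ (e ⊗ₜ d) = z
      induction z with
      | zero => simp
      | add s s' hs hs' => simp only [map_add, hs, hs']
      | tmul r s =>
      rw [crossMul_tmul, LinearMap.rTensor_tmul, LinearMap.flip_apply, TensorProduct.curry_apply]
      generalize Θ (r ⊗ₜ q) = z
      induction z with
      | zero => simp
      | add s s' hs hs' => simp only [map_add, TensorProduct.add_tmul, hs, hs']
      | tmul x y =>
        change mM (mM a p) x ⊗ₜ[k] mB (mB y s) f = mM a (mM p x) ⊗ₜ[k] mB (mB y s) f
        rw [hM]
  have e2 : ∀ z : M ⊗[k] B, crossMul mM mB LinearMap.id Θ (a ⊗ₜ b) (outerMul mM mB (c ⊗ₜ f) z) =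
      TensorProduct.map (mM a) (mB.flip f) (crossMul mM mB LinearMap.id Θ (Θ (c ⊗ₜ b)) z) :=
    fun z => by
      induction z with
      | zero => simp
      | add s s' hs hs' => simp only [map_add, hs, hs']
      | tmul r s =>
      rw [TensorProduct.map₂_apply_tmul, TensorProduct.map_tmul, LinearMap.flip_apply, crossMul_tmul, h₁]
      generalize Θ (c ⊗ₜ b) = z
      induction z with
      | zero => simp
      | add s s' hs hs' => simp only [map_add, LinearMap.add_apply, hs, hs']
      | tmul p q =>
      rw [crossMul_tmul, LinearMap.lTensor_tmul, TensorProduct.curry_apply]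
      generalize Θ (r ⊗ₜ q) = z
      induction z with
      | zero => simp
      | add s s' hs hs' => simp only [map_add, TensorProduct.tmul_add, hs, hs']
      | tmul x y =>
        change mM a (mM p x) ⊗ₜ[k] mB y (mB s f) = mM a (mM p x) ⊗ₜ[k] mB (mB y s) f
        rw [hB]
  rw [e1, e2]

/-- `Φ` intertwines the two products if `Ψ = Φ Θ`: apply `Φ` to `a c' ⊗ b' d`, where
`Θ (c ⊗ b) = c' ⊗ b'`, by the multiplicativity of `Φ`, and move the factors `Φ` that act on `b` and
on `c` past `Ψ`. -/
theorem map_crossMul (h₁ : IsMulLeft mM.flip Φ) (h₂ : IsMulRight mB Φ)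
    (hΘ : ∀ t, Φ (Θ t) = Ψ t) (hl : LegsCommute Ψ Φ) (hc : CoLegsCommute Φ Ψ) (s t : M ⊗[k] B) :
    Φ (crossMul mM mB LinearMap.id Θ s t) = crossMul mM mB Φ Ψ (Φ s) (Φ t) := by
  induction s with
  | zero => simp
  | add s s' hs hs' => simp only [map_add, LinearMap.add_apply, hs, hs']
  | tmul a b =>
  induction t with
  | zero => simp
  | add s s' hs hs' => simp only [map_add, hs, hs']
  | tmul c d =>
  -- `E (a ⊗ ((c ⊗ b) ⊗ d)) = a' c ⊗ b d'` for `Φ (a ⊗ d) = a' ⊗ d'`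
  let E : M ⊗[k] ((M ⊗[k] B) ⊗[k] B) →ₗ[k] M ⊗[k] B :=
    TensorProduct.lift (outerMul mM mB).flip ∘ₗ Φ.lTensor (M ⊗[k] B) ∘ₗ
      (TensorProduct.leftComm k M (M ⊗[k] B) B).toLinearMap
  let Z : M ⊗[k] B →ₗ[k] (M ⊗[k] B) ⊗[k] B := (TensorProduct.rightComm k M B B).toLinearMap ∘ₗ
    ((TensorProduct.curry Φ).flip d).rTensor B
  have hE : ∀ a t d, E (a ⊗ₜ (t ⊗ₜ d)) = outerMul mM mB (Φ (a ⊗ₜ d)) t := fun _ _ _ => rfl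
  have e1 : ∀ z : M ⊗[k] B, Φ (outerMul mM mB (a ⊗ₜ d) z) = E (Z.lTensor M
      (TensorProduct.leftComm k M M B ((TensorProduct.curry Φ a).lTensor M (Φ z)))) := fun z => by
    induction z with
    | zero => simp
    | add s s' hs hs' => simp only [map_add, hs, hs']
    | tmul p q =>
    have h3 := h₁ p a q
    rw [LinearMap.flip_apply] at h3
    rw [TensorProduct.map₂_apply_tmul, TensorProduct.map_tmul, LinearMap.flip_apply, h₂, h3]
    generalize Φ (p ⊗ₜ q) = z
    induction z with
    | zero => simp
    | add s s' hs hs' => simp only [map_add, hs, hs']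
    | tmul c b =>
    rw [LinearMap.lTensor_tmul, TensorProduct.curry_apply]
    generalize Φ (a ⊗ₜ b) = z
    induction z with
    | zero => simp
    | add s s' hs hs' => simp only [map_add, TensorProduct.tmul_add, hs, hs']
    | tmul a b =>
    have h4 := h₁ c a d
    rw [LinearMap.flip_apply] at h4
    rw [TensorProduct.assoc_symm_tmul, LinearMap.rTensor_tmul, TensorProduct.lift.tmul,
      LinearMap.flip_apply, LinearMap.rTensor_tmul, LinearMap.flip_apply, TensorProduct.curry_apply,
      h4]
    change _ = E (a ⊗ₜ[k] (TensorProduct.rightComm k M B B (Φ (c ⊗ₜ d) ⊗ₜ[k] b)))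
    generalize Φ (c ⊗ₜ d) = z
    induction z with
    | zero => simp
    | add s s' hs hs' => simp only [map_add, TensorProduct.tmul_add, TensorProduct.add_tmul, hs, hs']
    | tmul c d =>
    rw [TensorProduct.rightComm_tmul, hE, LinearMap.lTensor_tmul, TensorProduct.curry_apply]
    generalize Φ (a ⊗ₜ d) = z
    induction z with
    | zero => simp
    | add s s' hs hs' =>
      simp only [map_add, TensorProduct.tmul_add, TensorProduct.add_tmul, LinearMap.add_apply,
        hs, hs']
    | tmul a d => rfl
  rw [crossMul_tmul, LinearMap.id_apply, e1, hΘ, hl]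
  generalize Φ (a ⊗ₜ b) = z
  induction z with
  | zero => simp
  | add s s' hs hs' => simp only [map_add, LinearMap.add_apply, hs, hs']
  | tmul a b =>
  have e2 : Z (Ψ (c ⊗ₜ b)) = _ := hc c b d
  rw [LinearMap.lTensor_tmul, LinearMap.lTensor_tmul, TensorProduct.curry_apply, e2]
  generalize Φ (c ⊗ₜ d) = z
  induction z with
  | zero => simp
  | add s s' hs hs' => simp only [map_add, TensorProduct.tmul_add, hs, hs']
  | tmul c d =>
  rw [LinearMap.rTensor_tmul, hE, crossMul_tmul]
  rfl

end Cross

section Transport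

variable {k : Type u} [Field k] {V : Type v} [AddCommGroup V] [Module k V]
variable {W : Type w} [AddCommGroup W] [Module k W]
variable {μ : V →ₗ[k] V →ₗ[k] V} {ν : W →ₗ[k] W →ₗ[k] W}

theorem AreIsomorphic.isAssocMul (h : AreIsomorphic μ ν) (hμ : IsAssocMul μ) : IsAssocMul ν := by
  obtain ⟨φ, h⟩ := h
  intro a b c
  obtain ⟨a, rfl⟩ := φ.surjective a
  obtain ⟨b, rfl⟩ := φ.surjective b
  obtain ⟨c, rfl⟩ := φ.surjective c
  rw [← h, ← h, ← h, ← h, hμ]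

theorem AreIsomorphic.symm (h : AreIsomorphic μ ν) : AreIsomorphic ν μ := by
  obtain ⟨φ, h⟩ := h
  exact ⟨φ.symm, fun a b => by rw [φ.symm_apply_eq, h]; simp⟩

theorem AreIsomorphic.trans {W' : Type w'} [AddCommGroup W'] [Module k W']
    {ν' : W' →ₗ[k] W' →ₗ[k] W'} (h : AreIsomorphic μ ν) (h' : AreIsomorphic ν ν') :
    AreIsomorphic μ ν' := by
  obtain ⟨φ, h⟩ := h
  obtain ⟨ψ, h'⟩ := h'
  exact ⟨φ ≪≫ₗ ψ, fun a b => by simp [h, h']⟩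

theorem AreIsomorphic.flip (h : AreIsomorphic μ ν) : AreIsomorphic μ.flip ν.flip := by
  obtain ⟨φ, h⟩ := h
  exact ⟨φ, fun a b => h b a⟩

theorem IsAssocMul.flip (h : IsAssocMul μ) : IsAssocMul μ.flip := fun a b c => (h c b a).symm

/-- The transport of a product along a linear isomorphism. -/
def transport (e : V ≃ₗ[k] W) (μ : V →ₗ[k] V →ₗ[k] V) : W →ₗ[k] W →ₗ[k] W :=
  (μ.compl₁₂ e.symm.toLinearMap e.symm.toLinearMap).compr₂ e.toLinearMap

theorem areIsomorphic_transport (e : V ≃ₗ[k] W) (μ : V →ₗ[k] V →ₗ[k] V) :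
    AreIsomorphic μ (transport e μ) :=
  ⟨e, fun a b => by simp [transport]⟩

end Transport

/-! ### Change of the acting algebra -/

section Conj

variable {k : Type u} [Field k]
variable {H : Type v} [NonUnitalRing H] [Module k H] [IsScalarTower k H H] [SMulCommClass k H H]
variable {V : Type w} [AddCommGroup V] [Module k V]
variable {ρ ρ' : H ⊗[k] V →ₗ[k] H ⊗[k] V}

/-- If `ρ` and `ρ'` are the operators of `v ↦ v₍₋₁₎ ⊗ v₀`, then `S⁻¹ ρ' S` and `S⁻¹ ρ S` are those of
`v ↦ S⁻¹(v₍₋₁₎) ⊗ v₀`. -/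
theorem IsCompatible.antipode_symm (h : IsCompatible ρ ρ') {S : H ≃ₗ[k] H}
    (hS : ∀ x y, S (x * y) = S y * S x) :
    IsCompatible ((antipodeLeft S V).symm.conj ρ') ((antipodeLeft S V).symm.conj ρ) := fun e x v => by
  apply (antipodeLeft S V).injective
  rw [antipodeLeft_mulLeft hS, antipodeLeft_mulRight hS, LinearEquiv.conj_apply_apply,
    LinearEquiv.conj_apply_apply, LinearEquiv.apply_symm_apply, LinearEquiv.apply_symm_apply]
  exact (h (S x) (S e) v).symm

theorem IsCompatible.op (h : IsCompatible ρ ρ') :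
    IsCompatible ((opLeft k H V).conj ρ') ((opLeft k H V).conj ρ) := fun e x v => by
  obtain ⟨e, rfl⟩ := MulOpposite.op_surjective e
  obtain ⟨x, rfl⟩ := MulOpposite.op_surjective x
  have h1 := congrArg (opLeft k H V) (h x e v)
  rw [opLeft_mulLeft, opLeft_mulRight] at h1
  exact h1.symm

theorem IsCompatible.map_lTensor (h : IsCompatible ρ ρ') (hH : IsNondegenerate H) {f : V →ₗ[k] V}
    (hf : ∀ x v, ρ (x ⊗ₜ f v) = f.lTensor H (ρ (x ⊗ₜ v))) (x : H) (v : V) :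
    ρ' (x ⊗ₜ f v) = f.lTensor H (ρ' (x ⊗ₜ v)) := by
  refine eq_of_mulRight_rTensor hH fun e => ?_
  rw [← h, hf, rTensor_lTensor_comm, rTensor_lTensor_comm, h]

variable {H' : Type v'} [AddCommGroup H'] [Module k H']

theorem conj_lTensor (e : H ≃ₗ[k] H') {f : V →ₗ[k] V}
    (hf : ∀ x v, ρ (x ⊗ₜ f v) = f.lTensor H (ρ (x ⊗ₜ v))) (x : H') (v : V) :
    (TensorProduct.congr e (LinearEquiv.refl k V)).conj ρ (x ⊗ₜ f v) =
      f.lTensor H' ((TensorProduct.congr e (LinearEquiv.refl k V)).conj ρ (x ⊗ₜ v)) := by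
  have h1 := hf (e.symm x) v
  change TensorProduct.congr e (LinearEquiv.refl k V) (ρ (e.symm x ⊗ₜ f v)) =
    f.lTensor H' (TensorProduct.congr e (LinearEquiv.refl k V) (ρ (e.symm x ⊗ₜ v)))
  rw [h1]
  generalize ρ (e.symm x ⊗ₜ v) = t
  induction t with
  | zero => simp
  | add s s' hs hs' => simp only [map_add, hs, hs']
  | tmul a b => rfl

theorem LegsCommute.conj {K : Type w'} [AddCommGroup K] [Module k K]
    {τ : K ⊗[k] V →ₗ[k] K ⊗[k] V} (h : LegsCommute ρ τ) (e : H ≃ₗ[k] H') :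
    LegsCommute ((TensorProduct.congr e (LinearEquiv.refl k V)).conj ρ) τ := fun x y v => by
  have h1 := congrArg ((TensorProduct.congr e (LinearEquiv.refl k V)).toLinearMap.lTensor K)
    (h (e.symm x) y v)
  have e1 : ∀ t : H ⊗[k] V, TensorProduct.leftComm k H' K V ((TensorProduct.curry τ y).lTensor H'
      (TensorProduct.congr e (LinearEquiv.refl k V) t)) =
        (TensorProduct.congr e (LinearEquiv.refl k V)).toLinearMap.lTensor K
          (TensorProduct.leftComm k H K V ((TensorProduct.curry τ y).lTensor H t)) := fun t => by
    induction t with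
    | zero => simp
    | add s s' hs hs' => simp only [map_add, hs, hs']
    | tmul a b =>
      rw [TensorProduct.congr_tmul, LinearMap.lTensor_tmul, LinearMap.lTensor_tmul,
        LinearEquiv.refl_apply]
      generalize TensorProduct.curry τ y b = u
      induction u with
      | zero => simp
      | add s s' hs hs' => simp only [map_add, TensorProduct.tmul_add, hs, hs']
      | tmul c d => rfl
  rw [← LinearMap.lTensor_comp_apply] at h1
  exact (e1 _).trans h1

theorem IsMultiplicative.conj {A : Type w} [NonUnitalRing A] [Module k A] [IsScalarTower k A A]
    [SMulCommClass k A A] {ρ : H ⊗[k] A →ₗ[k] H ⊗[k] A} (h : IsMultiplicative ρ) (e : H ≃ₗ[k] H') :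
    IsMultiplicative ((TensorProduct.congr e (LinearEquiv.refl k A)).conj ρ) := fun x a b => by
  have h1 := congrArg (TensorProduct.congr e (LinearEquiv.refl k A)) (h (e.symm x) a b)
  refine Eq.trans h1 ?_
  change _ = twistMul _ ((TensorProduct.mk k A A a).lTensor H'
    (TensorProduct.congr e (LinearEquiv.refl k A) (ρ (e.symm x ⊗ₜ b))))
  generalize ρ (e.symm x ⊗ₜ b) = t
  induction t with
  | zero => simp
  | add s s' hs hs' => simp only [map_add, hs, hs']
  | tmul c d =>
    rw [LinearMap.lTensor_tmul, TensorProduct.congr_tmul, LinearMap.lTensor_tmul,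
      TensorProduct.mk_apply, TensorProduct.mk_apply, twistMul_tmul, LinearEquiv.refl_apply,
      twistMul_tmul, LinearEquiv.conj_apply_apply, TensorProduct.congr_symm_tmul,
      LinearEquiv.symm_apply_apply]
    change _ = (mulRight k d).lTensor H' (TensorProduct.congr e (LinearEquiv.refl k A)
      (ρ (c ⊗ₜ a)))
    generalize ρ (c ⊗ₜ a) = u
    induction u with
    | zero => simp
    | add s s' hs hs' => simp only [map_add, hs, hs']
    | tmul i j => rfl

/-- The other covered form of a multiplicative coaction: `x (ab)₍₋₁₎ ⊗ (ab)₀` is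
`x a₍₋₁₎ b₍₋₁₎ ⊗ a₀ b₀`. -/
theorem IsMultiplicative.isMulRight {A : Type w} [NonUnitalRing A] [Module k A]
    [IsScalarTower k A A] [SMulCommClass k A A] {ρ ρ' : H ⊗[k] A →ₗ[k] H ⊗[k] A}
    (h : IsMultiplicative ρ) (hρ : IsCompatible ρ ρ') (hH : IsNondegenerate H) :
    IsMulRight (LinearMap.mul k A) ρ' := fun x a b => by
  refine eq_of_mulRight_rTensor hH fun e => ?_
  -- both sides are `ρ' (x ⊗ a) * ρ (e ⊗ b)`
  have e1 : ∀ t : H ⊗[k] A, (mulRight k e).rTensor A ((TensorProduct.lift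
      (LinearMap.mul k A).flip).lTensor H (TensorProduct.assoc k H A A
        (((TensorProduct.curry ρ').flip b).rTensor A t))) = t * ρ (e ⊗ₜ b) := fun t => by
    induction t with
    | zero => simp
    | add s s' hs hs' => simp only [map_add, add_mul, hs, hs']
    | tmul q c =>
      have h1 : ∀ u : H ⊗[k] A, (mulRight k e).rTensor A ((TensorProduct.lift
          (LinearMap.mul k A).flip).lTensor H (TensorProduct.assoc k H A A (u ⊗ₜ c))) =
          (mulLeft k c).lTensor H ((mulRight k e).rTensor A u) := fun u => by
        induction u with
        | zero => simp
        | add s s' hs hs' => simp only [map_add, TensorProduct.add_tmul, hs, hs']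
        | tmul i j => rfl
      rw [LinearMap.rTensor_tmul, h1, LinearMap.flip_apply, TensorProduct.curry_apply, ← hρ]
      generalize ρ (e ⊗ₜ b) = u
      induction u with
      | zero => simp
      | add s s' hs hs' => simp only [map_add, mul_add, hs, hs']
      | tmul i j => exact (Algebra.TensorProduct.tmul_mul_tmul (R := k) q i c j).symm
  have e2 : ∀ u : H ⊗[k] A, (mulLeft k x).rTensor A (twistMul ρ
      ((TensorProduct.mk k A A a).lTensor H u)) = ρ' (x ⊗ₜ a) * u := fun u => by
    induction u with
    | zero => simp
    | add s s' hs hs' => simp only [map_add, mul_add, hs, hs']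
    | tmul r d =>
      rw [LinearMap.lTensor_tmul, TensorProduct.mk_apply, twistMul_tmul, rTensor_lTensor_comm, hρ]
      generalize ρ' (x ⊗ₜ a) = u
      induction u with
      | zero => simp
      | add s s' hs hs' => simp only [map_add, add_mul, hs, hs']
      | tmul i j => exact (Algebra.TensorProduct.tmul_mul_tmul (R := k) i r j d).symm
  rw [e1, LinearMap.mul_apply', ← hρ, h, e2]

end Conj

/-! ### The contraction of a coaction with an action -/

section Contraction

variable {k : Type u} [Field k]
variable {H : Type v} [NonUnitalRing H] [Module k H] [IsScalarTower k H H] [SMulCommClass k H H]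
variable {M : Type w} [AddCommGroup M] [Module k M] {act : H →ₗ[k] M →ₗ[k] M}
variable {τ τ' : H ⊗[k] M →ₗ[k] H ⊗[k] M} {α β : M →ₗ[k] M}

/-- `α` is the map `a ↦ a₍₋₁₎ ▷ a₀`, in covered form `x ▷ a ↦ (a₍₋₁₎ x) ▷ a₀`, where
`τ : x ⊗ a ↦ a₍₋₁₎ x ⊗ a₀`. -/
def IsContraction (act : H →ₗ[k] M →ₗ[k] M) (τ : H ⊗[k] M →ₗ[k] H ⊗[k] M) (α : M →ₗ[k] M) : Prop :=
  ∀ t, α (TensorProduct.lift act t) = TensorProduct.lift act (τ t)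

/-- The contraction exists if the action and the coaction commute: with `e` a local unit,
`∑ (a₍₋₁₎ x) ▷ a₀ = ∑ (e a₍₋₁₎) ▷ (x ▷ a₀)` depends on `x ▷ a` only. -/
theorem exists_isContraction (h : IsUnitalAction act) (hτ : IsCompatible τ τ')
    (hl : ∀ x y a, τ' (x ⊗ₜ act y a) = (act y).lTensor H (τ' (x ⊗ₜ a))) :
    ∃ α, IsContraction act τ α := by
  obtain ⟨s, hs⟩ := LinearMap.exists_rightInverse_of_surjective (TensorProduct.lift act)
    (LinearMap.range_eq_top.2 h.surjective)
  have h1 : ∀ e t, act e (TensorProduct.lift act t) =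
      TensorProduct.lift act ((mulLeft k e).rTensor M t) := fun e t => by
    induction t with
    | zero => simp
    | add s s' hs hs' => simp only [map_add, hs, hs']
    | tmul x a => exact (h.act_mul e x a).symm
  have h2 : ∀ x t, TensorProduct.lift act ((mulRight k x).rTensor M t) =
      TensorProduct.lift act ((act x).lTensor H t) := fun x t => by
    induction t with
    | zero => simp
    | add s s' hs hs' => simp only [map_add, hs, hs']
    | tmul y a => exact h.act_mul y x a
  have h3 : ∀ e t, act e (TensorProduct.lift act (τ t)) =
      TensorProduct.lift act (τ' (e ⊗ₜ TensorProduct.lift act t)) := fun e t => by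
    induction t with
    | zero => simp
    | add s s' hs hs' => simp only [map_add, TensorProduct.tmul_add, hs, hs']
    | tmul x a => rw [h1, hτ, h2, TensorProduct.lift.tmul, hl]
  have h4 : ∀ t, TensorProduct.lift act t = 0 → TensorProduct.lift act (τ t) = 0 := fun t ht => by
    obtain ⟨e, he⟩ := h.unital (TensorProduct.lift act (τ t))
    rw [← he, h3, ht, TensorProduct.tmul_zero, map_zero, map_zero]
  refine ⟨TensorProduct.lift act ∘ₗ τ ∘ₗ s, fun t => ?_⟩
  rw [← sub_eq_zero, LinearMap.comp_apply, LinearMap.comp_apply, ← map_sub, ← map_sub]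
  refine h4 _ ?_
  rw [map_sub, sub_eq_zero]
  exact LinearMap.congr_fun hs _

theorem IsContraction.comp_eq (h : IsUnitalAction act) (hα : IsContraction act τ α)
    (hβ : IsContraction act τ' β) (h1 : ∀ t, τ (τ' t) = t) (a : M) : α (β a) = a := by
  obtain ⟨t, rfl⟩ := h.surjective a
  rw [hβ, hα, h1]

theorem IsContraction.map (h : IsUnitalAction act) (hα : IsContraction act τ α) {f : M →ₗ[k] M}
    (hf : ∀ x a, f (act x a) = act x (f a))
    (hl : ∀ x a, τ (x ⊗ₜ f a) = f.lTensor H (τ (x ⊗ₜ a))) (a : M) : α (f a) = f (α a) := by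
  have h1 : ∀ t, f (TensorProduct.lift act t) = TensorProduct.lift act (f.lTensor H t) := fun t => by
    induction t with
    | zero => simp
    | add s s' hs hs' => simp only [map_add, hs, hs']
    | tmul x a => exact hf x a
  obtain ⟨t, rfl⟩ := h.surjective a
  rw [h1, hα, hα, h1]
  induction t with
  | zero => simp
  | add s s' hs hs' => simp only [map_add, hs, hs']
  | tmul x a => rw [LinearMap.lTensor_tmul, hl]

/-- The contraction is colinear for a coaction that commutes with the action and the coaction that
are contracted. -/
theorem IsContraction.map_lTensor (h : IsUnitalAction act) (hα : IsContraction act τ α)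
    {K : Type v'} [AddCommGroup K] [Module k K] {ρ : K ⊗[k] M →ₗ[k] K ⊗[k] M}
    (hρ : ∀ x y a, ρ (x ⊗ₜ act y a) = (act y).lTensor K (ρ (x ⊗ₜ a))) (hc : LegsCommute ρ τ)
    (x : K) (a : M) : ρ (x ⊗ₜ α a) = α.lTensor K (ρ (x ⊗ₜ a)) := by
  have h1 : ∀ t : H ⊗[k] M, ρ (x ⊗ₜ TensorProduct.lift act t) =
      (TensorProduct.lift act).lTensor K (TensorProduct.leftComm k H K M
        ((TensorProduct.curry ρ x).lTensor H t)) := fun t => by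
    induction t with
    | zero => simp
    | add s s' hs hs' => simp only [map_add, TensorProduct.tmul_add, hs, hs']
    | tmul y a =>
      rw [TensorProduct.lift.tmul, hρ, LinearMap.lTensor_tmul, TensorProduct.curry_apply]
      generalize ρ (x ⊗ₜ a) = u
      induction u with
      | zero => simp
      | add s s' hs hs' => simp only [map_add, TensorProduct.tmul_add, hs, hs']
      | tmul i j => rfl
  obtain ⟨t, rfl⟩ := h.surjective a
  rw [hα, h1]
  induction t with
  | zero => simp
  | add s s' hs hs' => simp only [map_add, TensorProduct.tmul_add, hs, hs']
  | tmul y a =>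
    rw [hc.symm y x a, TensorProduct.lift.tmul, hρ]
    generalize ρ (x ⊗ₜ a) = u
    induction u with
    | zero => simp
    | add s s' hs hs' => simp only [map_add, hs, hs']
    | tmul i j => exact congrArg (i ⊗ₜ[k] ·) (hα (y ⊗ₜ j)).symm

end Contraction

/-! ### The twisted product of a Long module algebra -/

section TwistedProduct

variable {k : Type u} [Field k]
variable {H : Type v} [NonUnitalRing H] [Module k H] [IsScalarTower k H H] [SMulCommClass k H H]
variable {A : Type w} [NonUnitalRing A] [Module k A] [IsScalarTower k A A] [SMulCommClass k A A]
variable {act : H →ₗ[k] A →ₗ[k] A} {τ : H ⊗[k] A →ₗ[k] H ⊗[k] A} {Λ : A ⊗[k] A →ₗ[k] A ⊗[k] A}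

/-- The product `a • b = a₀ b'`, where `Λ (b ⊗ a) = b' ⊗ a₀`. -/
def twistedMul (Λ : A ⊗[k] A →ₗ[k] A ⊗[k] A) : A →ₗ[k] A →ₗ[k] A :=
  (TensorProduct.curry (TensorProduct.lift (LinearMap.mul k A).flip ∘ₗ Λ)).flip

theorem twistedMul_apply (a b : A) :
    twistedMul Λ a b = TensorProduct.lift (LinearMap.mul k A).flip (Λ (b ⊗ₜ a)) := rfl

/-- If action and coaction commute, the twisting maps in the legs `1, 2` and in the legs `2, 3` of
`A ⊗ A ⊗ A` commute. -/
theorem IsTwist.adjacent_commute (h : IsUnitalAction act) (hΛ : IsTwist act τ Λ)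
    (hl : ∀ x y a, τ (x ⊗ₜ act y a) = (act y).lTensor H (τ (x ⊗ₜ a))) (a b c : A) :
    TensorProduct.assoc k A A A ((TensorProduct.curry Λ c).rTensor A (Λ (b ⊗ₜ a))) =
      ((TensorProduct.curry Λ).flip a).lTensor A (Λ (c ⊗ₜ b)) := by
  obtain ⟨y, hy⟩ := h.unital b
  have h1 : ∀ u t, Λ ((act u).lTensor A t) = (act u).lTensor A (Λ t) := fun u =>
    hΛ.map_lTensor h.unital (fun x b => hl x u b)
  have h2 := hΛ y b a
  have h3 : Λ (c ⊗ₜ b) = (act y).lTensor A (Λ (c ⊗ₜ b)) := by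
    rw [← h1, LinearMap.lTensor_tmul, hy]
  rw [hy] at h2
  rw [h2, h3]
  have h4 : ∀ t : A ⊗[k] A, ((TensorProduct.curry Λ).flip a).lTensor A ((act y).lTensor A t) =
      ((LinearMap.rTensorHom A ∘ₗ act.flip).flip (τ (y ⊗ₜ a))).lTensor A t := fun t => by
    induction t with
    | zero => simp
    | add s s' hs hs' => simp only [map_add, hs, hs']
    | tmul i j => exact congrArg (i ⊗ₜ[k] ·) (hΛ y j a)
  rw [h4]
  generalize τ (y ⊗ₜ a) = t
  induction t with
  | zero => simp
  | add s s' hs hs' =>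
    simp only [map_add, hs, hs', LinearMap.lTensor_add, LinearMap.add_apply]
  | tmul u d =>
    have h5 : Λ (c ⊗ₜ act u b) = (act u).lTensor A (Λ (c ⊗ₜ b)) := h1 u (c ⊗ₜ b)
    rw [LinearMap.rTensor_tmul, LinearMap.rTensor_tmul, LinearMap.flip_apply,
      TensorProduct.curry_apply, h5]
    generalize Λ (c ⊗ₜ b) = t
    induction t with
    | zero => simp
    | add s s' hs hs' => simp only [map_add, TensorProduct.add_tmul, hs, hs']
    | tmul i j => rfl

theorem isAssocMul_twistedMul (h₁ : IsMulLeft (LinearMap.mul k A) Λ)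
    (h₂ : IsMulRight (LinearMap.mul k A).flip Λ)
    (h₃ : ∀ a b c, TensorProduct.assoc k A A A ((TensorProduct.curry Λ c).rTensor A (Λ (b ⊗ₜ a))) =
      ((TensorProduct.curry Λ).flip a).lTensor A (Λ (c ⊗ₜ b))) :
    IsAssocMul (twistedMul Λ) := fun a b c => by
  -- `c ⊗ (b ⊗ a) ↦ a₀ (b c')` for `Λ (c ⊗ a) = c' ⊗ a₀`
  let F : A ⊗[k] (A ⊗[k] A) →ₗ[k] A := TensorProduct.lift (LinearMap.mul k A).flip ∘ₗ
    (LinearMap.mul' k A).rTensor A ∘ₗ (TensorProduct.assoc k A A A).symm.toLinearMap ∘ₗ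
    Λ.lTensor A ∘ₗ (TensorProduct.leftComm k A A A).toLinearMap
  have hF : ∀ a b c, F (c ⊗ₜ (b ⊗ₜ a)) =
      TensorProduct.lift ((LinearMap.mul k A).flip ∘ₗ LinearMap.mul k A b) (Λ (c ⊗ₜ a)) :=
    fun a b c => by
      change TensorProduct.lift (LinearMap.mul k A).flip ((LinearMap.mul' k A).rTensor A
        ((TensorProduct.assoc k A A A).symm (b ⊗ₜ Λ (c ⊗ₜ a)))) = _
      generalize Λ (c ⊗ₜ a) = t
      induction t with
      | zero => simp
      | add s s' hs hs' => simp only [map_add, TensorProduct.tmul_add, hs, hs']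
      | tmul c a => rfl
  have e1 : ∀ t : A ⊗[k] A, twistedMul Λ (TensorProduct.lift (LinearMap.mul k A).flip t) c =
      F (TensorProduct.assoc k A A A ((TensorProduct.curry Λ c).rTensor A t)) := fun t => by
    induction t with
    | zero => simp
    | add s s' hs hs' => simp only [map_add, LinearMap.add_apply, hs, hs']
    | tmul i j =>
      have h4 := h₂ c i j
      rw [LinearMap.flip_apply, LinearMap.mul_apply'] at h4
      rw [twistedMul_apply, TensorProduct.lift.tmul, LinearMap.flip_apply, LinearMap.mul_apply', h4,
        LinearMap.rTensor_tmul, TensorProduct.curry_apply]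
      generalize Λ (c ⊗ₜ i) = t
      induction t with
      | zero => simp
      | add s s' hs hs' => simp only [map_add, TensorProduct.add_tmul, hs, hs']
      | tmul c b =>
        rw [LinearMap.rTensor_tmul, TensorProduct.assoc_tmul, hF, LinearMap.flip_apply,
          TensorProduct.curry_apply]
        generalize Λ (c ⊗ₜ j) = t
        induction t with
        | zero => simp
        | add s s' hs hs' => simp only [map_add, TensorProduct.add_tmul, hs, hs']
        | tmul c a => exact mul_assoc a b c
  have e2 : ∀ t : A ⊗[k] A, twistedMul Λ a (TensorProduct.lift (LinearMap.mul k A).flip t) =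
      F (((TensorProduct.curry Λ).flip a).lTensor A t) := fun t => by
    induction t with
    | zero => simp
    | add s s' hs hs' => simp only [map_add, hs, hs']
    | tmul i j =>
      have h4 := h₁ j i a
      rw [LinearMap.mul_apply'] at h4
      rw [twistedMul_apply, TensorProduct.lift.tmul, LinearMap.flip_apply, LinearMap.mul_apply', h4,
        LinearMap.lTensor_tmul, LinearMap.flip_apply, TensorProduct.curry_apply]
      generalize Λ (j ⊗ₜ a) = t
      induction t with
      | zero => simp
      | add s s' hs hs' => simp only [map_add, TensorProduct.tmul_add, hs, hs']
      | tmul b a =>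
        rw [LinearMap.lTensor_tmul, hF, TensorProduct.curry_apply]
        generalize Λ (i ⊗ₜ a) = t
        induction t with
        | zero => simp
        | add s s' hs hs' => simp only [map_add, TensorProduct.tmul_add, hs, hs']
        | tmul c a => rfl
  rw [twistedMul_apply a b, twistedMul_apply b c, e1, e2, h₃]

end TwistedProduct

/-! ### The contraction is multiplicative up to the twisting map -/

section RightContraction

variable {k : Type u} [Field k]
variable {H : Type v} [NonUnitalRing H] [Module k H] [IsScalarTower k H H] [SMulCommClass k H H]

theorem isTwist_opAction {M : Type w} [AddCommGroup M] [Module k M] {B : Type w'} [AddCommGroup B]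
    [Module k B] {ract : H →ₗ[k] M →ₗ[k] M} {ρ : H ⊗[k] B →ₗ[k] H ⊗[k] B}
    {Φ : M ⊗[k] B →ₗ[k] M ⊗[k] B} (h : IsTwist (opAction ract) ((opLeft k H B).conj ρ) Φ) :
    IsTwist ract ρ Φ := fun x m b => by
  refine (h (MulOpposite.op x) m b).trans ?_
  change ((opAction ract).flip m).rTensor B (opLeft k H B (ρ (x ⊗ₜ b))) = _
  generalize ρ (x ⊗ₜ b) = t
  induction t with
  | zero => simp
  | add s s' hs hs' => simp only [map_add, hs, hs']
  | tmul i j => rfl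

theorem isContraction_opAction {M : Type w} [AddCommGroup M] [Module k M]
    {ract : H →ₗ[k] M →ₗ[k] M} {ρ : H ⊗[k] M →ₗ[k] H ⊗[k] M}
    {α : M →ₗ[k] M} (h : IsContraction (opAction ract) ((opLeft k H M).conj ρ) α) :
    IsContraction ract ρ α := fun t => by
  have e : ∀ t : H ⊗[k] M, TensorProduct.lift (opAction ract) (opLeft k H M t) =
      TensorProduct.lift ract t := fun t => by
    induction t with
    | zero => simp
    | add s s' hs hs' => simp only [map_add, hs, hs']
    | tmul i j => rfl
  rw [← e, h, LinearEquiv.conj_apply_apply, LinearEquiv.symm_apply_apply, e]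

variable {A : Type w} [NonUnitalRing A] [Module k A] [IsScalarTower k A A] [SMulCommClass k A A]
variable {Δ : H →ₗ[k] Multiplier k (H ⊗[k] H)} {ract : H →ₗ[k] A →ₗ[k] A}
  {ρ ρ' : H ⊗[k] A →ₗ[k] H ⊗[k] A} {Φ : A ⊗[k] A →ₗ[k] A ⊗[k] A} {α : A →ₗ[k] A}

/-- For the contraction `α : a ↦ a₀ ◁ a₍₁₎` of a right action and a right coaction, and the twisting
map `Φ : m ⊗ b ↦ m ◁ b₍₁₎ ⊗ b₀`, the product `α (a b)` is `(a₀ ◁ a₍₁₎ b₍₁₎)(b₀ ◁ a₍₂₎ b₍₂₎)`. It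
suffices to consider `a = c ◁ s` and `b = d ◁ t`, for all `t ⊗ s = ∑ x y₂ ⊗ y₁` at once; then
`a b = (c (d ◁ x)) ◁ y`. -/
theorem IsContraction.map_mul (hΔ : IsRegularMultiplierHopf Δ) (h : IsRightModuleAlgebra Δ ract)
    (hρ : IsCoaction (flipComul Δ) ρ ρ') (hm : IsMulRight (LinearMap.mul k A) ρ')
    (hl : ∀ x y a, ρ' (x ⊗ₜ ract y a) = (ract y).lTensor H (ρ' (x ⊗ₜ a)))
    (hΦ : IsTwist ract ρ' Φ) (hΦl : ∀ y t, Φ ((ract y).lTensor A t) = (ract y).lTensor A (Φ t))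
    (hα : IsContraction ract ρ' α) (t : A ⊗[k] A) :
    α (LinearMap.mul' k A t) = LinearMap.mul' k A (Φ (TensorProduct.map α α
      (TensorProduct.comm k A A (Φ (TensorProduct.comm k A A t))))) := by
  have hα' : ∀ x a, α (ract x a) = TensorProduct.lift ract (ρ' (x ⊗ₜ a)) := fun x a =>
    hα (x ⊗ₜ a)
  -- `c ⊗ ((w ⊗ u) ⊗ d) ↦ (c ◁ u)(d ◁ w)`
  let V : A ⊗[k] ((H ⊗[k] H) ⊗[k] A) →ₗ[k] A := LinearMap.mul' k A ∘ₗ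
    TensorProduct.map (TensorProduct.lift ract.flip) (TensorProduct.lift ract) ∘ₗ
    (TensorProduct.assoc k A H (H ⊗[k] A)).symm.toLinearMap ∘ₗ
    ((TensorProduct.leftComm k H H A).toLinearMap ∘ₗ
      (TensorProduct.assoc k H H A).toLinearMap).lTensor A
  have hV : ∀ c w u d, V (c ⊗ₜ ((w ⊗ₜ u) ⊗ₜ d)) = ract u c * ract w d := fun _ _ _ _ => rfl
  let W : A → (H ⊗[k] H) ⊗[k] A →ₗ[k] A := fun d => V ∘ₗ
    ((TensorProduct.curry (twice ρ')).flip d).lTensor A ∘ₗ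
    (TensorProduct.comm k (H ⊗[k] H) A).toLinearMap
  have hW : ∀ d z c, W d (z ⊗ₜ c) = V (c ⊗ₜ twice ρ' (z ⊗ₜ d)) := fun _ _ _ => rfl
  have h1 : ∀ c d z, LinearMap.mul' k A (Φ (TensorProduct.map α α (TensorProduct.comm k A A
      (Φ (TensorProduct.map (ract.flip d) (ract.flip c) z))))) = W d (twice ρ' (z ⊗ₜ c)) :=
    fun c d z => by
      induction z with
      | zero => simp
      | add s s' hs hs' => simp only [map_add, TensorProduct.add_tmul, hs, hs']
      | tmul t s =>
      rw [TensorProduct.map_tmul, LinearMap.flip_apply, LinearMap.flip_apply,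
        ← LinearMap.lTensor_tmul, hΦl, hΦ, twoLegs_tmul]
      generalize ρ' (t ⊗ₜ c) = z
      induction z with
      | zero => simp
      | add s s' hs hs' => simp only [map_add, hs, hs']
      | tmul q c =>
      rw [LinearMap.rTensor_tmul, LinearMap.lTensor_tmul, TensorProduct.comm_tmul,
        TensorProduct.map_tmul, LinearMap.flip_apply, hα', hα', LinearMap.lTensor_tmul,
        TensorProduct.curry_apply]
      generalize ρ' (s ⊗ₜ c) = z
      induction z with
      | zero => simp
      | add s s' hs hs' => simp only [map_add, TensorProduct.tmul_add, TensorProduct.add_tmul, hs, hs']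
      | tmul r c =>
      rw [TensorProduct.assoc_symm_tmul, hW, twoLegs_tmul]
      generalize ρ' (q ⊗ₜ d) = z
      induction z with
      | zero => simp
      | add s s' hs hs' => simp only [map_add, TensorProduct.tmul_add, hs, hs']
      | tmul w d =>
      rw [TensorProduct.lift.tmul, TensorProduct.lift.tmul, ← LinearMap.lTensor_tmul, hΦl, hΦ,
        LinearMap.lTensor_tmul, TensorProduct.curry_apply]
      generalize ρ' (r ⊗ₜ d) = z
      induction z with
      | zero => simp
      | add s s' hs hs' => simp only [map_add, TensorProduct.tmul_add, hs, hs']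
      | tmul u d => rfl
  have hT : ∀ x y, T₂ (flipComul Δ) (x ⊗ₜ y) = TensorProduct.comm k H H (leftSnd Δ y x) :=
    fun x y => hΔ.T₂_flip x y
  have h2 : ∀ c d x y, LinearMap.mul' k A (TensorProduct.map (ract.flip c) (ract.flip d)
      (TensorProduct.comm k H H (T₂ (flipComul Δ) (x ⊗ₜ y)))) = ract y (c * ract x d) :=
    fun c d x y => by
      rw [hT, TensorProduct.comm_comm, h.map_mul' hΔ]
  have h3 : ∀ c d x y, V (c ⊗ₜ (T₂ (flipComul Δ) (x ⊗ₜ y) ⊗ₜ d)) = ract y (c * ract x d) :=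
    fun c d x y => by
      rw [hT, h.map_mul' hΔ]
      generalize leftSnd Δ y x = z
      induction z with
      | zero => simp
      | add s s' hs hs' => simp only [map_add, TensorProduct.tmul_add, TensorProduct.add_tmul, hs, hs']
      | tmul i j => rfl
  have h4 : ∀ c d x y, W d (twice ρ' (T₂ (flipComul Δ) (x ⊗ₜ y) ⊗ₜ c)) =
      α (ract y (c * ract x d)) := fun c d x y => by
    have h5 := hm y c (ract x d)
    rw [LinearMap.mul_apply'] at h5
    rw [hρ.coassoc' hΔ.flip_hopf, hα', h5]
    generalize ρ' (y ⊗ₜ c) = z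
    induction z with
    | zero => simp
    | add s s' hs hs' => simp only [map_add, hs, hs']
    | tmul p c =>
    have h6 : W d (((leftFst (flipComul Δ)).flip x).rTensor A (p ⊗ₜ c)) =
      V (c ⊗ₜ twice ρ' (T₂ (flipComul Δ) (x ⊗ₜ p) ⊗ₜ d)) := rfl
    rw [h6, hρ.coassoc' hΔ.flip_hopf, LinearMap.rTensor_tmul, LinearMap.flip_apply,
      TensorProduct.curry_apply, hl]
    generalize ρ' (p ⊗ₜ d) = z
    induction z with
    | zero => simp
    | add s s' hs hs' => simp only [map_add, TensorProduct.tmul_add, TensorProduct.add_tmul, hs, hs']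
    | tmul r d => exact h3 c d x r
  have h5 : ∀ c d z, α (LinearMap.mul' k A (TensorProduct.map (ract.flip c) (ract.flip d)
      (TensorProduct.comm k H H z))) = W d (twice ρ' (z ⊗ₜ c)) := fun c d z => by
    obtain ⟨z, rfl⟩ := hΔ.flip_hopf.bijective₂.2 z
    induction z with
    | zero => simp
    | add s s' hs hs' => simp only [map_add, TensorProduct.add_tmul, hs, hs']
    | tmul x y => rw [h4, h2]
  induction t with
  | zero => simp
  | add s s' hs hs' => simp only [map_add, hs, hs']
  | tmul a b =>
    obtain ⟨s, hs⟩ := h.unital a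
    obtain ⟨t, ht⟩ := h.unital b
    have h6 := (h5 a b (t ⊗ₜ s)).trans (h1 a b (t ⊗ₜ s)).symm
    rwa [TensorProduct.comm_tmul, TensorProduct.map_tmul, TensorProduct.map_tmul,
      LinearMap.flip_apply, LinearMap.flip_apply, hs, ht] at h6

end RightContraction

/-! ### The two pairs of isomorphic products on a tensor product -/

section CrossIso

variable {k : Type u} [Field k]
variable {M : Type w} [AddCommGroup M] [Module k M] {B : Type w'} [AddCommGroup B] [Module k B]
variable {mM : M →ₗ[k] M →ₗ[k] M} {mB : B →ₗ[k] B →ₗ[k] B} {Φ Φ' Ψ Θ : M ⊗[k] B →ₗ[k] M ⊗[k] B}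

theorem crossMul_areIsomorphic (h₁ : IsMulLeft mM.flip Φ) (h₂ : IsMulRight mB Φ)
    (hΦ : ∀ t, Φ (Φ' t) = t) (hΦ' : ∀ t, Φ' (Φ t) = t)
    (hΘ : ∀ t, Φ (Θ t) = Ψ t) (hl : LegsCommute Ψ Φ) (hc : CoLegsCommute Φ Ψ) :
    AreIsomorphic (crossMul mM mB LinearMap.id Θ) (crossMul mM mB Φ Ψ) :=
  ⟨LinearEquiv.ofLinearMap Φ Φ' (LinearMap.ext hΦ) (LinearMap.ext hΦ'),
    map_crossMul h₁ h₂ hΘ hl hc⟩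

end CrossIso

/-! ### Four-sided Long module algebras -/

section FourSided

variable {k : Type u} [Field k]
variable {Q : Type v} [NonUnitalRing Q] [Module k Q] [IsScalarTower k Q Q] [SMulCommClass k Q Q]
variable {A : Type w} [NonUnitalRing A] [Module k A] [IsScalarTower k A A] [SMulCommClass k A A]
variable {Δ : Q →ₗ[k] Multiplier k (Q ⊗[k] Q)} {lact ract : Q →ₗ[k] A →ₗ[k] A}
  {Γ : A →ₗ[k] Multiplier k (Q ⊗[k] A)} {υ : A →ₗ[k] Multiplier k (A ⊗[k] Q)}
  {ε : Q →ₗ[k] k} {S : Q ≃ₗ[k] Q}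

theorem IsBicomoduleAlgebra.legsCommute (h : IsBicomoduleAlgebra Δ Γ υ) :
    LegsCommute (coactRight Γ) (rcoactLeft υ) := fun x y a => by
  have h1 := congrArg (fun t => TensorProduct.leftComm k Q Q A
    ((TensorProduct.comm k A Q).toLinearMap.lTensor Q t)) (h.compat a y x)
  have e1 : ∀ t : Q ⊗[k] A, (TensorProduct.curry (rcoactLeft υ) y).lTensor Q t =
      (TensorProduct.comm k A Q).toLinearMap.lTensor Q (((leftSnd υ).flip y).lTensor Q t) :=
    fun t => by
      rw [← LinearMap.lTensor_comp_apply]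
      rfl
  rw [coactRight_tmul, rcoactLeft_tmul, e1]
  refine h1.trans ?_
  generalize leftSnd υ a y = t
  induction t with
  | zero => simp
  | add s s' hs hs' => simp only [map_add] at hs hs' ⊢; rw [hs, hs']
  | tmul b q =>
    change TensorProduct.leftComm k Q Q A ((TensorProduct.comm k A Q).toLinearMap.lTensor Q
      (TensorProduct.assoc k Q A Q (rightFst Γ b x ⊗ₜ q))) = q ⊗ₜ rightFst Γ b x
    generalize rightFst Γ b x = t
    induction t with
    | zero => simp
    | add s s' hs hs' => simp only [map_add, TensorProduct.tmul_add, TensorProduct.add_tmul, hs, hs']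
    | tmul i j => rfl

/-- The operator of the left coaction `a ↦ op S⁻¹(a₍₁₎) ⊗ a₀` of `Qᵒᵖ`, made from the operator of the
right coaction `a ↦ a₀ ⊗ a₍₁₎` of `Q`. -/
abbrev opCoact (S : Q ≃ₗ[k] Q) (ρ : Q ⊗[k] A →ₗ[k] Q ⊗[k] A) : Qᵐᵒᵖ ⊗[k] A →ₗ[k] Qᵐᵒᵖ ⊗[k] A :=
  (antipodeLeft S.symm A ≪≫ₗ opLeft k Q A).conj ρ

theorem opCoact_tmul (S : Q ≃ₗ[k] Q) (ρ : Q ⊗[k] A →ₗ[k] Q ⊗[k] A) (x : Q) (a : A) :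
    opCoact S ρ (MulOpposite.op x ⊗ₜ a) =
      opLeft k Q A (antipodeLeft S.symm A (ρ (S x ⊗ₜ a))) := rfl

theorem twoLegs_opCoact (S : Q ≃ₗ[k] Q) (Γ : A →ₗ[k] Multiplier k (Q ⊗[k] A))
    (υ : A →ₗ[k] Multiplier k (A ⊗[k] Q)) (x y : Q) (a : A) :
    twoLegs (coactRight Γ) (opCoact S (rcoactRight υ)) ((x ⊗ₜ MulOpposite.op y) ⊗ₜ a) =
      (((MulOpposite.opLinearEquiv k).toLinearMap ∘ₗ S.symm.toLinearMap).lTensor Q).rTensor A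
        (legsRight Γ υ a x (S y)) := by
  rw [twoLegs_tmul, coactRight_tmul, legsRight]
  generalize rightFst Γ a x = t
  induction t with
  | zero => simp
  | add s s' hs hs' => simp only [map_add, hs, hs']
  | tmul p b =>
    rw [LinearMap.lTensor_tmul, LinearMap.lTensor_tmul, TensorProduct.curry_apply, opCoact_tmul,
      rcoactRight_tmul, LinearMap.flip_apply]
    generalize rightSnd υ b (S y) = t
    induction t with
    | zero => simp
    | add s s' hs hs' => simp only [map_add, TensorProduct.tmul_add, hs, hs']
    | tmul i j => rfl

theorem twoLegs_antipode_symm (S : Q ≃ₗ[k] Q) (Γ : A →ₗ[k] Multiplier k (Q ⊗[k] A))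
    (υ : A →ₗ[k] Multiplier k (A ⊗[k] Q)) (x y : Q) (a : A) :
    twoLegs ((antipodeLeft S A).symm.conj (coactLeft Γ)) (rcoactLeft υ) ((x ⊗ₜ y) ⊗ₜ a) =
      (S.symm.toLinearMap.rTensor Q).rTensor A (legsLeft Γ υ a (S x) y) := by
  rw [twoLegs_tmul, legsLeft]
  change (TensorProduct.assoc k Q Q A).symm ((TensorProduct.curry (rcoactLeft υ) y).lTensor Q
    ((antipodeLeft S A).symm (leftFst Γ a (S x)))) = _
  generalize leftFst Γ a (S x) = t
  induction t with
  | zero => simp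
  | add s s' hs hs' => simp only [map_add, hs, hs']
  | tmul p b =>
    rw [TensorProduct.congr_symm_tmul, LinearMap.lTensor_tmul, LinearMap.lTensor_tmul,
      TensorProduct.curry_apply, LinearEquiv.refl_symm, LinearEquiv.refl_apply, rcoactLeft_tmul,
      LinearMap.flip_apply]
    generalize leftSnd υ b y = t
    induction t with
    | zero => simp
    | add s s' hs hs' => simp only [map_add, TensorProduct.tmul_add, hs, hs']
    | tmul i j => rfl

theorem twoLegs_lTensor {H : Type v} [AddCommGroup H] [Module k H] {K : Type v'} [AddCommGroup K]
    [Module k K] {V : Type w} [AddCommGroup V] [Module k V] {ρ : H ⊗[k] V →ₗ[k] H ⊗[k] V}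
    {τ : K ⊗[k] V →ₗ[k] K ⊗[k] V} {f : V →ₗ[k] V}
    (hρ : ∀ x v, ρ (x ⊗ₜ f v) = f.lTensor H (ρ (x ⊗ₜ v)))
    (hτ : ∀ x v, τ (x ⊗ₜ f v) = f.lTensor K (τ (x ⊗ₜ v))) (z : H ⊗[k] K) (v : V) :
    twoLegs ρ τ (z ⊗ₜ f v) = f.lTensor (H ⊗[k] K) (twoLegs ρ τ (z ⊗ₜ v)) := by
  induction z with
  | zero => simp
  | add s s' hs hs' => simp only [map_add, TensorProduct.add_tmul, hs, hs']
  | tmul x y =>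
    rw [twoLegs_tmul, twoLegs_tmul, hρ]
    generalize ρ (x ⊗ₜ v) = t
    induction t with
    | zero => simp
    | add s s' hs hs' => simp only [map_add, hs, hs']
    | tmul c d =>
      rw [LinearMap.lTensor_tmul, LinearMap.lTensor_tmul, LinearMap.lTensor_tmul,
        TensorProduct.curry_apply, TensorProduct.curry_apply, hτ]
      generalize τ (y ⊗ₜ d) = t
      induction t with
      | zero => simp
      | add s s' hs hs' => simp only [map_add, TensorProduct.tmul_add, hs, hs']
      | tmul i j => rfl

theorem rTensor_comm (f : A →ₗ[k] A) (t : A ⊗[k] Q) :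
    TensorProduct.comm k A Q (f.rTensor Q t) = f.lTensor Q (TensorProduct.comm k A Q t) := by
  induction t with
  | zero => simp
  | add s s' hs hs' => simp only [map_add, hs, hs']
  | tmul i j => rfl

/-- The inverse of the twisting map of `a ↦ op S⁻¹(a₍₁₎) ⊗ a₀` comes from `x ⊗ a ↦ x a₍₁₎ ⊗ a₀`. -/
theorem IsCoaction.opCoact_comp {ρ ρ' : Q ⊗[k] A →ₗ[k] Q ⊗[k] A}
    (hΔ : IsRegularMultiplierHopf Δ) (hS : IsCounitAntipode Δ ε S.toLinearMap)
    (h : IsCoaction (flipComul Δ) ρ ρ') (t : Qᵐᵒᵖ ⊗[k] A) :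
    opCoact S ρ ((opLeft k Q A).conj ρ' t) = t := by
  have h1 := congrArg (opLeft k Q A) (h.antipode₂ hΔ.flip_hopf (hS.flip hΔ)
    ((opLeft k Q A).symm t))
  rw [LinearEquiv.apply_symm_apply] at h1
  rw [opCoact, LinearEquiv.conj_apply_apply, LinearEquiv.conj_apply_apply]
  refine Eq.trans ?_ h1
  rw [LinearEquiv.trans_apply, LinearEquiv.trans_symm, LinearEquiv.trans_apply,
    LinearEquiv.symm_apply_apply]

theorem IsCoaction.comp_opCoact {ρ ρ' : Q ⊗[k] A →ₗ[k] Q ⊗[k] A}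
    (hΔ : IsRegularMultiplierHopf Δ) (hS : IsCounitAntipode Δ ε S.toLinearMap)
    (h : IsCoaction (flipComul Δ) ρ ρ') (t : Qᵐᵒᵖ ⊗[k] A) :
    (opLeft k Q A).conj ρ' (opCoact S ρ t) = t := by
  have h1 := congrArg (opLeft k Q A) (h.antipode₁ hΔ.flip_hopf (hS.flip hΔ)
    ((antipodeLeft S.symm A).symm ((opLeft k Q A).symm t)))
  rw [LinearEquiv.apply_symm_apply, LinearEquiv.apply_symm_apply] at h1
  rw [opCoact, LinearEquiv.conj_apply_apply, LinearEquiv.conj_apply_apply]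
  refine Eq.trans ?_ h1
  rw [LinearEquiv.trans_apply, LinearEquiv.symm_apply_apply]
  rfl

theorem IsRightComoduleAlgebra.isCoaction_opCoact (hΔ : IsRegularMultiplierHopf Δ)
    (hS : IsCounitAntipode Δ ε S.toLinearMap) (hA : IsNondegenerate A)
    (h : IsRightComoduleAlgebra Δ υ) :
    IsCoaction (opComul Δ :) (opCoact S (rcoactRight υ)) (opCoact S (rcoactLeft υ)) := by
  have h1 := (h.isCoaction hΔ hA).op hΔ.flip (hS.flip hΔ)
  rwa [flip_flip] at h1

/-- The coaction of `Q ⊗ Qᵒᵖ` on a bicomodule algebra. -/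
theorem IsBicomoduleAlgebra.isCoaction_enveloping (hΔ : IsRegularMultiplierHopf Δ)
    (hS : IsCounitAntipode Δ ε S.toLinearMap) (hA : IsNondegenerate A)
    (h : IsBicomoduleAlgebra Δ Γ υ) :
    IsCoaction (enveloping Δ :) (twoLegs (coactRight Γ) (opCoact S (rcoactRight υ)))
      (twoLegs (coactLeft Γ) (opCoact S (rcoactLeft υ))) := by
  have hQ := hΔ.nondegenerate
  have h1 := h.left.isCoaction hQ hA
  have h2 := h.right.isCoaction hΔ hA
  have h3 := h.right.isCoaction_opCoact hΔ hS hA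
  have h4 := ((h.legsCommute.right h2.compat hQ).symm.conj S.symm).conj (MulOpposite.opLinearEquiv k)
  exact h1.tensor hΔ.hopf.comul hΔ.opComul.hopf.comul h3 h4.symm

theorem IsRightComoduleAlgebra.isMultiplicative_opCoact (hQ : IsNondegenerate Q)
    (hA : IsNondegenerate A) (h : IsRightComoduleAlgebra Δ υ) (S : Q ≃ₗ[k] Q) :
    IsMultiplicative (opCoact S (rcoactRight υ)) :=
  ((h.isMultiplicative hQ hA).conj S.symm).conj (MulOpposite.opLinearEquiv k)

theorem IsBicomoduleAlgebra.isMultiplicative_enveloping (hQ : IsNondegenerate Q)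
    (hA : IsNondegenerate A) (h : IsBicomoduleAlgebra Δ Γ υ) (S : Q ≃ₗ[k] Q) :
    IsMultiplicative (twoLegs (coactRight Γ) (opCoact S (rcoactRight υ))) :=
  (h.left.isMultiplicative hQ hA).twoLegs (h.right.isMultiplicative_opCoact hQ hA S)

theorem IsBimoduleAlgebra.isLeftModuleAlgebra_enveloping (hΔ : IsRegularMultiplierHopf Δ)
    (h : IsBimoduleAlgebra Δ lact ract) :
    IsLeftModuleAlgebra (enveloping Δ :) (envelopingAction lact ract) :=
  h.left.tensor hΔ.hopf.comul hΔ.opComul.hopf.comul (h.right.op hΔ) fun x y a => h.assoc x y.unop a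

theorem IsFourSidedLong.long_enveloping (h : IsFourSidedLong Δ lact ract Γ υ) (S : Q ≃ₗ[k] Q)
    (z s : Q ⊗[k] Qᵐᵒᵖ) (a : A) :
    twoLegs (coactRight Γ) (opCoact S (rcoactRight υ)) (z ⊗ₜ envelopingAction lact ract s a) =
      (envelopingAction lact ract s).lTensor (Q ⊗[k] Qᵐᵒᵖ)
        (twoLegs (coactRight Γ) (opCoact S (rcoactRight υ)) (z ⊗ₜ a)) := by
  have h1 : ∀ f : A →ₗ[k] A, (∀ y a, rightSnd υ (f a) y = f.rTensor Q (rightSnd υ a y)) →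
      ∀ x a, opCoact S (rcoactRight υ) (x ⊗ₜ f a) =
        f.lTensor Qᵐᵒᵖ (opCoact S (rcoactRight υ) (x ⊗ₜ a)) := fun f hf => by
    have h2 : ∀ x a, rcoactRight υ (x ⊗ₜ f a) = f.lTensor Q (rcoactRight υ (x ⊗ₜ a)) :=
      fun x a => by rw [rcoactRight_tmul, hf, rTensor_comm, rcoactRight_tmul]
    have h3 := conj_lTensor S.symm h2
    have h4 := conj_lTensor (MulOpposite.opLinearEquiv k (M := Q)) h3
    exact h4
  induction s with
  | zero => simp
  | add s s' hs hs' =>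
    simp only [map_add, LinearMap.add_apply, TensorProduct.tmul_add, LinearMap.lTensor_add, hs, hs']
  | tmul x y =>
    have h2 : ∀ p b, coactRight Γ (p ⊗ₜ ract y.unop b) =
        (ract y.unop).lTensor Q (coactRight Γ (p ⊗ₜ b)) := fun p b => h.rightLeft.long y.unop p b
    have h3 : ∀ p b, coactRight Γ (p ⊗ₜ lact x b) =
        (lact x).lTensor Q (coactRight Γ (p ⊗ₜ b)) := fun p b => h.leftLeft.long x p b
    have e : envelopingAction lact ract (x ⊗ₜ y) = ract y.unop ∘ₗ lact x := rfl
    rw [e, LinearMap.comp_apply, LinearMap.lTensor_comp_apply,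
      twoLegs_lTensor h2 (h1 _ (h.rightRight.long y.unop)),
      twoLegs_lTensor h3 (h1 _ (h.leftRight.long x))]

end FourSided

/-! ### The twisting maps of a four-sided Long module algebra -/

section TwistingMaps

variable {k : Type u} [Field k]
variable {Q : Type v} [NonUnitalRing Q] [Module k Q] [IsScalarTower k Q Q] [SMulCommClass k Q Q]
variable {A : Type w} [NonUnitalRing A] [Module k A] [IsScalarTower k A A] [SMulCommClass k A A]
variable {Δ : Q →ₗ[k] Multiplier k (Q ⊗[k] Q)} {lact ract : Q →ₗ[k] A →ₗ[k] A}
  {Γ : A →ₗ[k] Multiplier k (Q ⊗[k] A)} {υ : A →ₗ[k] Multiplier k (A ⊗[k] Q)}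
  {ε : Q →ₗ[k] k} {S : Q ≃ₗ[k] Q}

/-- The operators `Ψ : m ⊗ b ↦ b₍₋₁₎ ▷ m ⊗ b₀` and `Φ : m ⊗ b ↦ m ◁ b₍₁₎ ⊗ b₀` on `A ⊗ A`, with their
inverses `Ψ' : m ⊗ b ↦ S⁻¹(b₍₋₁₎) ▷ m ⊗ b₀` and `Φ' : m ⊗ b ↦ m ◁ S⁻¹(b₍₁₎) ⊗ b₀`, and the identities
between them on which the twisted products depend. -/
structure IsTwistSystem (S : Q ≃ₗ[k] Q) (lact ract : Q →ₗ[k] A →ₗ[k] A)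
    (Γ : A →ₗ[k] Multiplier k (Q ⊗[k] A)) (υ : A →ₗ[k] Multiplier k (A ⊗[k] Q))
    (Ψ Ψ' Φ Φ' : A ⊗[k] A →ₗ[k] A ⊗[k] A) : Prop where
  left : IsTwist lact (coactRight Γ) Ψ
  left_inv : IsTwist lact ((antipodeLeft S A).symm.conj (coactLeft Γ)) Ψ'
  right : IsTwist ract (rcoactLeft υ) Φ
  left_left_inv : ∀ t, Ψ (Ψ' t) = t
  left_inv_left : ∀ t, Ψ' (Ψ t) = t
  right_right_inv : ∀ t, Φ (Φ' t) = t
  right_inv_right : ∀ t, Φ' (Φ t) = t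
  mulLeft_left : IsMulLeft (LinearMap.mul k A) Ψ
  mulRight_left : IsMulRight (LinearMap.mul k A).flip Ψ
  mulLeft_right : IsMulLeft (LinearMap.mul k A).flip Φ
  mulRight_right : IsMulRight (LinearMap.mul k A) Φ
  mulLeft_comp : IsMulLeft (LinearMap.mul k A) (Φ' ∘ₗ Ψ)
  mulRight_comp : IsMulRight (LinearMap.mul k A).flip (Φ' ∘ₗ Ψ)
  comp : IsTwist (envelopingAction lact ract)
    (twoLegs (coactRight Γ) (opCoact S (rcoactRight υ))) (Φ' ∘ₗ Ψ)
  legs : LegsCommute Ψ Φ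
  colegs : CoLegsCommute Φ Ψ
  colegs' : CoLegsCommute Ψ Φ
  commute : ∀ t, Φ (Ψ t) = Ψ (Φ t)

theorem IsFourSidedLong.exists_isTwistSystem (hΔ : IsRegularMultiplierHopf Δ)
    (hS : IsCounitAntipode Δ ε S.toLinearMap) (hA : IsNondegenerate A)
    (h : IsFourSidedLong Δ lact ract Γ υ) :
    ∃ Ψ Ψ' Φ Φ', IsTwistSystem S lact ract Γ υ Ψ Ψ' Φ Φ' := by
  have hQ := hΔ.nondegenerate
  have mL := h.bimodule.left
  have mR := h.bimodule.right.op hΔ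
  have mE := h.bimodule.isLeftModuleAlgebra_enveloping hΔ
  have uL := mL.isUnitalAction
  have uR := mR.isUnitalAction
  have cL := h.bicomodule.left.isCoaction hQ hA
  have cυ := h.bicomodule.right.isCoaction hΔ hA
  have cR := h.bicomodule.right.isCoaction_opCoact hΔ hS hA
  have cE := h.bicomodule.isCoaction_enveloping hΔ hS hA
  have eL : ∀ t, (antipodeLeft S A).symm.conj (coactLeft Γ) (coactRight Γ t) = t := fun t =>
    (antipodeLeft S A).symm_apply_eq.2 (cL.antipode₁ hΔ.hopf hS t)
  have eL' : ∀ t, coactRight Γ ((antipodeLeft S A).symm.conj (coactLeft Γ) t) = t := fun t =>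
    (antipodeLeft S A).injective (cL.antipode₂ hΔ.hopf hS (antipodeLeft S A t))
  obtain ⟨Ψ, hΨ⟩ := exists_isTwist uL cL.compat
  obtain ⟨Ψ', hΨ'⟩ := exists_isTwist uL (cL.compat.antipode_symm (hS.antipode_mul hΔ.hopf))
  obtain ⟨Φ, hΦ⟩ := exists_isTwist uR cυ.compat.op
  obtain ⟨Φ', hΦ'⟩ := exists_isTwist uR cR.compat
  have hc : ∀ x y m, opAction ract y (lact x m) = lact x (opAction ract y m) := fun x y m =>
    h.bimodule.assoc x y.unop m
  have hl : LegsCommute (coactRight Γ) ((opLeft k Q A).conj (rcoactLeft υ)) :=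
    (h.bicomodule.legsCommute.symm.conj (MulOpposite.opLinearEquiv k)).symm
  have hΨM := hΨ.isMulLeft hΔ.hopf.bijective₁.2 mL cL
  have hΦM' := hΦ'.isMulLeft hΔ.opComul.hopf.bijective₁.2 mR cR
  have hΦR' := hΦ'.isMulRight uR (h.bicomodule.right.isMultiplicative_opCoact hQ hA S)
  have hE : IsTwist (envelopingAction lact ract)
    (twoLegs (coactRight Γ) (opCoact S (rcoactRight υ))) (Φ' ∘ₗ Ψ) := hΨ.tensor hΦ' hc
  have i1 : ∀ t, Φ (Φ' t) = t := (hΦ.comp hΦ').eq_id uR (cυ.comp_opCoact hΔ hS)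
  have i2 : ∀ t, Φ' (Φ t) = t := (hΦ'.comp hΦ).eq_id uR (cυ.opCoact_comp hΔ hS)
  exact ⟨Ψ, Ψ', Φ, Φ',
    { left := hΨ
      left_inv := hΨ'
      right := isTwist_opAction hΦ
      left_left_inv := (hΨ.comp hΨ').eq_id uL eL'
      left_inv_left := (hΨ'.comp hΨ).eq_id uL eL
      right_right_inv := i1
      right_inv_right := i2
      mulLeft_left := hΨM
      mulRight_left := hΨ.isMulRight uL (h.bicomodule.left.isMultiplicative hQ hA)
      mulLeft_right := hΦM'.inverse i2 i1
      mulRight_right := hΦR'.inverse i2 i1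
      mulLeft_comp := hE.isMulLeft hΔ.enveloping.hopf.bijective₁.2 mE cE
      mulRight_comp := hE.isMulRight mE.isUnitalAction
        (h.bicomodule.isMultiplicative_enveloping hQ hA S)
      comp := hE
      legs := hΨ.legsCommute uL uR hΦ hl
      colegs := hΨ.coLegsCommute uL uR hΦ hc
      colegs' := hΦ.coLegsCommute uR uL hΨ fun x y m => (hc y x m).symm
      commute := hΨ.commute uL uR hΦ hc hl }⟩

variable {Ψ Ψ' Φ Φ' : A ⊗[k] A →ₗ[k] A ⊗[k] A}

theorem isAssocMul_mul : IsAssocMul (LinearMap.mul k A) := mul_assoc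

theorem IsTwistSystem.isLeftLRSmash (h : IsTwistSystem S lact ract Γ υ Ψ Ψ' Φ Φ') :
    IsLeftLRSmash lact ract Γ υ (crossMul (LinearMap.mul k A) (LinearMap.mul k A) Φ Ψ) :=
  fun a c b d x y => by
    rw [crossMul_tmul, h.left, h.right, rcoactLeft_tmul, coactRight_tmul]
    generalize rightFst Γ b x = s
    generalize TensorProduct.comm k A Q (leftSnd υ d y) = t
    induction s with
    | zero => simp
    | add s s' hs hs' => simp only [map_add, TensorProduct.add_tmul, hs, hs']
    | tmul p b =>
    induction t with
    | zero => simp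
    | add s s' hs hs' =>
      simp only [map_add, TensorProduct.tmul_add, LinearMap.add_apply, hs, hs']
    | tmul q d => rfl

theorem IsTwistSystem.isLeftTwistedSmash (h : IsTwistSystem S lact ract Γ υ Ψ Ψ' Φ Φ') :
    IsLeftTwistedSmash S lact ract Γ υ
      (crossMul (LinearMap.mul k A) (LinearMap.mul k A) LinearMap.id (Φ' ∘ₗ Ψ)) :=
  fun a c b d x y => by
    have h1 := h.comp (x ⊗ₜ MulOpposite.op y) c b
    rw [twoLegs_opCoact] at h1
    rw [crossMul_tmul, LinearMap.id_apply]
    refine (congrArg _ h1).trans ?_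
    generalize legsRight Γ υ b x (S y) = s
    induction s with
    | zero => simp
    | add s s' hs hs' => simp only [map_add, hs, hs']
    | tmul p b =>
    induction p with
    | zero => simp
    | add s s' hs hs' => simp only [map_add, TensorProduct.add_tmul, hs, hs']
    | tmul p q => rfl

theorem IsTwistSystem.leftIso (h : IsTwistSystem S lact ract Γ υ Ψ Ψ' Φ Φ') :
    AreIsomorphic
      (crossMul (LinearMap.mul k A) (LinearMap.mul k A) LinearMap.id (Φ' ∘ₗ Ψ))
      (crossMul (LinearMap.mul k A) (LinearMap.mul k A) Φ Ψ) :=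
  crossMul_areIsomorphic h.mulLeft_right h.mulRight_right h.right_right_inv h.right_inv_right
    (fun t => h.right_right_inv (Ψ t)) h.legs h.colegs

theorem IsTwistSystem.isAssocMul_left (h : IsTwistSystem S lact ract Γ υ Ψ Ψ' Φ Φ') :
    IsAssocMul (crossMul (LinearMap.mul k A) (LinearMap.mul k A) LinearMap.id (Φ' ∘ₗ Ψ)) :=
  isAssocMul_crossMul_id isAssocMul_mul isAssocMul_mul h.mulLeft_comp h.mulRight_comp

/-- `m ⊗ d ↦ S⁻¹(d₍₋₁₎) ▷ m ◁ d₍₁₎ ⊗ d₀` inverts `m ⊗ d ↦ d₍₋₁₎ ▷ m ◁ S⁻¹(d₍₁₎) ⊗ d₀`. -/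
theorem IsTwistSystem.comp_inv (h : IsTwistSystem S lact ract Γ υ Ψ Ψ' Φ Φ') (t : A ⊗[k] A) :
    (Φ' ∘ₗ Ψ) ((Φ ∘ₗ Ψ') t) = t := by
  simp only [LinearMap.comp_apply]
  rw [← h.commute, h.left_left_inv, h.right_inv_right]

theorem IsTwistSystem.inv_comp (h : IsTwistSystem S lact ract Γ υ Ψ Ψ' Φ Φ') (t : A ⊗[k] A) :
    (Φ ∘ₗ Ψ') ((Φ' ∘ₗ Ψ) t) = t := by
  have h1 : Function.Injective (Φ' ∘ₗ Ψ) :=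
    (Function.LeftInverse.injective h.right_right_inv).comp
      (Function.LeftInverse.injective h.left_inv_left)
  exact h1 (h.comp_inv _)

theorem IsTwistSystem.rightIso (h : IsTwistSystem S lact ract Γ υ Ψ Ψ' Φ Φ') :
    AreIsomorphic
      (crossMul (LinearMap.mul k A) (LinearMap.mul k A) (Φ ∘ₗ Ψ') LinearMap.id)
      (crossMul (LinearMap.mul k A) (LinearMap.mul k A) Φ Ψ) := by
  have h1 := crossMul_areIsomorphic (mM := (LinearMap.mul k A).flip) (mB := (LinearMap.mul k A).flip)
    (Θ := Φ ∘ₗ Ψ') h.mulLeft_left h.mulRight_left h.left_left_inv h.left_inv_left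
    (fun t => by rw [LinearMap.comp_apply, ← h.commute, h.left_left_inv]) h.legs.symm h.colegs'
  rw [crossMul_flip, crossMul_flip] at h1
  exact h1.flip

theorem IsTwistSystem.isAssocMul_right (h : IsTwistSystem S lact ract Γ υ Ψ Ψ' Φ Φ') :
    IsAssocMul (crossMul (LinearMap.mul k A) (LinearMap.mul k A) (Φ ∘ₗ Ψ') LinearMap.id) := by
  have h1 := isAssocMul_crossMul_id (mM := (LinearMap.mul k A).flip)
    (mB := (LinearMap.mul k A).flip) isAssocMul_mul.flip isAssocMul_mul.flip
    (h.mulLeft_comp.inverse h.comp_inv h.inv_comp) (h.mulRight_comp.inverse h.comp_inv h.inv_comp)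
  rw [crossMul_flip] at h1
  exact h1.flip

theorem IsTwistSystem.isRightTwistedSmash (hc : ∀ x y m, ract y (lact x m) = lact x (ract y m))
    (h : IsTwistSystem S lact ract Γ υ Ψ Ψ' Φ Φ') :
    IsRightTwistedSmash S lact ract Γ υ (transport (TensorProduct.comm k A A)
      (crossMul (LinearMap.mul k A) (LinearMap.mul k A) (Φ ∘ₗ Ψ') LinearMap.id)) :=
  fun a c b d x y => by
    have h1 := h.left_inv.tensor h.right hc (x ⊗ₜ y) c d
    rw [twoLegs_antipode_symm, tensorAction_tmul] at h1
    change TensorProduct.comm k A A (outerMul _ _ ((Φ ∘ₗ Ψ') (ract y (lact x c) ⊗ₜ d)) (a ⊗ₜ b)) = _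
    rw [h1]
    congr 1
    generalize legsLeft Γ υ d (S x) y = s
    induction s with
    | zero => simp
    | add s s' hs hs' => simp only [map_add, LinearMap.add_apply, hs, hs']
    | tmul p b =>
    induction p with
    | zero => simp
    | add s s' hs hs' => simp only [map_add, TensorProduct.add_tmul, LinearMap.add_apply, hs, hs']
    | tmul p q => rfl

theorem IsTwistSystem.isRightLRSmash (h : IsTwistSystem S lact ract Γ υ Ψ Ψ' Φ Φ') :
    IsRightLRSmash lact ract Γ υ (transport (TensorProduct.comm k A A)
      (crossMul (LinearMap.mul k A) (LinearMap.mul k A) Φ Ψ)) :=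
  fun a c b d x y => congrArg (TensorProduct.comm k A A) (h.isLeftLRSmash a c b d x y)

end TwistingMaps

/-! ### The isomorphism of the twisted products on the Long module algebra -/

section ContractionIso

variable {k : Type u} [Field k]
variable {Q : Type v} [NonUnitalRing Q] [Module k Q] [IsScalarTower k Q Q] [SMulCommClass k Q Q]
variable {A : Type w} [NonUnitalRing A] [Module k A] [IsScalarTower k A A] [SMulCommClass k A A]
variable {Δ : Q →ₗ[k] Multiplier k (Q ⊗[k] Q)} {lact ract : Q →ₗ[k] A →ₗ[k] A}
  {Γ : A →ₗ[k] Multiplier k (Q ⊗[k] A)} {υ : A →ₗ[k] Multiplier k (A ⊗[k] Q)}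
  {ε : Q →ₗ[k] k} {S : Q ≃ₗ[k] Q} {Ψ Ψ' Φ Φ' : A ⊗[k] A →ₗ[k] A ⊗[k] A}

/-- The product `a ⊛ b = (a₀ ◁ b₍₁₎)(a₍₋₁₎ ▷ b₀)`. -/
def lrMul (Φ Ψ : A ⊗[k] A →ₗ[k] A ⊗[k] A) : A →ₗ[k] A →ₗ[k] A :=
  (TensorProduct.curry (LinearMap.mul' k A ∘ₗ Φ ∘ₗ (TensorProduct.comm k A A).toLinearMap ∘ₗ Ψ)).flip

theorem lrMul_apply (a b : A) : lrMul Φ Ψ a b =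
    LinearMap.mul' k A (Φ (TensorProduct.comm k A A (Ψ (b ⊗ₜ a)))) := rfl

theorem IsFourSidedLong.isLRTwistedProduct (h : IsFourSidedLong Δ lact ract Γ υ)
    (hT : IsTwistSystem S lact ract Γ υ Ψ Ψ' Φ Φ') (hΦ : ∀ x t, Φ ((lact x).lTensor A t) =
      (lact x).lTensor A (Φ t)) :
    IsLRTwistedProduct lact ract Γ υ (lrMul Φ Ψ) := fun a b x y => by
  rw [lrMul_apply, hT.left, coactRight_tmul, h.rightLeft.long]
  generalize rightFst Γ a x = s
  induction s with
  | zero => simp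
  | add s s' hs hs' => simp only [map_add, TensorProduct.add_tmul, hs, hs']
  | tmul q a =>
  rw [LinearMap.lTensor_tmul, LinearMap.rTensor_tmul, TensorProduct.comm_tmul, LinearMap.flip_apply,
    ← LinearMap.lTensor_tmul, hΦ, hT.right, rcoactLeft_tmul]
  generalize TensorProduct.comm k A Q (leftSnd υ b y) = t
  induction t with
  | zero => simp
  | add s s' hs hs' => simp only [map_add, TensorProduct.tmul_add, hs, hs']
  | tmul r b => rfl

theorem IsRightRightLong.rcoactRight_act (h : IsRightRightLong Δ ract υ) (x y : Q) (a : A) :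
    rcoactRight υ (x ⊗ₜ ract y a) = (ract y).lTensor Q (rcoactRight υ (x ⊗ₜ a)) := by
  rw [rcoactRight_tmul, h.long, rTensor_comm, rcoactRight_tmul]

theorem IsRightRightLong.rcoactLeft_act (hΔ : IsRegularMultiplierHopf Δ) (hA : IsNondegenerate A)
    (h : IsRightRightLong Δ ract υ) (x y : Q) (a : A) :
    rcoactLeft υ (x ⊗ₜ ract y a) = (ract y).lTensor Q (rcoactLeft υ (x ⊗ₜ a)) :=
  (h.comoduleAlgebra.isCoaction hΔ hA).compat.map_lTensor hΔ.nondegenerate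
    (fun x a => h.rcoactRight_act x y a) x a

theorem IsLeftRightLong.rcoactLeft_act (hΔ : IsRegularMultiplierHopf Δ) (hA : IsNondegenerate A)
    (h : IsLeftRightLong Δ lact υ) (x y : Q) (a : A) :
    rcoactLeft υ (x ⊗ₜ lact y a) = (lact y).lTensor Q (rcoactLeft υ (x ⊗ₜ a)) :=
  (h.comoduleAlgebra.isCoaction hΔ hA).compat.map_lTensor hΔ.nondegenerate
    (fun x a => by rw [rcoactRight_tmul, h.long, rTensor_comm, rcoactRight_tmul]) x a

/-- The contraction `α : a ↦ a₀ ◁ a₍₁₎`, with inverse `a ↦ a₀ ◁ S⁻¹(a₍₁₎)`. -/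
theorem IsRightRightLong.exists_contraction (hΔ : IsRegularMultiplierHopf Δ)
    (hS : IsCounitAntipode Δ ε S.toLinearMap) (hA : IsNondegenerate A)
    (h : IsRightRightLong Δ ract υ) :
    ∃ α : A ≃ₗ[k] A, IsContraction (opAction ract) ((opLeft k Q A).conj (rcoactLeft υ)) α.toLinearMap ∧
      ∀ a x, α.symm (ract x a) =
        TensorProduct.lift (ract.flip.compl₂ S.symm.toLinearMap) (rightSnd υ a (S x)) := by
  have u := (h.moduleAlgebra.op hΔ).isUnitalAction
  have c := h.comoduleAlgebra.isCoaction hΔ hA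
  have cR := h.comoduleAlgebra.isCoaction_opCoact hΔ hS hA
  have l1 : ∀ y : Qᵐᵒᵖ, ∀ x a, (opLeft k Q A).conj (rcoactRight υ) (x ⊗ₜ ract y.unop a) =
      (ract y.unop).lTensor Qᵐᵒᵖ ((opLeft k Q A).conj (rcoactRight υ) (x ⊗ₜ a)) := fun y =>
    conj_lTensor (MulOpposite.opLinearEquiv k (M := Q)) fun x a => h.rcoactRight_act x y.unop a
  have l2 : ∀ y : Qᵐᵒᵖ, ∀ x a, opCoact S (rcoactLeft υ) (x ⊗ₜ ract y.unop a) =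
      (ract y.unop).lTensor Qᵐᵒᵖ (opCoact S (rcoactLeft υ) (x ⊗ₜ a)) := fun y => by
    have h3 := conj_lTensor S.symm fun x a => h.rcoactLeft_act hΔ hA x y.unop a
    have h4 := conj_lTensor (MulOpposite.opLinearEquiv k (M := Q)) h3
    exact h4
  obtain ⟨α, hα⟩ := exists_isContraction u c.compat.op fun x y a => l1 y x a
  obtain ⟨β, hβ⟩ := exists_isContraction u cR.compat fun x y a => l2 y x a
  refine ⟨LinearEquiv.ofLinearMap α β
    (LinearMap.ext (hα.comp_eq u hβ (c.comp_opCoact hΔ hS)))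
    (LinearMap.ext (hβ.comp_eq u hα (c.opCoact_comp hΔ hS))), hα, fun a x => ?_⟩
  have h1 := hβ (MulOpposite.op x ⊗ₜ a)
  rw [opCoact_tmul, rcoactRight_tmul] at h1
  refine Eq.trans h1 ?_
  generalize rightSnd υ a (S x) = t
  induction t with
  | zero => simp
  | add s s' hs hs' => simp only [map_add, hs, hs']
  | tmul i j => rfl

/-- The contraction `α` carries the left twisted product to the L-R-twisted product: `α (a b)` is
`α (a) α (b)` up to two twisting maps `Φ`, one of which turns `Φ' Ψ` into `Ψ`, and `Ψ` commutes with
`α ⊗ α`. -/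
theorem IsFourSidedLong.contraction_twistedMul (hΔ : IsRegularMultiplierHopf Δ)
    (hA : IsNondegenerate A) (h : IsFourSidedLong Δ lact ract Γ υ)
    (hT : IsTwistSystem S lact ract Γ υ Ψ Ψ' Φ Φ') {α : A →ₗ[k] A}
    (hα : IsContraction (opAction ract) ((opLeft k Q A).conj (rcoactLeft υ)) α) (a b : A) :
    α (twistedMul (Φ' ∘ₗ Ψ) a b) = lrMul Φ Ψ (α a) (α b) := by
  have hQ := hΔ.nondegenerate
  have u := (h.bimodule.right.op hΔ).isUnitalAction
  have uL := h.bimodule.left.isUnitalAction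
  have c := h.bicomodule.right.isCoaction hΔ hA
  have hact : ∀ x m, α (lact x m) = lact x (α m) := fun x => by
    refine hα.map u (fun y m => (h.bimodule.assoc x y.unop m).symm) ?_
    exact conj_lTensor (MulOpposite.opLinearEquiv k (M := Q)) fun y m =>
      h.leftRight.rcoactLeft_act hΔ hA y x m
  have hcoact : ∀ x m, coactRight Γ (x ⊗ₜ α m) = α.lTensor Q (coactRight Γ (x ⊗ₜ m)) :=
    hα.map_lTensor u (fun x y m => h.rightLeft.long y.unop x m)
      (h.bicomodule.legsCommute.symm.conj (MulOpposite.opLinearEquiv k)).symm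
  have hΨ : ∀ t, TensorProduct.map α α (Ψ t) = Ψ (TensorProduct.map α α t) := fun t => by
    rw [← LinearMap.lTensor_comp_rTensor, LinearMap.comp_apply, LinearMap.comp_apply,
      ← hT.left.map_rTensor uL hact, ← hT.left.map_lTensor uL.unital hcoact]
  have hΦ : ∀ y t, Φ ((ract y).lTensor A t) = (ract y).lTensor A (Φ t) := fun y =>
    hT.right.map_lTensor h.bimodule.right.unital fun x m => h.rightRight.rcoactLeft_act hΔ hA x y m
  have hm := (h.bicomodule.right.isMultiplicative hQ hA).isMulRight c.compat hQ
  have h1 := (isContraction_opAction hα).map_mul hΔ h.bimodule.right c hm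
    (h.rightRight.rcoactLeft_act hΔ hA) hT.right hΦ
    (TensorProduct.comm k A A ((Φ' ∘ₗ Ψ) (b ⊗ₜ a)))
  rw [TensorProduct.comm_comm, LinearMap.comp_apply, hT.right_right_inv] at h1
  rw [twistedMul_apply, lrMul_apply, ← TensorProduct.map_tmul, ← hΨ]
  refine Eq.trans ?_ (h1.trans ?_)
  · rw [LinearMap.comp_apply]
    generalize Φ' (Ψ (b ⊗ₜ a)) = t
    induction t with
    | zero => simp
    | add s s' hs hs' => simp only [map_add, hs, hs']
    | tmul i j => rfl
  · rw [TensorProduct.map_comm]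

end ContractionIso

end

end MultHopf

theorem theorem4p6 {k Q A : Type*} [Field k]
    [NonUnitalRing Q] [Module k Q] [IsScalarTower k Q Q] [SMulCommClass k Q Q]
    [NonUnitalRing A] [Module k A] [IsScalarTower k A A] [SMulCommClass k A A]
    (Δ : Q →ₗ[k] Multiplier k (Q ⊗[k] Q)) (hΔ : IsRegularMultiplierHopf Δ)
    (S : Q ≃ₗ[k] Q) (hS : IsAntipode Δ S.toLinearMap)
    (hA : IsNondegenerate A)
    (lact ract : Q →ₗ[k] A →ₗ[k] A)
    (Γ : A →ₗ[k] Multiplier k (Q ⊗[k] A)) (υ : A →ₗ[k] Multiplier k (A ⊗[k] Q))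
    (hLong : IsFourSidedLong Δ lact ract Γ υ) :
    IsRegularMultiplierHopf (enveloping Δ) ∧
    (∃ Γ' : A →ₗ[k] Multiplier k ((Q ⊗[k] Qᵐᵒᵖ) ⊗[k] A),
      IsEnvelopingCoaction S Γ υ Γ' ∧
      IsLeftLeftLong (enveloping Δ) (envelopingAction lact ract) Γ' ∧
      ∃ bullet lr : A →ₗ[k] A →ₗ[k] A,
        IsLeftTwistedProduct (envelopingAction lact ract) Γ' bullet ∧ IsAssocMul bullet ∧
        IsLRTwistedProduct lact ract Γ υ lr ∧ IsAssocMul lr ∧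
        ∃ α : A ≃ₗ[k] A,
          (∀ a b, α (bullet a b) = lr (α a) (α b)) ∧
          (∀ a x, α (ract x a) = TensorProduct.lift ract.flip (leftSnd υ a x)) ∧
          (∀ a x, α.symm (ract x a) =
            TensorProduct.lift (ract.flip.compl₂ S.symm.toLinearMap) (rightSnd υ a (S x)))) ∧
    (∃ μ ν : A ⊗[k] A →ₗ[k] A ⊗[k] A →ₗ[k] A ⊗[k] A,
      IsRightLRSmash lact ract Γ υ μ ∧ IsAssocMul μ ∧
      IsRightTwistedSmash S lact ract Γ υ ν ∧ IsAssocMul ν ∧ AreIsomorphic μ ν) ∧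
    (∃ μ ν : A ⊗[k] A →ₗ[k] A ⊗[k] A →ₗ[k] A ⊗[k] A,
      IsLeftLRSmash lact ract Γ υ μ ∧ IsAssocMul μ ∧
      IsLeftTwistedSmash S lact ract Γ υ ν ∧ IsAssocMul ν ∧ AreIsomorphic μ ν) := by
  obtain ⟨ε, hS⟩ := isAntipode_iff.1 hS
  have hE := hΔ.enveloping
  have mE := hLong.bimodule.isLeftModuleAlgebra_enveloping hΔ
  have cE := hLong.bicomodule.isCoaction_enveloping hΔ hS hA
  have lE := hLong.long_enveloping S
  obtain ⟨Ψ, Ψ', Φ, Φ', hT⟩ := hLong.exists_isTwistSystem hΔ hS hA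
  obtain ⟨α, hα, hα'⟩ := hLong.rightRight.exists_contraction hΔ hS hA
  have hm : ∀ a b, α (twistedMul (Φ' ∘ₗ Ψ) a b) = lrMul Φ Ψ (α a) (α b) :=
    hLong.contraction_twistedMul hΔ hA hT hα
  have hbullet : IsAssocMul (twistedMul (Φ' ∘ₗ Ψ)) :=
    isAssocMul_twistedMul hT.mulLeft_comp hT.mulRight_comp
      (hT.comp.adjacent_commute mE.isUnitalAction fun x y a => lE x y a)
  have hR := coactRight_ofCompatible hE.nondegenerate hA cE.compat
  refine ⟨hE, ⟨ofCompatible hE.nondegenerate hA cE.compat, fun a x y => ?_,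
    ⟨mE, cE.isLeftComoduleAlgebra hE.nondegenerate hA
      (hLong.bicomodule.isMultiplicative_enveloping hΔ.nondegenerate hA S), fun x y a => ?_⟩,
    twistedMul (Φ' ∘ₗ Ψ), lrMul Φ Ψ, fun a b x => ?_, hbullet,
    hLong.isLRTwistedProduct hT fun x => ?_, AreIsomorphic.isAssocMul ⟨α, hm⟩ hbullet,
    α, hm, fun a x => ?_, hα'⟩,
    ⟨_, _, hT.isRightLRSmash, ?_, hT.isRightTwistedSmash hLong.bimodule.assoc, ?_, ?_⟩,
    ⟨_, _, hT.isLeftLRSmash, hT.leftIso.isAssocMul hT.isAssocMul_left, hT.isLeftTwistedSmash,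
      hT.isAssocMul_left, hT.leftIso.symm⟩⟩
  · rw [ofCompatible_mul_fstM, twoLegs_opCoact]
  · rw [← coactRight_tmul, ← coactRight_tmul, hR, lE]
  · rw [← coactRight_tmul, hR, twistedMul_apply, hT.comp]
    generalize twoLegs (coactRight Γ) (opCoact S (rcoactRight υ)) (x ⊗ₜ a) = t
    induction t with
    | zero => simp
    | add s s' hs hs' => simp only [map_add, hs, hs']
    | tmul i j => rfl
  · exact hT.right.map_lTensor hLong.bimodule.right.unital fun y m =>
      hLong.leftRight.rcoactLeft_act hΔ hA y x m
  · refine (isContraction_opAction hα (x ⊗ₜ a)).trans ?_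
    rw [rcoactLeft_tmul]
    generalize leftSnd υ a x = t
    induction t with
    | zero => simp
    | add s s' hs hs' => simp only [map_add, hs, hs']
    | tmul i j => rfl
  · exact (areIsomorphic_transport _ _).isAssocMul (hT.rightIso.isAssocMul hT.isAssocMul_right)
  · exact (areIsomorphic_transport _ _).isAssocMul hT.isAssocMul_right
  · exact ((areIsomorphic_transport _ _).symm.trans hT.rightIso.symm).trans
      (areIsomorphic_transport _ _)
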